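/- **Theorem 3.1 (Hybrid Minimum Principle).** Let $\mathcal M$ be a smooth $n$-dimensional Riemannian manifold with metric $g$ (Hausdorff, second countable, without boundary), let $U\subset\mathbb R^m$ be compact, and let $f_{q_0},f_{q_1}:\mathcal M\times U\to T\mathcal M$ be smooth controlled vector fields. Let $\mathcal S\subset\mathcal M$ be an embedded smooth hypersurface (codimension $1$, not necessarily closed), let $\zeta:\mathcal M\to\mathcal M$ be smooth and let $h:\mathcal M\to\mathbb R$ be $C^1$. Fix $t_0<t_f<\infty$ and $x_0\in\mathcal M\setminus\mathcal S$. For $u:[t_0,t_f)\to U$ measurable, call $t$ a *Lebesgue point* of $u$ if $\frac1\epsilon\int_t^{t+\epsilon}|u(\tau)-u(t)|\,d\tau\to0$ as $\epsilon\downarrow0$, and say that $u(t^-)=w$ if $\frac1\epsilon\int_{t-\epsilon}^{t}|u(\tau)-w|\,d\tau\to0$ as $\epsilon\downarrow0$. A *trajectory with one switching* consists of a measurable control $u:[t_0,t_f)\to U$, a time $t_s\in(t_0,t_f)$ at which $u(t_s^-)$ exists, and a curve $x:[t_0,t_f]\to\mathcal M$ such that * $x$ is absolutely continuous on $[t_0,t_s)$,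 up to $t_s$ when completed there by its left limit $x(t_s^-)$, with $x(t_0)=x_0$ and $\dot x=f_{q_0}(x,u)$ a.e. on $[t_0,t_s)$; * $x(t)\notin\mathcal S$ for $t\in[t_0,t_s)$, $x(t_s^-)\in\mathcal S$, and the crossing is transversal: $f_{q_0}(x(t_s^-),u(t_s^-))\notin T_{x(t_s^-)}\mathcal S$; * $x(t_s)=\zeta(x(t_s^-))$, and $x$ is absolutely continuous on $[t_s,t_f]$ with $\dot x=f_{q_1}(x,u)$ a.e. Let $(u^o,t_s,x^o)$ minimize $h(x(t_f))$ among all trajectories with one switching (with $t_0,t_f,x_0$ fixed). Assume that $t_s$ is a Lebesgue point of $u^o$ and that $x^o(t)\notin\overline{\mathcal S}$ for $t\in[t_0,t_s)$ (which is automatic if $\mathcal S$ is closed). Put $H_{q_i}(x,p,v)=\langle p,f_{q_i}(x,v)\rangle$ for $p\in T^*_x\mathcal M$, $v\in U$. Then there is an adjoint curve $\lambda^o(t)=(x^o(t),p^o(t))\in T^*\mathcal M$, $t\in[t_0,t_f]$, with a left limit $p^o(t_s^-)\in T^*_{x^o(t_s^-)}\mathcal M$, such that: 1. $\lambda^o$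 is absolutely continuous on each of $[t_0,t_s)$ (up to $t_s^-$) and $[t_s,t_f]$, and satisfies Hamilton's equations $\dot\lambda^o=\overrightarrow{H}_{q_i}(\lambda^o)$ for the control $u^o(t)$ (in canonical coordinates, $\dot x=\partial H_{q_i}/\partial p$, $\dot p=-\partial H_{q_i}/\partial x$) almost everywhere, with $i=0$ on $[t_0,t_s)$ and $i=1$ on $[t_s,t_f]$; 2. $H_{q_i}(x^o(t),p^o(t),u^o(t))\le H_{q_i}(x^o(t),p^o(t),v)$ for all $v\in U$, for almost every $t$ and for every Lebesgue point $t$ of $u^o$, with $i=0$ on $[t_0,t_s)$ and $i=1$ on $[t_s,t_f)$; 3. $p^o(t_f)=dh(x^o(t_f))$; and if $dh(x^o(t_f))\neq0$, then $\lambda^o$ is nontrivial: $p^o(t)\ne0$ for all $t\in[t_s,t_f]$; 4. there are a nonzero vector $N\in T_{x^o(t_s^-)}\mathcal M$ that is $g$-orthogonal to $T_{x^o(t_s^-)}\mathcal S$ and a $\mu\in\mathbb R$ such that, with $dN:=g(N,\cdot)$, $$p^o(t_s^-)=T^*\zeta\,(p^o(t_s))+\mu\,dN,$$ where $T^*\zeta(\alpha)=\alpha\circ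 T_{x^o(t_s^-)}\zeta$; 5. $H_{q_0}(x^o(t_s^-),p^o(t_s^-),u^o(t_s^-))=H_{q_1}(x^o(t_s),p^o(t_s),u^o(t_s))$. -/

import Mathlib

open scoped Manifold ContDiff Topology
open Set Filter MeasureTheory

noncomputable section

namespace HybridControl

/-- The cotangent space `T*_x M`. -/
abbrev CotangentSpaceAt (n : ℕ) {M : Type*} [TopologicalSpace M]
    [ChartedSpace (EuclideanSpace ℝ (Fin n)) M] (x : M) : Type :=
  TangentSpace (𝓡 n) x →L[ℝ] ℝ

/-- `w` is the left value `u(t⁻)` of `u` at `t`, in the sense of Lebesgue points: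
`(1/ε) ∫_{t-ε}^{t} |u(τ) - w| dτ → 0` as `ε ↓ 0`. -/
def IsLeftLebesgueValue {m : ℕ} (u : ℝ → EuclideanSpace ℝ (Fin m)) (t : ℝ)
    (w : EuclideanSpace ℝ (Fin m)) : Prop :=
  Tendsto (fun ε : ℝ => (1 / ε) * ∫ τ in (t - ε)..t, ‖u τ - w‖) (𝓝[>] 0) (𝓝 0)

/-- `t` is a Lebesgue point of `u`:
`(1/ε) ∫_{t}^{t+ε} |u(τ) - u(t)| dτ → 0` as `ε ↓ 0`. -/
def IsLebesguePoint {m : ℕ} (u : ℝ → EuclideanSpace ℝ (Fin m)) (t : ℝ) : Prop :=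
  Tendsto (fun ε : ℝ => (1 / ε) * ∫ τ in t..(t + ε), ‖u τ - u t‖) (𝓝[>] 0) (𝓝 0)

section Manifold

variable {n m : ℕ} {M : Type*} [TopologicalSpace M]
  [ChartedSpace (EuclideanSpace ℝ (Fin n)) M]

/-- `S` is an embedded submanifold of codimension one (not necessarily closed in `M`): near each of
its points it is the zero set of a smooth function with nonvanishing differential. -/
def IsEmbeddedHypersurface (n : ℕ) {M : Type*} [TopologicalSpace M]
    [ChartedSpace (EuclideanSpace ℝ (Fin n)) M] (S : Set M) : Prop :=
  ∀ x ∈ S, ∃ V : Set M, IsOpen V ∧ x ∈ V ∧ ∃ φ : M → ℝ,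
    ContMDiffOn (𝓡 n) 𝓘(ℝ, ℝ) ∞ φ V ∧
    (∀ y ∈ V, y ∈ S ↔ φ y = 0) ∧
    (∀ y ∈ V, mfderiv (𝓡 n) 𝓘(ℝ, ℝ) φ y ≠ 0)

/-- `v ∈ T_x S`, for a point `x` of an embedded submanifold `S`: every function which is smooth
near `x` and vanishes on `S` near `x` has zero derivative along `v`. -/
def IsTangentTo (S : Set M) (x : M) (v : TangentSpace (𝓡 n) x) : Prop :=
  ∀ φ : M → ℝ, ContMDiffAt (𝓡 n) 𝓘(ℝ, ℝ) ∞ φ x → (∀ᶠ y in 𝓝[S] x, φ y = 0) →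
    mfderiv (𝓡 n) 𝓘(ℝ, ℝ) φ x v = 0

/-- The curve `x` is absolutely continuous on `[a, b]`: it is continuous, and absolutely continuous
in each chart on each subinterval which it maps into the domain of this chart. -/
def IsACCurve (n : ℕ) {M : Type*} [TopologicalSpace M]
    [ChartedSpace (EuclideanSpace ℝ (Fin n)) M] (x : ℝ → M) (a b : ℝ) : Prop :=
  ContinuousOn x (Icc a b) ∧
  ∀ (q : M) (c d : ℝ), a ≤ c → c ≤ d → d ≤ b →
    MapsTo x (Icc c d) (chartAt (EuclideanSpace ℝ (Fin n)) q).source →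
    AbsolutelyContinuousOnInterval (fun t => extChartAt (𝓡 n) q (x t)) c d

/-- `x` is an absolutely continuous solution of `ẋ(t) = f(x(t), u(t))`, a.e. `t ∈ [a, b]`. -/
def IsControlledCurve (f : (x : M) → EuclideanSpace ℝ (Fin m) → TangentSpace (𝓡 n) x)
    (u : ℝ → EuclideanSpace ℝ (Fin m)) (x : ℝ → M) (a b : ℝ) : Prop :=
  IsACCurve n x a b ∧
  ∀ᵐ t : ℝ, t ∈ Ioo a b →
    HasMFDerivAt 𝓘(ℝ, ℝ) (𝓡 n) x t ((1 : ℝ →L[ℝ] ℝ).smulRight (f (x t) (u t)))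

/-- The Hamiltonian `H(x, p, v) = ⟨p, f(x, v)⟩` of a controlled vector field. -/
def hamiltonian (f : (x : M) → EuclideanSpace ℝ (Fin m) → TangentSpace (𝓡 n) x)
    (x : M) (p : CotangentSpaceAt n x) (v : EuclideanSpace ℝ (Fin m)) : ℝ :=
  p (f x v)

/-- The cotangent map `T*ζ : T*_{ζ(x)} M → T*_x M`, `T*ζ(α) = α ∘ T_x ζ`. -/
def cotangentMap (ζ : M → M) (x : M) (α : CotangentSpaceAt n (ζ x)) : CotangentSpaceAt n x :=
  α.comp (mfderiv (𝓡 n) (𝓡 n) ζ x)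

/-- `u(t)` minimizes `v ↦ H(x(t), p(t), v)` over `U`, at almost every `t ∈ [a, b)` and, more
precisely, at every Lebesgue point `t ∈ [a, b)` of `u`. -/
def MinimizesHamiltonian (f : (x : M) → EuclideanSpace ℝ (Fin m) → TangentSpace (𝓡 n) x)
    (U : Set (EuclideanSpace ℝ (Fin m))) (u : ℝ → EuclideanSpace ℝ (Fin m)) (x : ℝ → M)
    (p : (t : ℝ) → CotangentSpaceAt n (x t)) (a b : ℝ) : Prop :=
  (∀ᵐ t : ℝ, t ∈ Ico a b → ∀ v ∈ U,
    hamiltonian f (x t) (p t) (u t) ≤ hamiltonian f (x t) (p t) v) ∧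
  (∀ t ∈ Ico a b, IsLebesguePoint u t → ∀ v ∈ U,
    hamiltonian f (x t) (p t) (u t) ≤ hamiltonian f (x t) (p t) v)

variable [IsManifold (𝓡 n) ∞ M]

/-- The coordinates `(p_1, …, p_n)` of the covector `p ∈ T*_x M` with respect to the chart at `q`
(as a linear form on the model space). -/
def covectorCoord (q x : M) (p : CotangentSpaceAt n x) : EuclideanSpace ℝ (Fin n) →L[ℝ] ℝ :=
  p.comp ((trivializationAt (EuclideanSpace ℝ (Fin n)) (TangentSpace (𝓡 n) : M → Type _) q).symmL
    ℝ x)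

/-- The covector at `x` with coordinates `π` with respect to the chart at `q`. -/
def covectorOfCoord (q x : M) (π : EuclideanSpace ℝ (Fin n) →L[ℝ] ℝ) : CotangentSpaceAt n x :=
  π.comp ((trivializationAt (EuclideanSpace ℝ (Fin n))
    (TangentSpace (𝓡 n) : M → Type _) q).continuousLinearMapAt ℝ x)

/-- The Hamiltonian `H(ξ, π, v)` in the canonical coordinates `(ξ, π)` of the cotangent bundle
induced by the chart at `q`. -/
def localHamiltonian (f : (x : M) → EuclideanSpace ℝ (Fin m) → TangentSpace (𝓡 n) x) (q : M)
    (ξ : EuclideanSpace ℝ (Fin n)) (π : EuclideanSpace ℝ (Fin n) →L[ℝ] ℝ)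
    (v : EuclideanSpace ℝ (Fin m)) : ℝ :=
  hamiltonian f ((extChartAt (𝓡 n) q).symm ξ)
    (covectorOfCoord q ((extChartAt (𝓡 n) q).symm ξ) π) v

/-- The curve `λ(t) = (x(t), p(t))` in `T*M` is an absolutely continuous solution on `[a, b]` of
Hamilton's equations `λ' = H⃗(λ)` of `H(·, ·, u(t))`; that is, in the canonical coordinates
`(ξ, π)` over each chart, `ξ' = ∂H/∂π` and `π' = -∂H/∂ξ` almost everywhere. -/
def IsHamiltonianCurve (f : (x : M) → EuclideanSpace ℝ (Fin m) → TangentSpace (𝓡 n) x)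
    (u : ℝ → EuclideanSpace ℝ (Fin m)) (x : ℝ → M)
    (p : (t : ℝ) → CotangentSpaceAt n (x t)) (a b : ℝ) : Prop :=
  IsACCurve n x a b ∧
  (∀ (q : M) (c d : ℝ), a ≤ c → c ≤ d → d ≤ b →
    MapsTo x (Icc c d) (chartAt (EuclideanSpace ℝ (Fin n)) q).source →
    AbsolutelyContinuousOnInterval (fun t => covectorCoord q (x t) (p t)) c d) ∧
  (∀ q : M, ∀ᵐ t : ℝ, t ∈ Ioo a b → x t ∈ (chartAt (EuclideanSpace ℝ (Fin n)) q).source →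
    ∃ (ξ' : EuclideanSpace ℝ (Fin n)) (π' : EuclideanSpace ℝ (Fin n) →L[ℝ] ℝ),
      HasDerivAt (fun s => extChartAt (𝓡 n) q (x s)) ξ' t ∧
      HasDerivAt (fun s => covectorCoord q (x s) (p s)) π' t ∧
      (∀ η : EuclideanSpace ℝ (Fin n) →L[ℝ] ℝ,
        η ξ' = fderiv ℝ (fun π => localHamiltonian f q (extChartAt (𝓡 n) q (x t)) π (u t))
          (covectorCoord q (x t) (p t)) η) ∧
      π' = -fderiv ℝ (fun ξ => localHamiltonian f q ξ (covectorCoord q (x t) (p t)) (u t))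
          (extChartAt (𝓡 n) q (x t)))

end Manifold

/-- An impulsive hybrid system on `M` with two discrete states `0`, `1` and one switching manifold
`S`, on which the autonomous transition `0 → 1` takes place, with state jump `ζ`. -/
structure ImpulsiveHybridSystem (n m : ℕ) (M : Type*) [TopologicalSpace M]
    [ChartedSpace (EuclideanSpace ℝ (Fin n)) M] [IsManifold (𝓡 n) ∞ M] where
  /-- the admissible control values -/
  U : Set (EuclideanSpace ℝ (Fin m))
  isCompact_U : IsCompact U
  /-- the controlled vector fields, one for each discrete state -/
  f : Fin 2 → (x : M) → EuclideanSpace ℝ (Fin m) → TangentSpace (𝓡 n) x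
  smooth_f : ∀ q : Fin 2, ContMDiffOn ((𝓡 n).prod (𝓡 m)) (𝓡 n).tangent ∞
    (fun z : M × EuclideanSpace ℝ (Fin m) => (⟨z.1, f q z.1 z.2⟩ : TangentBundle (𝓡 n) M))
    (univ ×ˢ U)
  /-- the switching manifold -/
  S : Set M
  hypersurface_S : IsEmbeddedHypersurface n S
  /-- the jump map -/
  ζ : M → M
  smooth_ζ : ContMDiff (𝓡 n) (𝓡 n) ∞ ζ

section System

variable {n m : ℕ} {M : Type*} [TopologicalSpace M]
  [ChartedSpace (EuclideanSpace ℝ (Fin n)) M] [IsManifold (𝓡 n) ∞ M]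

/-- The admissible control `u` generates, from the initial state `x₀ ∉ S` and the discrete state
`0`, a hybrid trajectory on `[t₀, t_f]` with exactly one switching, at time `t_s`. The curve `y` is
the state on `[t₀, t_s)`, completed by `y(t_s) = x(t_s⁻)`, and `z` is the state on `[t_s, t_f]`;
`w` is the left value `u(t_s⁻)`. The curve `y` meets `S` at `t_s` for the first time, and does so
transversally. -/
structure IsHybridTrajectory (𝓗 : ImpulsiveHybridSystem n m M) (t₀ t_f : ℝ) (x₀ : M)
    (u : ℝ → EuclideanSpace ℝ (Fin m)) (t_s : ℝ) (y z : ℝ → M)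
    (w : EuclideanSpace ℝ (Fin m)) : Prop where
  lt_switch : t₀ < t_s
  switch_lt : t_s < t_f
  measurable_u : Measurable u
  u_mem : ∀ t ∈ Ico t₀ t_f, u t ∈ 𝓗.U
  init : y t₀ = x₀
  dynamics₀ : IsControlledCurve (𝓗.f 0) u y t₀ t_s
  notMem_S : ∀ t ∈ Ico t₀ t_s, y t ∉ 𝓗.S
  mem_S : y t_s ∈ 𝓗.S
  leftValue : IsLeftLebesgueValue u t_s w
  transversal : ¬ IsTangentTo 𝓗.S (y t_s) (𝓗.f 0 (y t_s) w)
  jump : z t_s = 𝓗.ζ (y t_s)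
  dynamics₁ : IsControlledCurve (𝓗.f 1) u z t_s t_f

/-- The hybrid trajectory is optimal for the Mayer problem with terminal cost `h`: it minimizes
`h(x(t_f))` among all hybrid trajectories from the same initial state on the same time interval
with the same sequence of discrete transitions. -/
def IsMayerOptimal (𝓗 : ImpulsiveHybridSystem n m M) (h : M → ℝ) (t₀ t_f : ℝ) (x₀ : M)
    (u : ℝ → EuclideanSpace ℝ (Fin m)) (t_s : ℝ) (y z : ℝ → M)
    (w : EuclideanSpace ℝ (Fin m)) : Prop :=
  IsHybridTrajectory 𝓗 t₀ t_f x₀ u t_s y z w ∧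
  ∀ u' t_s' y' z' w', IsHybridTrajectory 𝓗 t₀ t_f x₀ u' t_s' y' z' w' → h (z t_f) ≤ h (z' t_f)

end System

end HybridControl

end

/-!
The proof compares the optimal trajectory with the trajectories of needle variations, and computes
the first-order change of the cost.

*Variations.* All variations are of one kind: a measurable time-dependent vector field with values
in a family which is locally bounded in `C¹`, with equicontinuous derivatives, is changed on a set
of times of measure `O(ε)`. Gronwall-type estimates in charts, continued along the trajectory by
interval induction, show that perturbed trajectories `xε` exist and are `O(ε)`-close to the nominal
one `x`, and that for an adjoint curve `p` along `x` the pairing of `p` with the displacement of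
`xε` changes from time `a` to time `b` by `∫ t in a..b, (p (gε t x) - p (g t x)) + o(ε)`
(`IsPerturbation.hasVariation`, `IsPerturbation.exists_family`). A displacement is measured by
functions on `M` with prescribed differential (`HasVariation`), which makes sense without reference
to charts and composes with the jump map.

*After the switching.* A needle with value `v` at a Lebesgue point `t₁` leaves the switching
unchanged, and changes the cost by `ε (H(v) - H(u(t₁))) + o(ε)`, which has to be nonnegative
(`IsMayerOptimal.le_after_switch`).

*Before the switching.* A needle variation moves the switching time by `O(ε)`. The perturbed
trajectory follows the needle variation up to the time `t_s - C ε`, and then the constant control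
`w = u(t_s⁻)` until it hits the switching manifold, at a time `s ε < t_s + C ε` (`exists_hitting`).
It does not meet the manifold earlier: away from `t_s` because the optimal trajectory avoids the
closure of the manifold, and near `t_s` because a defining function `φ` of the manifold is at most
`-(t_s - t) / 2` along the optimal trajectory while the perturbation changes it by only `O(ε)`.
After the jump the control is `u(t_s)` until `t_s + C ε`, and then `u` (`exists_restart`). The
displacement at the switching, paired with `p(t_s⁻)`, is
`ε (H(v) - H(u(t₁))) + (s ε - t_s) H₀ + o(ε)`. Because `φ` vanishes at the hitting point, the term
`μ dφ` of `p(t_s⁻) = T*ζ r(t_s) + μ dφ` does not contribute, so that this is also the pairing of the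
displacement after the jump with `r(t_s)`; the restart adds `(t_s - s ε) H₁`. The multiplier `μ` is
chosen so that `H₀ = H₁`, which is possible by transversality, and then the change of the switching
time drops out of the variation of the cost (`IsMayerOptimal.le_before_switch`).

The normal vector `N` is the Riemannian gradient of `φ`; the tangent vectors of the hypersurface
are in the kernel of `dφ`, and conversely by the Lagrange multiplier rule. Nontriviality of the
adjoint curve after the switching is uniqueness for the linear adjoint equation.
-/

noncomputable section

set_option linter.unusedSectionVars false

namespace HybridControl


section

/-! ### Absolutely continuous functions and integral equations -/

/-- Induction on intervals: a transitive relation between the points of `[a, b]` which holds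
locally, near each point of `[a, b]`, holds between `a` and `b`. -/
theorem interval_induction {P : ℝ → ℝ → Prop} {a b : ℝ} (hab : a ≤ b)
    (trans : ∀ c d e, a ≤ c → c ≤ d → d ≤ e → e ≤ b → P c d → P d e → P c e)
    (loc : ∀ t ∈ Icc a b, ∃ δ > 0, ∀ c d, a ≤ c → c ≤ d → d ≤ b → t - δ < c → d < t + δ → P c d) :
    P a b := by
  choose! δ hδ h using loc
  obtain ⟨t, ht0, htm, ⟨m, hm⟩, hcov⟩ := exists_monotone_Icc_subset_open_cover_Icc hab
    (c := fun i : Icc a b => {s : Icc a b | (s : ℝ) ∈ Ioo (i - δ i : ℝ) (i + δ i)})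
    (fun i => isOpen_Ioo.preimage continuous_subtype_val)
    (fun s _ => mem_iUnion.2 ⟨s, by simp [hδ s s.2]⟩)
  have key : ∀ k, P a (t k) := by
    intro k
    induction k with
    | zero =>
      rw [ht0]
      exact h a ⟨le_rfl, hab⟩ a a le_rfl le_rfl hab (by linarith [hδ a ⟨le_rfl, hab⟩])
        (by linarith [hδ a ⟨le_rfl, hab⟩])
    | succ k ih =>
      have hle : t k ≤ t (k + 1) := htm (Nat.le_succ k)
      obtain ⟨i, hi⟩ := hcov k
      exact trans _ _ _ le_rfl (t k).2.1 hle (t (k + 1)).2.2 ih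
        (h i i.2 _ _ (t k).2.1 hle (t (k + 1)).2.2 (hi ⟨le_rfl, hle⟩).1 (hi ⟨hle, le_rfl⟩).2)
  simpa [hm m le_rfl] using key m

section AC

variable {X : Type*} [PseudoMetricSpace X]

/-- Absolute continuity is preserved by a monotone, nonexpanding change of the parameter. -/
theorem _root_.AbsolutelyContinuousOnInterval.comp_monotone {f : ℝ → X} {κ : ℝ → ℝ} {a b c d : ℝ}
    (hf : AbsolutelyContinuousOnInterval f a b) (hκ : Monotone κ)
    (hκ1 : ∀ s t, dist (κ s) (κ t) ≤ dist s t) (hmap : MapsTo κ (uIcc c d) (uIcc a b)) :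
    AbsolutelyContinuousOnInterval (f ∘ κ) c d := by
  rw [absolutelyContinuousOnInterval_iff] at hf ⊢
  intro ε hε
  obtain ⟨δ, hδ, h⟩ := hf ε hε
  refine ⟨δ, hδ, fun E hE hlen => ?_⟩
  refine h (E.1, fun i => (κ (E.2 i).1, κ (E.2 i).2)) ⟨fun i hi => ⟨hmap (hE.1 i hi).1,
    hmap (hE.1 i hi).2⟩, ?_⟩ ((Finset.sum_le_sum fun i _ => hκ1 _ _).trans_lt hlen)
  intro i hi j hj hij
  have hd := hE.2 hi hj hij
  simp only [Function.onFun, uIoc, Set.Ioc_disjoint_Ioc] at hd ⊢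
  simpa only [hκ.map_min, hκ.map_max] using hκ hd

theorem _root_.AbsolutelyContinuousOnInterval.congr {f g : ℝ → X} {a b : ℝ}
    (hf : AbsolutelyContinuousOnInterval f a b) (h : EqOn g f (uIcc a b)) :
    AbsolutelyContinuousOnInterval g a b := by
  rw [absolutelyContinuousOnInterval_iff] at hf ⊢
  intro ε hε
  obtain ⟨δ, hδ, H⟩ := hf ε hε
  refine ⟨δ, hδ, fun E hE hlen => ?_⟩
  rw [Finset.sum_congr rfl fun i hi => by rw [h (hE.1 i hi).1, h (hE.1 i hi).2]]
  exact H E hE hlen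

end AC

section FTC

variable {E : Type*} [NormedAddCommGroup E]

/-- Absolute continuity on two adjacent intervals: `f` is the sum of its restrictions, each
extended by a constant. -/
theorem _root_.AbsolutelyContinuousOnInterval.trans {f : ℝ → E} {a b c : ℝ} (hab : a ≤ b)
    (hbc : b ≤ c) (h₁ : AbsolutelyContinuousOnInterval f a b)
    (h₂ : AbsolutelyContinuousOnInterval f b c) : AbsolutelyContinuousOnInterval f a c := by
  have k₁ : AbsolutelyContinuousOnInterval (f ∘ fun t => min t b) a c := by
    refine h₁.comp_monotone (fun s t hst => min_le_min_right b hst) (fun s t => ?_) (fun t ht => ?_)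
    · simp only [Real.dist_eq]
      simpa using abs_min_sub_min_le_max s b t b
    · rw [uIcc_of_le (hab.trans hbc)] at ht
      rw [uIcc_of_le hab]
      exact ⟨le_min ht.1 hab, min_le_right _ _⟩
  have k₂ : AbsolutelyContinuousOnInterval (f ∘ fun t => max t b) a c := by
    refine h₂.comp_monotone (fun s t hst => max_le_max_right b hst) (fun s t => ?_) (fun t ht => ?_)
    · simp only [Real.dist_eq]
      simpa using abs_max_sub_max_le_max s b t b
    · rw [uIcc_of_le (hab.trans hbc)] at ht
      rw [uIcc_of_le hbc]
      exact ⟨le_max_right _ _, max_le ht.2 hbc⟩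
  have k₃ : AbsolutelyContinuousOnInterval (fun _ : ℝ => f b) a c :=
    ((LipschitzWith.const' (K := 0) (f b)).lipschitzOnWith).absolutelyContinuousOnInterval
  refine ((k₁.add k₂).sub k₃).congr fun t _ => ?_
  rcases le_total t b with h | h <;> simp [h]

variable [NormedSpace ℝ E]

theorem lipschitzOnWith_integral {G : ℝ → E} {c d B : ℝ} (hB : 0 ≤ B)
    (hG : IntervalIntegrable G volume c d) (hGB : ∀ t ∈ Icc c d, ‖G t‖ ≤ B) {t₀ : ℝ}
    (ht₀ : t₀ ∈ Icc c d) :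
    LipschitzOnWith ⟨B, hB⟩ (fun t => ∫ s in t₀..t, G s) (Icc c d) := by
  have hcd : c ≤ d := ht₀.1.trans ht₀.2
  refine LipschitzOnWith.of_dist_le_mul fun s hs t ht => ?_
  have hint : ∀ {x y}, x ∈ Icc c d → y ∈ Icc c d → IntervalIntegrable G volume x y :=
    fun hx hy => hG.mono_set (by
      rw [uIcc_of_le hcd]; exact uIcc_subset_Icc hx hy)
  rw [dist_eq_norm, intervalIntegral.integral_interval_sub_left (hint ht₀ hs) (hint ht₀ ht),
    Real.dist_eq]
  exact intervalIntegral.norm_integral_le_of_norm_le_const fun x hx =>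
    hGB x (uIcc_subset_Icc ht hs (uIoc_subset_uIcc hx))

/-- The fundamental theorem of calculus for an absolutely continuous curve with bounded
derivative. -/
theorem _root_.AbsolutelyContinuousOnInterval.eq_add_integral [CompleteSpace E] {f G : ℝ → E} {c d B : ℝ}
    (hf : AbsolutelyContinuousOnInterval f c d) (hB : 0 ≤ B)
    (hG : IntervalIntegrable G volume c d) (hGB : ∀ t ∈ Icc c d, ‖G t‖ ≤ B)
    (hder : ∀ᵐ t, t ∈ Ioo c d → HasDerivAt f (G t) t) {t₀ t : ℝ} (ht₀ : t₀ ∈ Icc c d)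
    (ht : t ∈ Icc c d) : f t = f t₀ + ∫ s in t₀..t, G s := by
  have hcd : c ≤ d := ht.1.trans ht.2
  have hl := lipschitzOnWith_integral hB hG hGB ht₀
  rw [← uIcc_of_le hcd] at hl
  obtain ⟨C, hC⟩ := (hf.sub hl.absolutelyContinuousOnInterval).const_of_ae_hasDerivAt_zero (by
    have h₁ : ∀ᵐ x : ℝ, x ≠ c := by simp [ae_iff, measure_singleton]
    have h₂ : ∀ᵐ x : ℝ, x ≠ d := by simp [ae_iff, measure_singleton]
    filter_upwards [hder, hG.ae_hasDerivAt_integral, h₁, h₂] with x hx hx' hc hd hxcd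
    rw [uIcc_of_le hcd] at hxcd hx'
    have := (hx ⟨lt_of_le_of_ne hxcd.1 hc.symm, lt_of_le_of_ne hxcd.2 hd⟩).sub
      (hx' hxcd t₀ ht₀)
    rwa [sub_self] at this)
  rw [uIcc_of_le hcd] at hC
  have e₁ := hC t ht
  have e₂ := hC t₀ ht₀
  simp only [Pi.sub_apply, intervalIntegral.integral_same, sub_zero] at e₁ e₂
  rw [e₂, ← e₁]; abel

end FTC

section Caratheodory

variable {E : Type*} [NormedAddCommGroup E] [NormedSpace ℝ E] [FiniteDimensional ℝ E]
  [MeasurableSpace E] [BorelSpace E]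

/-- A function of `(t, x)` which is measurable in `t` and continuous in `x ∈ K` (a Carathéodory
function) is measurable along measurable curves in `K`. -/
theorem measurable_comp_curve {F : Type*} [MeasurableSpace F] [PseudoEMetricSpace F]
    [BorelSpace F] {G : ℝ → E → F} {K : Set E}
    (hG : ∀ x ∈ K, Measurable fun t => G t x) (hc : ∀ t, ContinuousOn (G t) K) {X : ℝ → E}
    (hX : Measurable X) (hK : ∀ t, X t ∈ K) : Measurable fun t => G t (X t) := by
  have := FiniteDimensional.proper ℝ E
  have h := measurable_uncurry_of_continuous_of_measurable (u := fun (x : K) t => G t x)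
    (fun t => continuousOn_iff_continuous_domRestrict.1 (hc t)) (fun x => hG x x.2)
  exact h.comp ((hX.subtype_mk (h := hK)).prodMk measurable_id)

/-- Existence of solutions, on a short interval and with initial time `t₀` anywhere in it, of a
differential equation whose right-hand side is measurable in time and Lipschitz in space. -/
theorem exists_integral_solution {G : ℝ → E → E} (hG : ∀ x, Measurable fun t => G t x)
    {L : NNReal} (hL : ∀ t, LipschitzWith L (G t)) {B : ℝ} (hB : ∀ t, ‖G t 0‖ ≤ B) {c d : ℝ}
    (hsmall : L * (d - c) ≤ 1 / 2) {t₀ : ℝ} (ht₀ : t₀ ∈ Icc c d) (x₀ : E) :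
    ∃ X : ℝ → E, Continuous X ∧ ∀ t ∈ Icc c d, X t = x₀ + ∫ s in t₀..t, G s (X s) := by
  have hcd : c ≤ d := ht₀.1.trans ht₀.2
  have hint : ∀ (X : ℝ → E), Continuous X → ∀ x y, IntervalIntegrable (fun s => G s (X s))
      volume x y := by
    intro X hX x y
    have hdom : Continuous fun s => B + L * ‖X s‖ := by fun_prop
    refine (hdom.intervalIntegrable x y).mono_fun
      (measurable_comp_curve (K := univ) (fun x _ => hG x) (fun t => (hL t).continuous.continuousOn)
        hX.measurable fun _ => mem_univ _).aestronglyMeasurable ?_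
    refine Eventually.of_forall fun s => ?_
    have h1 : ‖G s (X s) - G s 0‖ ≤ L * ‖X s - 0‖ := (hL s).norm_sub_le _ _
    rw [sub_zero] at h1
    calc ‖G s (X s)‖ = ‖G s 0 + (G s (X s) - G s 0)‖ := by congr 1; abel
      _ ≤ ‖G s 0‖ + ‖G s (X s) - G s 0‖ := norm_add_le _ _
      _ ≤ B + L * ‖X s‖ := add_le_add (hB s) h1
      _ ≤ ‖B + L * ‖X s‖‖ := le_abs_self _
  let ext : C(Icc c d, E) → ℝ → E := fun X => IccExtend hcd X
  have hext : ∀ X, Continuous (ext X) := fun X => X.continuous.Icc_extend'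
  let T : C(Icc c d, E) → C(Icc c d, E) := fun X =>
    ⟨fun t => x₀ + ∫ s in t₀..t, G s (ext X s), by
      have := intervalIntegral.continuous_primitive (hint _ (hext X)) t₀
      exact continuous_const.add (this.comp continuous_subtype_val)⟩
  have hT : ContractingWith (1 / 2) T := by
    refine ⟨by norm_num [← NNReal.coe_lt_coe], LipschitzWith.of_dist_le_mul fun X Y => ?_⟩
    rw [ContinuousMap.dist_le (by positivity)]
    intro t
    have e : T X t - T Y t = ∫ s in t₀..t, (G s (ext X s) - G s (ext Y s)) := by
      rw [intervalIntegral.integral_sub (hint _ (hext X) _ _) (hint _ (hext Y) _ _)]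
      simp [T]
    rw [dist_eq_norm, e]
    have hb := intervalIntegral.norm_integral_le_of_norm_le_const (a := t₀) (b := t)
      (f := fun s => G s (ext X s) - G s (ext Y s)) (C := L * dist X Y) fun s _ => by
        refine ((hL s).norm_sub_le _ _).trans ?_
        rw [← dist_eq_norm]
        gcongr
        exact ContinuousMap.dist_apply_le_dist _
    refine hb.trans ?_
    have ht : |(t : ℝ) - t₀| ≤ d - c := abs_sub_le_iff.2
      ⟨by linarith [t.2.2, ht₀.1], by linarith [t.2.1, ht₀.2]⟩
    calc L * dist X Y * |(t : ℝ) - t₀| ≤ L * dist X Y * (d - c) := by gcongr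
      _ = L * (d - c) * dist X Y := by ring
      _ ≤ _ := by
        simpa using mul_le_mul_of_nonneg_right hsmall (dist_nonneg (x := X) (y := Y))
  have : Nonempty C(Icc c d, E) := ⟨0⟩
  have hfix := hT.fixedPoint_isFixedPt
  set X := ContractingWith.fixedPoint T hT
  refine ⟨ext X, hext X, fun t ht => ?_⟩
  have h1 : T X ⟨t, ht⟩ = X ⟨t, ht⟩ := by rw [hfix]
  have h2 : ext X t = X ⟨t, ht⟩ := IccExtend_of_mem hcd _ ht
  rw [h2, ← h1]
  rfl

end Caratheodory

/-- A `C¹` function of a Lipschitz curve is absolutely continuous. -/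
theorem absolutelyContinuousOnInterval_comp {E F : Type*} [NormedAddCommGroup E] [NormedSpace ℝ E]
    [NormedAddCommGroup F] [NormedSpace ℝ F] {Ψ : E → F} {O : Set E} (hO : IsOpen O)
    (hΨ : ContDiffOn ℝ 1 Ψ O) {γ : ℝ → E} {K : NNReal} {c d : ℝ} (hcd : c ≤ d)
    (hγ : LipschitzOnWith K γ (Icc c d)) (hmap : MapsTo γ (Icc c d) O) :
    AbsolutelyContinuousOnInterval (fun t => Ψ (γ t)) c d := by
  refine interval_induction (P := AbsolutelyContinuousOnInterval fun t => Ψ (γ t)) hcd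
    (fun _ _ _ _ h₁ h₂ _ => AbsolutelyContinuousOnInterval.trans h₁ h₂) fun t ht => ?_
  obtain ⟨C, s, hs, hC⟩ :=
    (hΨ.contDiffAt (hO.mem_nhds (hmap ht))).exists_lipschitzOnWith
  obtain ⟨δ, hδ, h⟩ := Metric.mem_nhdsWithin_iff.1 ((hγ.continuousOn t ht).preimage_mem_nhdsWithin hs)
  refine ⟨δ, hδ, fun a b hca hab hbd h₁ h₂ => ?_⟩
  have hsub : uIcc a b ⊆ Icc c d := by
    rw [uIcc_of_le hab]; exact Icc_subset_Icc hca hbd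
  refine LipschitzOnWith.absolutelyContinuousOnInterval (K := C * K)
    (hC.comp (hγ.mono hsub) fun x hx => h ⟨?_, hsub hx⟩)
  rw [uIcc_of_le hab] at hx
  rw [Metric.mem_ball, Real.dist_eq, abs_lt]
  constructor <;> linarith [hx.1, hx.2]

end

section

/-! ### Vector fields and covectors in charts -/

/-- The model space `ℝⁿ`. -/
abbrev Eucl (n : ℕ) : Type := EuclideanSpace ℝ (Fin n)

/-- Linear forms on the model space. As the tangent spaces of `M` are copies of the model space,
covectors at any point of `M` are represented as elements of this fixed space. -/
abbrev Covec (n : ℕ) : Type := Eucl n →L[ℝ] ℝ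

/-- Vector fields on `M`, without any regularity. Each tangent space of `M` is a copy of the model
space, so that a vector field is encoded as a map into the model space; only its expressions in
charts, see `coordField`, have a meaning independent of this identification. -/
abbrev VField (n : ℕ) (M : Type*) : Type _ := M → Eucl n

variable {n : ℕ} {M : Type*} [TopologicalSpace M] [ChartedSpace (EuclideanSpace ℝ (Fin n)) M]

/-- The chart at `q`, as a map into the model space. -/
abbrev chart (n : ℕ) {M : Type*} [TopologicalSpace M] [ChartedSpace (EuclideanSpace ℝ (Fin n)) M]
    (q : M) : PartialEquiv M (Eucl n) := extChartAt (𝓡 n) q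

theorem chart_source (q : M) : (chart n q).source = (chartAt (EuclideanSpace ℝ (Fin n)) q).source :=
  extChartAt_source _ _

theorem isOpen_chart_source (q : M) : IsOpen (chart n q).source := isOpen_extChartAt_source q

theorem isOpen_chart_target (q : M) : IsOpen (chart n q).target := isOpen_extChartAt_target q

theorem chart_continuousAt {q x : M} (hx : x ∈ (chart n q).source) : ContinuousAt (chart n q) x :=
  continuousAt_extChartAt' hx

theorem chart_symm_continuousAt {q : M} {ξ : Eucl n} (hξ : ξ ∈ (chart n q).target) :
    ContinuousAt (chart n q).symm ξ := continuousAt_extChartAt_symm'' hξ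

/-- The transition map from the chart at `q` to the chart at `q'`. -/
def transition (n : ℕ) {M : Type*} [TopologicalSpace M] [ChartedSpace (EuclideanSpace ℝ (Fin n)) M]
    (q q' : M) (ξ : Eucl n) : Eucl n := chart n q' ((chart n q).symm ξ)

/-- The domain of the transition map from the chart at `q` to the chart at `q'`. -/
def transitionDomain (n : ℕ) {M : Type*} [TopologicalSpace M]
    [ChartedSpace (EuclideanSpace ℝ (Fin n)) M] (q q' : M) : Set (Eucl n) :=
  (chart n q).target ∩ (chart n q).symm ⁻¹' (chart n q').source

theorem isOpen_transitionDomain (q q' : M) : IsOpen (transitionDomain n q q') :=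
  (continuousOn_extChartAt_symm q).isOpen_inter_preimage (isOpen_chart_target q)
    (isOpen_chart_source q')

theorem chart_mem_transitionDomain {q q' x : M} (hx : x ∈ (chart n q).source)
    (hx' : x ∈ (chart n q').source) : chart n q x ∈ transitionDomain n q q' :=
  ⟨(chart n q).map_source hx, by rwa [mem_preimage, (chart n q).left_inv hx]⟩

theorem transition_chart {q q' x : M} (hx : x ∈ (chart n q).source) :
    transition n q q' (chart n q x) = chart n q' x := by
  rw [transition, (chart n q).left_inv hx]

variable [IsManifold (𝓡 n) ∞ M]

/-- The differential of the chart at `q` at the point `x`. -/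
def toChart (q x : M) : Eucl n →L[ℝ] Eucl n :=
  (trivializationAt (EuclideanSpace ℝ (Fin n)) (TangentSpace (𝓡 n) : M → Type _)
    q).continuousLinearMapAt ℝ x

/-- The inverse of the differential of the chart at `q` at the point `x`. -/
def ofChart (q x : M) : Eucl n →L[ℝ] Eucl n :=
  (trivializationAt (EuclideanSpace ℝ (Fin n)) (TangentSpace (𝓡 n) : M → Type _) q).symmL ℝ x

theorem ofChart_comp_toChart {q x : M} (hx : x ∈ (chart n q).source) :
    (ofChart q x).comp (toChart q x) = ContinuousLinearMap.id ℝ (Eucl n) := by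
  ext1 v
  exact Bundle.Trivialization.symmL_continuousLinearMapAt (R := ℝ)
    (trivializationAt (EuclideanSpace ℝ (Fin n)) (TangentSpace (𝓡 n) : M → Type _) q)
    (b := x) (by simpa using hx) v

theorem ofChart_toChart {q x : M} (hx : x ∈ (chart n q).source) (v : Eucl n) :
    ofChart q x (toChart q x v) = v := DFunLike.congr_fun (ofChart_comp_toChart hx) v

theorem hasMFDerivAt_chart {q x : M} (hx : x ∈ (chart n q).source) :
    HasMFDerivAt (𝓡 n) 𝓘(ℝ, Eucl n) (chart n q) x (toChart q x) := by
  have h : toChart q x = mfderiv (𝓡 n) 𝓘(ℝ, Eucl n) (extChartAt (𝓡 n) q) x :=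
    TangentBundle.continuousLinearMapAt_trivializationAt (by simpa using hx)
  rw [h]
  exact (mdifferentiableAt_extChartAt (by simpa using hx)).hasMFDerivAt

theorem hasMFDerivAt_chart_symm {q x : M} (hx : x ∈ (chart n q).source) :
    HasMFDerivAt 𝓘(ℝ, Eucl n) (𝓡 n) (chart n q).symm (chart n q x) (ofChart q x) := by
  have h := TangentBundle.symmL_trivializationAt (I := 𝓡 n) (x₀ := q) (x := x) (by simpa using hx)
  have h' : ofChart q x =
      mfderivWithin 𝓘(ℝ, Eucl n) (𝓡 n) (chart n q).symm (range (𝓡 n)) (chart n q x) := h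
  rw [show range (𝓡 n) = univ by simp, mfderivWithin_univ] at h'
  rw [h']
  have h2 := mdifferentiableWithinAt_extChartAt_symm (I := 𝓡 n) ((chart n q).map_source hx)
  rw [show range (𝓡 n) = univ by simp, mdifferentiableWithinAt_univ] at h2
  exact h2.hasMFDerivAt

/-- The curve `x` in `M` has velocity `v` at time `t`. -/
def HasVelocityAt (x : ℝ → M) (v : Eucl n) (t : ℝ) : Prop :=
  HasMFDerivAt 𝓘(ℝ, ℝ) (𝓡 n) x t ((1 : ℝ →L[ℝ] ℝ).smulRight (show TangentSpace (𝓡 n) (x t) from v))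

/-- The coordinate expression of a curve has the coordinate expression of its velocity as
derivative. -/
theorem HasVelocityAt.hasDerivAt_chart {q : M} {x : ℝ → M} {t : ℝ} {v : Eucl n}
    (h : HasVelocityAt x v t) (hx : x t ∈ (chart n q).source) :
    HasDerivAt (fun s => chart n q (x s)) (toChart q (x t) v) t := by
  have h2 := (HasMFDerivAt.comp t (hasMFDerivAt_chart hx) h).hasFDerivAt
  have h3 : HasFDerivAt (fun s => chart n q (x s))
    ((toChart q (x t)).comp ((1 : ℝ →L[ℝ] ℝ).smulRight v)) t := h2
  rw [hasDerivAt_iff_hasFDerivAt]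
  refine h3.congr_fderiv ?_
  ext1
  simp

theorem hasVelocityAt_of_chart {q : M} {x : ℝ → M} {t : ℝ} {e : Eucl n}
    (hx : x t ∈ (chart n q).source) (hc : ContinuousAt x t)
    (h : HasDerivAt (fun s => chart n q (x s)) e t) :
    HasVelocityAt x (ofChart q (x t) e) t := by
  have h1 : HasMFDerivAt 𝓘(ℝ, ℝ) 𝓘(ℝ, Eucl n) (fun s => chart n q (x s)) t
      ((1 : ℝ →L[ℝ] ℝ).smulRight e) := by
    have := (hasDerivAt_iff_hasFDerivAt.1 h)
    exact (this.congr_fderiv (ContinuousLinearMap.ext_ring (by simp) :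
      _ = (1 : ℝ →L[ℝ] ℝ).smulRight e)).hasMFDerivAt
  have h2 : HasMFDerivAt 𝓘(ℝ, ℝ) (𝓡 n) ((chart n q).symm ∘ fun s => chart n q (x s)) t
      ((ofChart q (x t)).comp ((1 : ℝ →L[ℝ] ℝ).smulRight e)) :=
    HasMFDerivAt.comp (f := fun s => chart n q (x s)) t (hasMFDerivAt_chart_symm hx) h1
  have h3 : x =ᶠ[𝓝 t] (chart n q).symm ∘ fun s => chart n q (x s) := by
    filter_upwards [hc.preimage_mem_nhds ((isOpen_chart_source q).mem_nhds hx)] with s hs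
    exact ((chart n q).left_inv hs).symm
  have h4 := h2.congr_of_eventuallyEq h3
  have h5 : (ofChart q (x t)).comp ((1 : ℝ →L[ℝ] ℝ).smulRight e) =
      (1 : ℝ →L[ℝ] ℝ).smulRight (ofChart q (x t) e) := by
    ext1
    simp
  exact h4.congr_mfderiv h5

theorem hasFDerivAt_comp_chart_symm {F : Type*} [NormedAddCommGroup F] [NormedSpace ℝ F] {q x : M}
    (hx : x ∈ (chart n q).source) {θ : M → F} (hθ : MDifferentiableAt (𝓡 n) 𝓘(ℝ, F) θ x) :
    HasFDerivAt (fun ξ => θ ((chart n q).symm ξ))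
      ((show Eucl n →L[ℝ] F from mfderiv (𝓡 n) 𝓘(ℝ, F) θ x).comp (ofChart q x)) (chart n q x) := by
  have h1 := hasMFDerivAt_chart_symm hx
  have h2 : HasMFDerivAt (𝓡 n) 𝓘(ℝ, F) θ ((chart n q).symm (chart n q x))
      (show Eucl n →L[ℝ] F from mfderiv (𝓡 n) 𝓘(ℝ, F) θ x) := by
    rw [(chart n q).left_inv hx]; exact hθ.hasMFDerivAt
  exact (HasMFDerivAt.comp _ h2 h1).hasFDerivAt

theorem hasMFDerivAt_comp_chart {F : Type*} [NormedAddCommGroup F] [NormedSpace ℝ F] {q x : M}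
    (hx : x ∈ (chart n q).source) {θ : Eucl n → F} {A : Eucl n →L[ℝ] F}
    (hθ : HasFDerivAt θ A (chart n q x)) :
    HasMFDerivAt (𝓡 n) 𝓘(ℝ, F) (fun y => θ (chart n q y)) x (A.comp (toChart q x)) :=
  HasMFDerivAt.comp x hθ.hasMFDerivAt (hasMFDerivAt_chart hx)

/-- The coordinate expression of a vector field in the chart at `q`. -/
def coordField (q : M) (V : VField n M) (ξ : Eucl n) : Eucl n :=
  toChart q ((chart n q).symm ξ) (V ((chart n q).symm ξ))

theorem coordField_chart {q x : M} (hx : x ∈ (chart n q).source) (V : VField n M) :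
    coordField q V (chart n q x) = toChart q x (V x) := by
  rw [coordField, (chart n q).left_inv hx]

theorem contDiffOn_transition (q q' : M) :
    ContDiffOn ℝ ∞ (transition n q q') (transitionDomain n q q') := by
  have h := contDiffOn_ext_coord_change (I := 𝓡 n) (n := ∞) q' q
  refine h.mono fun ξ hξ => ?_
  simpa [transitionDomain, PartialEquiv.trans_source] using hξ

theorem hasFDerivAt_transition {q q' x : M} (hx : x ∈ (chart n q).source)
    (hx' : x ∈ (chart n q').source) :
    HasFDerivAt (transition n q q') ((toChart q' x).comp (ofChart q x)) (chart n q x) := by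
  have h := hasFDerivAt_comp_chart_symm hx (hasMFDerivAt_chart hx').mdifferentiableAt
  rw [(hasMFDerivAt_chart hx').mfderiv] at h
  exact h

theorem fderiv_transition {q q' : M} {ξ : Eucl n} (hξ : ξ ∈ transitionDomain n q q') :
    fderiv ℝ (transition n q q') ξ =
      (toChart q' ((chart n q).symm ξ)).comp (ofChart q ((chart n q).symm ξ)) := by
  have h := hasFDerivAt_transition ((chart n q).map_target hξ.1) hξ.2
  rw [(chart n q).right_inv hξ.1] at h
  exact h.fderiv

/-- Transformation of the coordinate expression of a vector field under a change of charts. -/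
theorem coordField_transition {q q' : M} {ξ : Eucl n} (hξ : ξ ∈ transitionDomain n q q')
    (V : VField n M) :
    coordField q' V (transition n q q' ξ) =
      fderiv ℝ (transition n q q') ξ (coordField q V ξ) := by
  rw [fderiv_transition hξ, transition, coordField_chart hξ.2, ContinuousLinearMap.comp_apply,
    coordField, ofChart_toChart ((chart n q).map_target hξ.1)]

end

section

/-! ### Families of vector fields with uniform `C¹` bounds -/

variable {n : ℕ} {M : Type*} [TopologicalSpace M] [ChartedSpace (EuclideanSpace ℝ (Fin n)) M]
  [IsManifold (𝓡 n) ∞ M]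

/-- In the chart at `q`, the fields of the family `𝓕` are bounded by `B` on the closed ball of
radius `r` around `ξ₀`, and have there derivatives which are bounded by `L` and uniformly
equicontinuous. -/
structure IsGoodBall (𝓕 : Set (VField n M)) (q : M) (ξ₀ : Eucl n) (r B L : ℝ) : Prop where
  r_pos : 0 < r
  B_nonneg : 0 ≤ B
  L_nonneg : 0 ≤ L
  subset : Metric.closedBall ξ₀ r ⊆ (chart n q).target
  differentiableAt : ∀ V ∈ 𝓕, ∀ ξ ∈ Metric.closedBall ξ₀ r, DifferentiableAt ℝ (coordField q V) ξ
  bound : ∀ V ∈ 𝓕, ∀ ξ ∈ Metric.closedBall ξ₀ r, ‖coordField q V ξ‖ ≤ B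
  bound_fderiv : ∀ V ∈ 𝓕, ∀ ξ ∈ Metric.closedBall ξ₀ r, ‖fderiv ℝ (coordField q V) ξ‖ ≤ L
  equicontinuous : ∀ η > 0, ∃ δ > 0, ∀ V ∈ 𝓕, ∀ ξ ∈ Metric.closedBall ξ₀ r,
    ∀ ξ' ∈ Metric.closedBall ξ₀ r, ‖ξ' - ξ‖ ≤ δ →
      ‖fderiv ℝ (coordField q V) ξ' - fderiv ℝ (coordField q V) ξ‖ ≤ η

/-- The family `𝓕` of vector fields is bounded in `C¹`, with equicontinuous derivatives, locally in
each chart. -/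
def IsUniformlyC1 (𝓕 : Set (VField n M)) : Prop :=
  ∀ (q : M), ∀ ξ₀ ∈ (chart n q).target, ∃ r B L, IsGoodBall 𝓕 q ξ₀ r B L

/-- The time-dependent vector field `g` takes values in the family `𝓕` and is measurable in
time. -/
structure IsAdmissible (𝓕 : Set (VField n M)) (g : ℝ → VField n M) : Prop where
  mem : ∀ t, g t ∈ 𝓕
  measurable : ∀ x, Measurable fun t => g t x

theorem IsAdmissible.measurable_coordField {𝓕 : Set (VField n M)} {g : ℝ → VField n M}
    (hg : IsAdmissible 𝓕 g) (q : M) (ξ : Eucl n) : Measurable fun t => coordField q (g t) ξ :=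
  (toChart q _).continuous.measurable.comp (hg.measurable _)

theorem IsUniformlyC1.differentiableAt {𝓕 : Set (VField n M)} (h𝓕 : IsUniformlyC1 𝓕) {q : M}
    {ξ : Eucl n} (hξ : ξ ∈ (chart n q).target) {V : VField n M} (hV : V ∈ 𝓕) :
    DifferentiableAt ℝ (coordField q V) ξ := by
  obtain ⟨r, B, L, h⟩ := h𝓕 q ξ hξ
  exact h.differentiableAt V hV ξ (Metric.mem_closedBall_self h.r_pos.le)

namespace IsGoodBall

variable {𝓕 : Set (VField n M)} {q : M} {ξ₀ : Eucl n} {r B L : ℝ}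

theorem norm_sub_le (h : IsGoodBall 𝓕 q ξ₀ r B L) {V : VField n M} (hV : V ∈ 𝓕) {ξ ξ' : Eucl n}
    (hξ : ξ ∈ Metric.closedBall ξ₀ r) (hξ' : ξ' ∈ Metric.closedBall ξ₀ r) :
    ‖coordField q V ξ' - coordField q V ξ‖ ≤ L * ‖ξ' - ξ‖ :=
  (convex_closedBall ξ₀ r).norm_image_sub_le_of_norm_hasFDerivWithin_le
    (fun x hx => (h.differentiableAt V hV x hx).hasFDerivAt.hasFDerivWithinAt)
    (h.bound_fderiv V hV) hξ hξ'

theorem continuousOn (h : IsGoodBall 𝓕 q ξ₀ r B L) {V : VField n M} (hV : V ∈ 𝓕) :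
    ContinuousOn (coordField q V) (Metric.closedBall ξ₀ r) :=
  fun ξ hξ => (h.differentiableAt V hV ξ hξ).continuousAt.continuousWithinAt

theorem continuousOn_fderiv (h : IsGoodBall 𝓕 q ξ₀ r B L) {V : VField n M} (hV : V ∈ 𝓕) :
    ContinuousOn (fderiv ℝ (coordField q V)) (Metric.closedBall ξ₀ r) := by
  intro ξ hξ
  rw [Metric.continuousWithinAt_iff]
  intro ε hε
  obtain ⟨δ, hδ, H⟩ := h.equicontinuous (ε / 2) (by positivity)
  refine ⟨δ, hδ, fun {ξ'} hξ' hd => ?_⟩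
  rw [dist_eq_norm] at hd ⊢
  exact (H V hV ξ hξ ξ' hξ' hd.le).trans_lt (by linarith)

/-- First-order Taylor expansion, uniformly over the family. -/
theorem taylor (h : IsGoodBall 𝓕 q ξ₀ r B L) {η : ℝ} (hη : 0 < η) :
    ∃ δ > 0, ∀ V ∈ 𝓕, ∀ ξ ∈ Metric.closedBall ξ₀ r, ∀ ξ' ∈ Metric.closedBall ξ₀ r,
      ‖ξ' - ξ‖ ≤ δ → ‖coordField q V ξ' - coordField q V ξ -
        fderiv ℝ (coordField q V) ξ (ξ' - ξ)‖ ≤ η * ‖ξ' - ξ‖ := by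
  obtain ⟨δ, hδ, H⟩ := h.equicontinuous η hη
  refine ⟨δ, hδ, fun V hV ξ hξ ξ' hξ' hd => ?_⟩
  have hseg : segment ℝ ξ ξ' ⊆ Metric.closedBall ξ₀ r :=
    (convex_closedBall ξ₀ r).segment_subset hξ hξ'
  refine (convex_segment ξ ξ').norm_image_sub_le_of_norm_hasFDerivWithin_le'
    (fun x hx => (h.differentiableAt V hV x (hseg hx)).hasFDerivAt.hasFDerivWithinAt)
    (fun x hx => H V hV ξ hξ x (hseg hx) ?_) (left_mem_segment ℝ ξ ξ') (right_mem_segment ℝ ξ ξ')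
  refine le_trans ?_ hd
  simpa using norm_sub_le_of_mem_segment hx

/-- The derivatives of an admissible field are measurable in time, as limits of difference
quotients. -/
theorem measurable_fderiv (h : IsGoodBall 𝓕 q ξ₀ r B L) {g : ℝ → VField n M}
    (hg : IsAdmissible 𝓕 g) {ξ : Eucl n} (hξ : ξ ∈ Metric.closedBall ξ₀ r) (e : Eucl n) :
    Measurable fun t => fderiv ℝ (coordField q (g t)) ξ e := by
  refine measurable_of_tendsto_metrizable (f := fun (k : ℕ) t =>
    (k : ℝ) • (coordField q (g t) (ξ + (k : ℝ)⁻¹ • e) - coordField q (g t) ξ)) (fun k => ?_) ?_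
  · exact ((hg.measurable_coordField q _).sub (hg.measurable_coordField q _)).const_smul (k : ℝ)
  · rw [tendsto_pi_nhds]
    intro t
    refine (h.differentiableAt (g t) (hg.mem t) ξ hξ).hasFDerivAt.lim e ?_
    simpa using tendsto_natCast_atTop_atTop

end IsGoodBall

/-- On `[c, d]`, the curve `y` stays in the part of `M` which the chart at `q` maps to the closed
ball of radius `r` around `ξ₀`. -/
def StaysInBall (q : M) (ξ₀ : Eucl n) (r : ℝ) (y : ℝ → M) (c d : ℝ) : Prop :=
  ∀ t ∈ Icc c d, y t ∈ (chart n q).source ∧ chart n q (y t) ∈ Metric.closedBall ξ₀ r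

theorem intervalIntegrable_of_norm_le {F : Type*} [NormedAddCommGroup F]
    [SecondCountableTopology F] [MeasurableSpace F] [BorelSpace F] {G G' : ℝ → F} {c d B : ℝ}
    (hcd : c ≤ d) (hm : Measurable G') (heq : EqOn G G' (Icc c d))
    (hB : ∀ t ∈ Icc c d, ‖G t‖ ≤ B) : IntervalIntegrable G volume c d := by
  rw [intervalIntegrable_iff_integrableOn_Icc_of_le hcd]
  refine ⟨?_, ?_⟩
  · refine (hm.aestronglyMeasurable (μ := volume.restrict (Icc c d))).congr ?_
    filter_upwards [ae_restrict_mem measurableSet_Icc] with t ht using (heq ht).symm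
  · refine HasFiniteIntegral.restrict_of_bounded B (by simp) ?_
    filter_upwards [ae_restrict_mem measurableSet_Icc] with t ht using hB t ht

/-- `x` is an absolutely continuous solution of `ẋ(t) = g(t, x(t))`, a.e. `t ∈ [a, b]`. -/
def IsSolution (g : ℝ → VField n M) (x : ℝ → M) (a b : ℝ) : Prop :=
  IsACCurve n x a b ∧ ∀ᵐ t : ℝ, t ∈ Ioo a b → HasVelocityAt x (g t (x t)) t

namespace IsGoodBall

variable {𝓕 : Set (VField n M)} {q : M} {ξ₀ : Eucl n} {r B L : ℝ}

/-- The curve `X`, if it is continuous and lies in a set `K`, coincides on `[c, d]` with a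
measurable curve in `K`. -/
theorem _root_.ContinuousOn.exists_measurable_extension {E : Type*} [TopologicalSpace E]
    [MeasurableSpace E] [BorelSpace E] {X : ℝ → E} {K : Set E} {c d : ℝ} (hcd : c ≤ d)
    (hX : ContinuousOn X (Icc c d)) (hK : MapsTo X (Icc c d) K) :
    ∃ X' : ℝ → E, Measurable X' ∧ (∀ t, X' t ∈ K) ∧ EqOn X X' (Icc c d) :=
  ⟨fun t => X (projIcc c d hcd t),
    (hX.comp_continuous (continuous_subtype_val.comp continuous_projIcc)
      fun t => (projIcc c d hcd t).2).measurable,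
    fun t => hK (projIcc c d hcd t).2, fun t ht => by simp [projIcc_of_mem hcd ht]⟩

/-- The velocity of a curve in the chart is integrable, and bounded. -/
theorem intervalIntegrable_coordField (h : IsGoodBall 𝓕 q ξ₀ r B L) {g : ℝ → VField n M}
    (hg : IsAdmissible 𝓕 g) {X : ℝ → Eucl n} {c d : ℝ} (hcd : c ≤ d)
    (hX : ContinuousOn X (Icc c d)) (hK : MapsTo X (Icc c d) (Metric.closedBall ξ₀ r)) :
    IntervalIntegrable (fun t => coordField q (g t) (X t)) volume c d := by
  obtain ⟨X', hm, hK', heq⟩ := hX.exists_measurable_extension hcd hK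
  refine intervalIntegrable_of_norm_le (B := B) hcd
    (measurable_comp_curve (G := fun t => coordField q (g t))
      (fun x _ => hg.measurable_coordField q x) (fun t => h.continuousOn (hg.mem t)) hm hK')
    (fun t ht => ?_) (fun t ht => h.bound _ (hg.mem t) _ (hK ht))
  simp only [heq ht]

/-- A measurable extension of the matrix elements of the linearization of an admissible field along
a curve. -/
theorem exists_measurable_fderiv (h : IsGoodBall 𝓕 q ξ₀ r B L) {g : ℝ → VField n M}
    (hg : IsAdmissible 𝓕 g) {X : ℝ → Eucl n} {c d : ℝ} (hcd : c ≤ d)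
    (hX : ContinuousOn X (Icc c d)) (hK : MapsTo X (Icc c d) (Metric.closedBall ξ₀ r)) :
    ∃ D : ℝ → Eucl n →L[ℝ] Eucl n, (∀ e, Measurable fun t => D t e) ∧ (∀ t, ‖D t‖ ≤ L) ∧
      ∀ t ∈ Icc c d, D t = fderiv ℝ (coordField q (g t)) (X t) := by
  obtain ⟨X', hm, hK', heq⟩ := hX.exists_measurable_extension hcd hK
  refine ⟨fun t => fderiv ℝ (coordField q (g t)) (X' t), fun e => ?_,
    fun t => h.bound_fderiv _ (hg.mem t) _ (hK' t), fun t ht => by rw [heq ht]⟩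
  exact measurable_comp_curve (G := fun t ξ => fderiv ℝ (coordField q (g t)) ξ e)
    (fun x hx => h.measurable_fderiv hg hx e)
    (fun t => (h.continuousOn_fderiv (hg.mem t)).clm_apply continuousOn_const) hm hK'

end IsGoodBall

namespace StaysInBall

variable {𝓕 : Set (VField n M)} {q : M} {ξ₀ : Eucl n} {r B L : ℝ} {y : ℝ → M} {c d : ℝ}

theorem continuousOn (h : StaysInBall q ξ₀ r y c d) (hy : ContinuousOn y (Icc c d)) :
    ContinuousOn (fun t => chart n q (y t)) (Icc c d) := fun t ht =>
  (chart_continuousAt (h t ht).1).comp_continuousWithinAt (hy t ht)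

theorem mapsTo (h : StaysInBall q ξ₀ r y c d) :
    MapsTo (fun t => chart n q (y t)) (Icc c d) (Metric.closedBall ξ₀ r) := fun t ht => (h t ht).2

/-- A solution satisfies the integral equation in the chart. -/
theorem eq_add_integral (h : StaysInBall q ξ₀ r y c d) (hball : IsGoodBall 𝓕 q ξ₀ r B L)
    {g : ℝ → VField n M} (hg : IsAdmissible 𝓕 g) (hy : IsSolution g y c d) {s t : ℝ}
    (hs : s ∈ Icc c d) (ht : t ∈ Icc c d) :
    chart n q (y t) = chart n q (y s) + ∫ τ in s..t, coordField q (g τ) (chart n q (y τ)) := by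
  have hcd : c ≤ d := hs.1.trans hs.2
  refine AbsolutelyContinuousOnInterval.eq_add_integral
    (G := fun τ => coordField q (g τ) (chart n q (y τ)))
    (hy.1.2 q c d le_rfl hcd le_rfl fun t ht => ?_) hball.B_nonneg
    (hball.intervalIntegrable_coordField hg hcd (h.continuousOn hy.1.1) h.mapsTo)
    (fun t ht => hball.bound _ (hg.mem t) _ (h t ht).2) ?_ hs ht
  · simpa using (h t ht).1
  · filter_upwards [hy.2] with t ht htI
    have hsrc := (h t (Ioo_subset_Icc_self htI)).1
    simpa only [coordField_chart hsrc] using (ht htI).hasDerivAt_chart hsrc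

end StaysInBall

/-! ### Solutions: restriction, concatenation, construction in a chart -/

theorem IsACCurve.mono {x : ℝ → M} {a b c d : ℝ} (h : IsACCurve n x a b) (hac : a ≤ c)
    (hdb : d ≤ b) : IsACCurve n x c d :=
  ⟨h.1.mono (Icc_subset_Icc hac hdb), fun q _ _ h₁ h₂ h₃ => h.2 q _ _ (hac.trans h₁) h₂
    (h₃.trans hdb)⟩

theorem IsACCurve.trans {x : ℝ → M} {a b c : ℝ} (hab : a ≤ b) (hbc : b ≤ c)
    (h₁ : IsACCurve n x a b) (h₂ : IsACCurve n x b c) : IsACCurve n x a c := by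
  refine ⟨?_, fun q s t hs hst ht hmap => ?_⟩
  · rw [← Icc_union_Icc_eq_Icc hab hbc]
    exact h₁.1.union_of_isClosed h₂.1 isClosed_Icc isClosed_Icc
  · rcases le_total t b with htb | htb
    · exact h₁.2 q s t hs hst htb hmap
    rcases le_total b s with hbs | hbs
    · exact h₂.2 q s t hbs hst ht hmap
    · exact (h₁.2 q s b hs hbs le_rfl (hmap.mono_left (Icc_subset_Icc_right htb))).trans hbs htb
        (h₂.2 q b t le_rfl htb ht (hmap.mono_left (Icc_subset_Icc_left hbs)))

theorem IsACCurve.congr {x y : ℝ → M} {a b : ℝ} (h : IsACCurve n x a b)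
    (heq : EqOn y x (Icc a b)) : IsACCurve n y a b := by
  refine ⟨h.1.congr heq, fun q s t hs hst ht hmap => ?_⟩
  have hsub : Icc s t ⊆ Icc a b := Icc_subset_Icc hs ht
  refine (h.2 q s t hs hst ht fun τ hτ => heq (hsub hτ) ▸ hmap hτ).congr fun τ hτ => ?_
  rw [uIcc_of_le hst] at hτ
  rw [heq (hsub hτ)]

theorem IsSolution.mono {g : ℝ → VField n M} {x : ℝ → M} {a b c d : ℝ} (h : IsSolution g x a b)
    (hac : a ≤ c) (hdb : d ≤ b) : IsSolution g x c d := by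
  refine ⟨h.1.mono hac hdb, ?_⟩
  filter_upwards [h.2] with t ht htI using ht (Ioo_subset_Ioo hac hdb htI)

theorem ae_ne (b : ℝ) : ∀ᵐ t : ℝ, t ≠ b := by simp [ae_iff, measure_singleton]

theorem IsSolution.trans {g : ℝ → VField n M} {x : ℝ → M} {a b c : ℝ} (hab : a ≤ b) (hbc : b ≤ c)
    (h₁ : IsSolution g x a b) (h₂ : IsSolution g x b c) : IsSolution g x a c := by
  refine ⟨h₁.1.trans hab hbc h₂.1, ?_⟩
  filter_upwards [h₁.2, h₂.2, ae_ne b] with t ht₁ ht₂ hne htI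
  rcases lt_or_gt_of_ne hne with h | h
  · exact ht₁ ⟨htI.1, h⟩
  · exact ht₂ ⟨h, htI.2⟩

theorem IsSolution.congr {g g' : ℝ → VField n M} {x y : ℝ → M} {a b : ℝ} (h : IsSolution g x a b)
    (heq : EqOn y x (Icc a b)) (hg : ∀ t ∈ Ioo a b, g' t = g t) : IsSolution g' y a b := by
  refine ⟨h.1.congr heq, ?_⟩
  filter_upwards [h.2] with t ht htI
  have hev : y =ᶠ[𝓝 t] x := by
    filter_upwards [isOpen_Ioo.mem_nhds htI] with s hs using heq (Ioo_subset_Icc_self hs)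
  have := (ht htI).congr_of_eventuallyEq hev
  rw [HasVelocityAt, hg t htI, hev.eq_of_nhds]
  exact this

/-- A constant curve is a solution of `ẋ = 0`. -/
theorem isSolution_const {g : ℝ → VField n M} (x₀ : M) {a b : ℝ} (hg : ∀ t ∈ Ioo a b, g t = 0) :
    IsSolution g (fun _ => x₀) a b := by
  refine ⟨⟨continuousOn_const, fun q s t _ _ _ _ =>
    ((LipschitzWith.const' (K := 0) _).lipschitzOnWith).absolutelyContinuousOnInterval⟩,
    Eventually.of_forall fun t ht => ?_⟩
  rw [hg t ht]
  have h := hasMFDerivAt_const (I := 𝓘(ℝ, ℝ)) (I' := 𝓡 n) x₀ t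
  exact h.congr_mfderiv (ContinuousLinearMap.ext fun v => (smul_zero ((1 : ℝ →L[ℝ] ℝ) v)).symm)

/-- An integral curve in the chart defines a solution in `M`. -/
theorem IsGoodBall.isSolution {𝓕 : Set (VField n M)} {q : M} {ξ₀ : Eucl n} {r B L : ℝ}
    (h : IsGoodBall 𝓕 q ξ₀ r B L) {g : ℝ → VField n M} (hg : IsAdmissible 𝓕 g)
    {X : ℝ → Eucl n} {c d : ℝ} (hcd : c ≤ d) (hX : ContinuousOn X (Icc c d))
    (hK : MapsTo X (Icc c d) (Metric.closedBall ξ₀ r))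
    (hint : ∀ t ∈ Icc c d, X t = X c + ∫ s in c..t, coordField q (g s) (X s)) :
    IsSolution g (fun t => (chart n q).symm (X t)) c d := by
  have hcI : c ∈ Icc c d := ⟨le_rfl, hcd⟩
  have htgt : ∀ t ∈ Icc c d, X t ∈ (chart n q).target := fun t ht => h.subset (hK ht)
  have hII := h.intervalIntegrable_coordField hg hcd hX hK
  have hcont : ContinuousOn (fun t => (chart n q).symm (X t)) (Icc c d) := fun t ht =>
    (chart_symm_continuousAt (htgt t ht)).comp_continuousWithinAt (hX t ht)
  have hLip : LipschitzOnWith ⟨B, h.B_nonneg⟩ X (Icc c d) := by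
    have hl := lipschitzOnWith_integral h.B_nonneg hII
      (fun t ht => h.bound _ (hg.mem t) _ (hK ht)) hcI
    refine LipschitzOnWith.of_dist_le_mul fun s hs t ht => ?_
    rw [hint s hs, hint t ht, dist_add_left]
    exact hl.dist_le_mul s hs t ht
  refine ⟨⟨hcont, fun q' s t hs hst ht hmap => ?_⟩, ?_⟩
  · refine absolutelyContinuousOnInterval_comp (Ψ := transition n q q')
      (isOpen_transitionDomain q q') ((contDiffOn_transition q q').of_le (by simp)) hst
      (hLip.mono (Icc_subset_Icc hs ht)) fun τ hτ => ⟨htgt τ (Icc_subset_Icc hs ht hτ), ?_⟩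
    rw [mem_preimage, chart_source]
    exact hmap hτ
  · filter_upwards [hII.ae_hasDerivAt_integral] with t ht htI
    have htI' : t ∈ Icc c d := Ioo_subset_Icc_self htI
    rw [uIcc_of_le hcd] at ht
    have hev : (fun s => chart n q ((chart n q).symm (X s))) =ᶠ[𝓝 t]
        fun s => X c + ∫ τ in c..s, coordField q (g τ) (X τ) := by
      filter_upwards [isOpen_Ioo.mem_nhds htI] with s hs
      have hs' := Ioo_subset_Icc_self hs
      rw [(chart n q).right_inv (htgt s hs'), hint s hs']
    have hder := ((ht htI' c hcI).const_add (X c)).congr_of_eventuallyEq hev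
    have hsrc := (chart n q).map_target (htgt t htI')
    have hv := hasVelocityAt_of_chart hsrc
      (hcont.continuousAt (Icc_mem_nhds htI.1 htI.2)) hder
    rwa [coordField, ofChart_toChart hsrc] at hv

end

section

/-! ### The adjoint equation -/

variable {n : ℕ} {M : Type*} [TopologicalSpace M] [ChartedSpace (EuclideanSpace ℝ (Fin n)) M]
  [IsManifold (𝓡 n) ∞ M]

/-- The covector `p` at `x` in the coordinates of the chart at `q`. -/
def coordCovec (q x : M) (p : Covec n) : Covec n := p.comp (ofChart q x)

theorem coordCovec_toChart {q x : M} (hx : x ∈ (chart n q).source) (p : Covec n) (v : Eucl n) :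
    coordCovec q x p (toChart q x v) = p v := by
  rw [coordCovec, ContinuousLinearMap.comp_apply, ofChart_toChart hx]

/-- `p` is an absolutely continuous solution, along the curve `x`, of the adjoint equation of
`ẋ = g(t, x)`: in the coordinates of each chart, `ṗ = -p ∘ ∂g/∂x` almost everywhere. -/
def IsAdjoint (g : ℝ → VField n M) (x : ℝ → M) (p : ℝ → Covec n) (a b : ℝ) : Prop :=
  (∀ (q : M) (c d : ℝ), a ≤ c → c ≤ d → d ≤ b → MapsTo x (Icc c d) (chart n q).source →
    AbsolutelyContinuousOnInterval (fun t => coordCovec q (x t) (p t)) c d) ∧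
  ∀ q : M, ∀ᵐ t : ℝ, t ∈ Ioo a b → x t ∈ (chart n q).source →
    HasDerivAt (fun s => coordCovec q (x s) (p s))
      (-(coordCovec q (x t) (p t)).comp (fderiv ℝ (coordField q (g t)) (chart n q (x t)))) t

theorem IsAdjoint.mono {g : ℝ → VField n M} {x : ℝ → M} {p : ℝ → Covec n} {a b c d : ℝ}
    (h : IsAdjoint g x p a b) (hac : a ≤ c) (hdb : d ≤ b) : IsAdjoint g x p c d := by
  refine ⟨fun q _ _ h₁ h₂ h₃ => h.1 q _ _ (hac.trans h₁) h₂ (h₃.trans hdb), fun q => ?_⟩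
  filter_upwards [h.2 q] with t ht htI using ht (Ioo_subset_Ioo hac hdb htI)

theorem IsAdjoint.trans {g : ℝ → VField n M} {x : ℝ → M} {p : ℝ → Covec n} {a b c : ℝ}
    (h₁ : IsAdjoint g x p a b) (h₂ : IsAdjoint g x p b c) :
    IsAdjoint g x p a c := by
  refine ⟨fun q s t hs hst ht hmap => ?_, fun q => ?_⟩
  · rcases le_total t b with htb | htb
    · exact h₁.1 q s t hs hst htb hmap
    rcases le_total b s with hbs | hbs
    · exact h₂.1 q s t hbs hst ht hmap
    · exact (h₁.1 q s b hs hbs le_rfl (hmap.mono_left (Icc_subset_Icc_right htb))).trans hbs htb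
        (h₂.1 q b t le_rfl htb ht (hmap.mono_left (Icc_subset_Icc_left hbs)))
  · filter_upwards [h₁.2 q, h₂.2 q, ae_ne b] with t ht₁ ht₂ hne htI
    rcases lt_or_gt_of_ne hne with h | h
    · exact ht₁ ⟨htI.1, h⟩
    · exact ht₂ ⟨h, htI.2⟩

theorem IsAdjoint.congr {g g' : ℝ → VField n M} {x y : ℝ → M} {p p' : ℝ → Covec n} {a b : ℝ}
    (h : IsAdjoint g x p a b) (heq : EqOn y x (Icc a b)) (hp : EqOn p' p (Icc a b))
    (hg : ∀ t ∈ Ioo a b, g' t = g t) : IsAdjoint g' y p' a b := by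
  refine ⟨fun q s t hs hst ht hmap => ?_, fun q => ?_⟩
  · have hsub : Icc s t ⊆ Icc a b := Icc_subset_Icc hs ht
    refine (h.1 q s t hs hst ht fun τ hτ => heq (hsub hτ) ▸ hmap hτ).congr fun τ hτ => ?_
    rw [uIcc_of_le hst] at hτ
    rw [heq (hsub hτ), hp (hsub hτ)]
  · filter_upwards [h.2 q] with t ht htI hsrc
    have htI' := Ioo_subset_Icc_self htI
    rw [heq htI'] at hsrc
    rw [heq htI', hp htI', hg t htI]
    refine (ht htI hsrc).congr_of_eventuallyEq ?_
    filter_upwards [isOpen_Ioo.mem_nhds htI] with s hs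
    rw [heq (Ioo_subset_Icc_self hs), hp (Ioo_subset_Icc_self hs)]

theorem isAdjoint_const {g : ℝ → VField n M} (x₀ : M) (p₀ : Covec n) {a b : ℝ}
    (hg : ∀ t ∈ Ioo a b, g t = 0) : IsAdjoint g (fun _ => x₀) (fun _ => p₀) a b := by
  refine ⟨fun q s t _ _ _ _ =>
    ((LipschitzWith.const' (K := 0) _).lipschitzOnWith).absolutelyContinuousOnInterval,
    fun q => Eventually.of_forall fun t ht _ => ?_⟩
  have h0 : coordField q (0 : VField n M) = fun _ => 0 := by
    funext ξ
    simp [coordField]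
  rw [hg t ht, h0]
  simpa using hasDerivAt_const t (coordCovec q x₀ p₀)

theorem covec_eq_sum (A : Covec n) :
    A = ∑ i, A (EuclideanSpace.single i 1) • (EuclideanSpace.proj i : Eucl n →L[ℝ] ℝ) := by
  ext v
  have hv : v = ∑ i, v i • EuclideanSpace.single i (1 : ℝ) := by
    ext j
    simp [Pi.single_apply]
  conv_lhs => rw [hv]
  simp [mul_comm]

/-- Covector-valued functions are measurable if their values on all vectors are. -/
theorem measurable_covec {A : ℝ → Covec n} (h : ∀ e, Measurable fun t => A t e) :
    Measurable A := by
  have : A = fun t => ∑ i, A t (EuclideanSpace.single i 1) •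
      (EuclideanSpace.proj i : Eucl n →L[ℝ] ℝ) := funext fun t => covec_eq_sum (A t)
  rw [this]
  exact Finset.measurable_sum _ fun i _ => (h _).smul_const _

variable {𝓕 : Set (VField n M)} {q : M} {ξ₀ : Eucl n} {r B L : ℝ} {c d : ℝ}

theorem StaysInBall.lipschitzOnWith {y : ℝ → M} (h : StaysInBall q ξ₀ r y c d)
    (hball : IsGoodBall 𝓕 q ξ₀ r B L) {g : ℝ → VField n M} (hg : IsAdmissible 𝓕 g)
    (hy : IsSolution g y c d) :
    LipschitzOnWith ⟨B, hball.B_nonneg⟩ (fun t => chart n q (y t)) (Icc c d) := by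
  refine LipschitzOnWith.of_dist_le_mul fun s hs t ht => ?_
  have hcd : c ≤ d := hs.1.trans hs.2
  have hII := hball.intervalIntegrable_coordField hg hcd (h.continuousOn hy.1.1) h.mapsTo
  have hl := lipschitzOnWith_integral hball.B_nonneg hII
      (fun t ht => hball.bound _ (hg.mem t) _ (h t ht).2) hs
  have e₁ := h.eq_add_integral hball hg hy hs ht
  have := hl.dist_le_mul s hs t ht
  rw [e₁]
  simpa using this

/-- The linearized field composed with a continuous covector function is integrable. -/
theorem IsGoodBall.intervalIntegrable_comp_fderiv (hball : IsGoodBall 𝓕 q ξ₀ r B L)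
    {g : ℝ → VField n M} (hg : IsAdmissible 𝓕 g) {X : ℝ → Eucl n} (hcd : c ≤ d)
    (hX : ContinuousOn X (Icc c d)) (hK : MapsTo X (Icc c d) (Metric.closedBall ξ₀ r))
    {π : ℝ → Covec n} (hπ : ContinuousOn π (Icc c d)) :
    ∃ C, 0 ≤ C ∧ (∀ t ∈ Icc c d, ‖(π t).comp (fderiv ℝ (coordField q (g t)) (X t))‖ ≤ C) ∧
      IntervalIntegrable (fun t => (π t).comp (fderiv ℝ (coordField q (g t)) (X t))) volume c d := by
  obtain ⟨C, hC⟩ := isCompact_Icc.exists_bound_of_continuousOn hπ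
  have hC0 : 0 ≤ C := (norm_nonneg _).trans (hC c ⟨le_rfl, hcd⟩)
  have hbd : ∀ t ∈ Icc c d, ‖(π t).comp (fderiv ℝ (coordField q (g t)) (X t))‖ ≤ C * L :=
    fun t ht => ((π t).opNorm_comp_le _).trans (mul_le_mul (hC t ht)
      (hball.bound_fderiv _ (hg.mem t) _ (hK ht)) (norm_nonneg _) hC0)
  refine ⟨C * L, mul_nonneg hC0 hball.L_nonneg, hbd, ?_⟩
  obtain ⟨D, hDm, -, hD⟩ := hball.exists_measurable_fderiv hg hcd hX hK
  obtain ⟨π', hm, -, heq⟩ := hπ.exists_measurable_extension hcd (mapsTo_univ _ _)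
  refine intervalIntegrable_of_norm_le (G' := fun t => (π' t).comp (D t)) hcd
    (measurable_covec fun e => ?_) (fun t ht => by simp only [heq ht, hD t ht]) hbd
  have hev : Continuous fun z : Covec n × Eucl n => z.1 z.2 := by fun_prop
  exact hev.measurable.comp (hm.prodMk (hDm e))

/-- A solution of the adjoint equation satisfies the integral equation in the chart. -/
theorem IsAdjoint.eq_add_integral {g : ℝ → VField n M} {x : ℝ → M} {p : ℝ → Covec n}
    (hp : IsAdjoint g x p c d) (hx : IsSolution g x c d) (hball : IsGoodBall 𝓕 q ξ₀ r B L)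
    (hg : IsAdmissible 𝓕 g) (h : StaysInBall q ξ₀ r x c d) {s t : ℝ} (hs : s ∈ Icc c d)
    (ht : t ∈ Icc c d) :
    coordCovec q (x t) (p t) = coordCovec q (x s) (p s) + ∫ τ in s..t,
      -((coordCovec q (x τ) (p τ)).comp (fderiv ℝ (coordField q (g τ)) (chart n q (x τ)))) := by
  have hcd : c ≤ d := hs.1.trans hs.2
  have hAC := hp.1 q c d le_rfl hcd le_rfl fun t ht => (h t ht).1
  have hπ := hAC.continuousOn
  rw [uIcc_of_le hcd] at hπ
  obtain ⟨C, hC0, hC, hint⟩ := hball.intervalIntegrable_comp_fderiv hg hcd (h.continuousOn hx.1.1)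
    h.mapsTo hπ
  refine hAC.eq_add_integral hC0 (G := fun τ => -((coordCovec q (x τ) (p τ)).comp
    (fderiv ℝ (coordField q (g τ)) (chart n q (x τ))))) hint.neg
    (fun t ht => by rw [norm_neg]; exact hC t ht) ?_ hs ht
  filter_upwards [hp.2 q] with t ht htI using ht htI (h t (Ioo_subset_Icc_self htI)).1

theorem IsAdjoint.exists_lipschitzOnWith {g : ℝ → VField n M} {x : ℝ → M} {p : ℝ → Covec n}
    (hp : IsAdjoint g x p c d) (hx : IsSolution g x c d) (hball : IsGoodBall 𝓕 q ξ₀ r B L)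
    (hg : IsAdmissible 𝓕 g) (h : StaysInBall q ξ₀ r x c d) (hcd : c ≤ d) :
    ∃ K, LipschitzOnWith K (fun t => coordCovec q (x t) (p t)) (Icc c d) := by
  have hAC := hp.1 q c d le_rfl hcd le_rfl fun t ht => (h t ht).1
  have hπ := hAC.continuousOn
  rw [uIcc_of_le hcd] at hπ
  obtain ⟨C, hC0, hC, hint⟩ := hball.intervalIntegrable_comp_fderiv hg hcd (h.continuousOn hx.1.1)
    h.mapsTo hπ
  refine ⟨⟨C, hC0⟩, LipschitzOnWith.of_dist_le_mul fun s hs t ht => ?_⟩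
  have hl := lipschitzOnWith_integral hC0 hint.neg
    (fun t ht => by rw [Pi.neg_apply, norm_neg]; exact hC t ht) hs
  have e₁ := hp.eq_add_integral hx hball hg h hs ht
  have := hl.dist_le_mul s hs t ht
  rw [e₁]
  simpa using this

/-- The transformation of the linearization of a vector field under a change of charts: the
derivative of `coordField_transition`. -/
theorem fderiv_coordField_transition {q q' : M} {ξ : Eucl n} (hξ : ξ ∈ transitionDomain n q q')
    {V : VField n M} (hV : DifferentiableAt ℝ (coordField q V) ξ)
    (hV' : DifferentiableAt ℝ (coordField q' V) (transition n q q' ξ)) (η : Eucl n) :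
    fderiv ℝ (coordField q' V) (transition n q q' ξ) (fderiv ℝ (transition n q q') ξ η) =
      fderiv ℝ (fderiv ℝ (transition n q q')) ξ (coordField q V ξ) η +
        fderiv ℝ (transition n q q') ξ (fderiv ℝ (coordField q V) ξ η) := by
  have hnhds := (isOpen_transitionDomain q q').mem_nhds hξ
  have hT : ContDiffAt ℝ ∞ (transition n q q') ξ := (contDiffOn_transition q q').contDiffAt hnhds
  have hT1 : HasFDerivAt (transition n q q') (fderiv ℝ (transition n q q') ξ) ξ :=
    (hT.differentiableAt (by simp)).hasFDerivAt
  have hT2 : HasFDerivAt (fderiv ℝ (transition n q q'))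
      (fderiv ℝ (fderiv ℝ (transition n q q')) ξ) ξ :=
    ((hT.fderiv_right (m := 1) (by norm_cast)).differentiableAt (by simp)).hasFDerivAt
  have h₁ := hV'.hasFDerivAt.comp ξ hT1
  have h₂ := hT2.clm_apply hV.hasFDerivAt
  have heq : coordField q' V ∘ transition n q q' =ᶠ[𝓝 ξ]
      fun ζ => fderiv ℝ (transition n q q') ζ (coordField q V ζ) := by
    filter_upwards [hnhds] with ζ hζ using coordField_transition hζ V
  have h₃ := DFunLike.congr_fun (h₁.unique (h₂.congr_of_eventuallyEq heq)) η
  have hsymm : IsSymmSndFDerivAt ℝ (transition n q q') ξ :=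
    hT.isSymmSndFDerivAt (by
      rw [minSmoothness_of_isRCLikeNormedField]
      exact (mod_cast le_top : ((2 : ℕ∞) : WithTop ℕ∞) ≤ ∞))
  simp only [ContinuousLinearMap.comp_apply, add_apply,
    ContinuousLinearMap.flip_apply] at h₃
  rw [h₃, hsymm.eq η, add_comm]

/-- Local existence for the adjoint equation, with a given terminal value. -/
theorem exists_isAdjoint_local (h𝓕 : IsUniformlyC1 𝓕) {g : ℝ → VField n M} {x : ℝ → M}
    (hx : IsSolution g x c d) (hball : IsGoodBall 𝓕 q ξ₀ r B L)
    (hg : IsAdmissible 𝓕 g) (h : StaysInBall q ξ₀ r x c d) (hcd : c ≤ d)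
    (hsmall : L * (d - c) ≤ 1 / 2) (p₁ : Covec n) :
    ∃ p : ℝ → Covec n, p d = p₁ ∧ IsAdjoint g x p c d := by
  have hdI : d ∈ Icc c d := ⟨hcd, le_rfl⟩
  obtain ⟨D, hDm, hDL, hD⟩ := hball.exists_measurable_fderiv hg hcd (h.continuousOn hx.1.1) h.mapsTo
  have hL0 := hball.L_nonneg
  obtain ⟨P, hPc, hP⟩ := exists_integral_solution
    (G := fun t (π : Covec n) => -(π.comp (D t))) (fun π => by
      refine measurable_covec fun e => ?_
      exact (π.continuous.measurable.comp (hDm e)).neg)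
    (L := ⟨L, hL0⟩) (fun t => LipschitzWith.of_dist_le_mul fun π π' => by
      rw [dist_neg_neg, dist_eq_norm, dist_eq_norm, ← ContinuousLinearMap.sub_comp, mul_comm]
      exact (ContinuousLinearMap.opNorm_comp_le _ _).trans
        (mul_le_mul_of_nonneg_left (hDL t) (norm_nonneg _)))
    (B := 0) (fun t => by simp) hsmall hdI (coordCovec q (x d) p₁)
  obtain ⟨C, hC0, hC, hPI⟩ := hball.intervalIntegrable_comp_fderiv hg hcd (h.continuousOn hx.1.1)
    h.mapsTo hPc.continuousOn
  have hP' : ∀ t ∈ Icc c d, P t = coordCovec q (x d) p₁ +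
      ∫ s in d..t, -((P s).comp (fderiv ℝ (coordField q (g s)) (chart n q (x s)))) := by
    intro t ht
    rw [hP t ht]
    congr 1
    refine intervalIntegral.integral_congr fun s hs => ?_
    simp only [hD s (uIcc_subset_Icc hdI ht hs)]
  have hPder : ∀ᵐ t, t ∈ Ioo c d → HasDerivAt P
      (-((P t).comp (fderiv ℝ (coordField q (g t)) (chart n q (x t))))) t := by
    filter_upwards [hPI.neg.ae_hasDerivAt_integral] with t ht htI
    have htI' := Ioo_subset_Icc_self htI
    rw [uIcc_of_le hcd] at ht
    refine ((ht htI' d hdI).const_add (coordCovec q (x d) p₁)).congr_of_eventuallyEq ?_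
    filter_upwards [isOpen_Ioo.mem_nhds htI] with s hs using hP' s (Ioo_subset_Icc_self hs)
  have hPL : LipschitzOnWith ⟨C, hC0⟩ P (Icc c d) := by
    have hl := lipschitzOnWith_integral hC0 hPI.neg
      (fun t ht => by rw [Pi.neg_apply, norm_neg]; exact hC t ht) hdI
    refine LipschitzOnWith.of_dist_le_mul fun s hs t ht => ?_
    rw [hP' s hs, hP' t ht, dist_add_left]
    exact hl.dist_le_mul s hs t ht
  have hXL := h.lipschitzOnWith hball hg hx
  refine ⟨fun t => (P t).comp (toChart q (x t)), ?_, fun q' s t hs hst ht hmap => ?_, fun q' => ?_⟩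
  · simp only
    rw [hP d hdI, intervalIntegral.integral_same, add_zero, coordCovec,
      ContinuousLinearMap.comp_assoc, ofChart_comp_toChart (h d hdI).1,
      ContinuousLinearMap.comp_id]
  · -- the coordinates in the chart at `q'` are a smooth function of those in the chart at `q`
    have hsub : Icc s t ⊆ Icc c d := Icc_subset_Icc hs ht
    have hO : IsOpen (transitionDomain n q q' ×ˢ (univ : Set (Covec n))) :=
      (isOpen_transitionDomain q q').prod isOpen_univ
    have hmaps : MapsTo (transition n q q') (transitionDomain n q q') (transitionDomain n q' q) := by
      intro ξ hξ
      exact chart_mem_transitionDomain hξ.2 ((chart n q).map_target hξ.1)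
    have hΨ : ContDiffOn ℝ 1 (fun z : Eucl n × Covec n =>
        z.2.comp (fderiv ℝ (transition n q' q) (transition n q q' z.1)))
        (transitionDomain n q q' ×ˢ (univ : Set (Covec n))) := by
      have h1 : ContDiffOn ℝ 1 (fderiv ℝ (transition n q' q)) (transitionDomain n q' q) :=
        (contDiffOn_transition q' q).fderiv_of_isOpen (isOpen_transitionDomain q' q)
          (by norm_cast)
      have h2 : ContDiffOn ℝ 1 (transition n q q') (transitionDomain n q q') :=
        (contDiffOn_transition q q').of_le (by simp)
      have h3 := (h1.comp h2 hmaps).comp (t := transitionDomain n q q')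
        (s := transitionDomain n q q' ×ˢ (univ : Set (Covec n))) contDiffOn_fst
        (fun z hz => hz.1)
      exact contDiffOn_snd.clm_comp h3
    have hmem : ∀ τ ∈ Icc s t, chart n q (x τ) ∈ transitionDomain n q q' := fun τ hτ =>
      chart_mem_transitionDomain (h τ (hsub hτ)).1 (hmap hτ)
    refine (absolutelyContinuousOnInterval_comp hO hΨ hst
      (γ := fun τ => (chart n q (x τ), P τ)) ((hXL.mono hsub).prodMk (hPL.mono hsub))
      fun τ hτ => ⟨hmem τ hτ, mem_univ _⟩).congr fun τ hτ => ?_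
    rw [uIcc_of_le hst] at hτ
    have hsq := (h τ (hsub hτ)).1
    simp only
    rw [transition_chart hsq, (hasFDerivAt_transition (hmap hτ) hsq).fderiv, coordCovec,
      ContinuousLinearMap.comp_assoc]
  · filter_upwards [hPder, hx.2] with t htP htx htI hsrc'
    have htI' := Ioo_subset_Icc_self htI
    have hsrc := (h t htI').1
    have hmem := chart_mem_transitionDomain hsrc' hsrc
    have hnhds := (isOpen_transitionDomain q' q).mem_nhds hmem
    have hT : ContDiffAt ℝ ∞ (transition n q' q) (chart n q' (x t)) :=
      (contDiffOn_transition q' q).contDiffAt hnhds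
    have hT2 : HasFDerivAt (fderiv ℝ (transition n q' q))
        (fderiv ℝ (fderiv ℝ (transition n q' q)) (chart n q' (x t))) (chart n q' (x t)) :=
      ((hT.fderiv_right (m := 1) (by norm_cast)).differentiableAt (by simp)).hasFDerivAt
    have hX' := (htx htI).hasDerivAt_chart hsrc'
    rw [← coordField_chart hsrc'] at hX'
    have hder := (htP htI).clm_comp (hT2.comp_hasDerivAt t hX')
    have hev : (fun s => coordCovec q' (x s) ((P s).comp (toChart q (x s)))) =ᶠ[𝓝 t]
        fun s => (P s).comp (fderiv ℝ (transition n q' q) (chart n q' (x s))) := by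
      have hxc : ContinuousAt x t := hx.1.1.continuousAt (Icc_mem_nhds htI.1 htI.2)
      filter_upwards [hxc.preimage_mem_nhds ((isOpen_chart_source q).mem_nhds hsrc),
        hxc.preimage_mem_nhds ((isOpen_chart_source q').mem_nhds hsrc')] with s hs hs'
      rw [(hasFDerivAt_transition hs' hs).fderiv, coordCovec, ContinuousLinearMap.comp_assoc]
    refine (hder.congr_of_eventuallyEq hev).congr_deriv ?_
    rw [hev.eq_of_nhds]
    ext1 η
    have hVq := hball.differentiableAt _ (hg.mem t) _ (h t htI').2
    have key := fderiv_coordField_transition hmem (V := g t)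
      (h𝓕.differentiableAt ((chart n q').map_source hsrc') (hg.mem t))
      (by rwa [transition_chart hsrc']) η
    rw [transition_chart hsrc'] at key
    simp only [Function.comp_apply, neg_apply, add_apply, ContinuousLinearMap.comp_apply, key,
      map_add]
    rw [(hasFDerivAt_transition hsrc' hsrc).fderiv]
    simp only [ContinuousLinearMap.comp_apply]
    ring

end

section

/-! ### Short arcs, and the global adjoint -/

theorem le_two_mul_of_forall_le {f : ℝ → ℝ} {c d A : ℝ} (hf : ContinuousOn f (Icc c d))
    (h : ∀ S, (∀ s ∈ Icc c d, f s ≤ S) → ∀ t ∈ Icc c d, f t ≤ A + S / 2) {t : ℝ}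
    (ht : t ∈ Icc c d) : f t ≤ 2 * A := by
  obtain ⟨s, hs, hmax⟩ := isCompact_Icc.exists_isMaxOn ⟨t, ht⟩ hf
  have h1 := h (f s) (fun τ hτ => hmax hτ) s hs
  have h2 : f t ≤ f s := hmax ht
  linarith

theorem intervalIntegrable_indicator {D : Set ℝ} (hD : MeasurableSet D) (K u v : ℝ) :
    IntervalIntegrable (D.indicator fun _ => K) volume u v := by
  rw [intervalIntegrable_iff]
  exact (integrableOn_const (by simp [uIoc])).indicator hD

theorem integral_indicator_le {D : Set ℝ} (hD : MeasurableSet D) {K m : ℝ} (hK : 0 ≤ K)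
    (hm : 0 ≤ m) (hDm : volume D ≤ ENNReal.ofReal m) {u v : ℝ} (huv : u ≤ v) :
    ∫ τ in u..v, D.indicator (fun _ => K) τ ≤ K * m := by
  rw [intervalIntegral.integral_of_le huv, setIntegral_indicator hD, setIntegral_const,
    smul_eq_mul, mul_comm]
  refine mul_le_mul_of_nonneg_left ?_ hK
  rw [measureReal_def]
  exact ENNReal.toReal_le_of_le_ofReal hm ((measure_mono inter_subset_right).trans hDm)

/-- Gronwall's inequality on a short interval, for two curves whose velocities differ by a bounded
amount on a set `D` of small measure. -/
theorem norm_sub_le_of_velocity {E : Type*} [NormedAddCommGroup E] [NormedSpace ℝ E]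
    {X Y f f' : ℝ → E} {c d L K m : ℝ} {D : Set ℝ} (hL : 0 ≤ L) (hsmall : L * (d - c) ≤ 1 / 2)
    (hX : ContinuousOn X (Icc c d)) (hY : ContinuousOn Y (Icc c d))
    (hf : IntervalIntegrable f volume c d) (hf' : IntervalIntegrable f' volume c d)
    (hXint : ∀ t ∈ Icc c d, X t = X c + ∫ s in c..t, f s)
    (hYint : ∀ t ∈ Icc c d, Y t = Y c + ∫ s in c..t, f' s)
    (hD : MeasurableSet D) (hK : 0 ≤ K) (hm : 0 ≤ m) (hDm : volume D ≤ ENNReal.ofReal m)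
    (hle : ∀ t ∈ Ioo c d, ‖f' t - f t‖ ≤ L * ‖Y t - X t‖ + D.indicator (fun _ => K) t)
    {t : ℝ} (ht : t ∈ Icc c d) : ‖Y t - X t‖ ≤ 2 * (‖Y c - X c‖ + K * m) := by
  refine le_two_mul_of_forall_le (f := fun t => ‖Y t - X t‖) (hY.sub hX).norm
    (fun S hS s hs => ?_) ht
  have hcI : c ∈ Icc c d := ⟨le_rfl, hs.1.trans hs.2⟩
  have hS0 : 0 ≤ S := (norm_nonneg _).trans (hS c hcI)
  have hsub : uIcc c s ⊆ uIcc c d := by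
    rw [uIcc_of_le hs.1, uIcc_of_le hcI.2]; exact Icc_subset_Icc_right hs.2
  have e : Y s - X s = Y c - X c + ∫ τ in c..s, (f' τ - f τ) := by
    rw [intervalIntegral.integral_sub (hf'.mono_set hsub) (hf.mono_set hsub), hXint s hs,
      hYint s hs]
    abel
  have hI : IntervalIntegrable (fun τ => L * S + D.indicator (fun _ => K) τ) volume c s :=
    intervalIntegrable_const.add (intervalIntegrable_indicator hD K c s)
  have h1 : ‖∫ τ in c..s, (f' τ - f τ)‖ ≤ ∫ τ in c..s, (L * S + D.indicator (fun _ => K) τ) := by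
    refine intervalIntegral.norm_integral_le_of_norm_le hs.1 ?_ hI
    filter_upwards [ae_ne d] with τ hne hτ
    have hτ' : τ ∈ Ioo c d := ⟨hτ.1, lt_of_le_of_ne (hτ.2.trans hs.2) hne⟩
    refine (hle τ hτ').trans ?_
    gcongr
    exact hS τ (Ioo_subset_Icc_self hτ')
  rw [intervalIntegral.integral_add intervalIntegrable_const
    (intervalIntegrable_indicator hD K c s), intervalIntegral.integral_const, smul_eq_mul] at h1
  have h2 := integral_indicator_le hD hK hm hDm hs.1
  have h3 : (s - c) * (L * S) ≤ S / 2 := by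
    calc (s - c) * (L * S) ≤ (d - c) * (L * S) := by
          gcongr
          exact hs.2
      _ = (L * (d - c)) * S := by ring
      _ ≤ 1 / 2 * S := by gcongr
      _ = S / 2 := by ring
  calc ‖Y s - X s‖ ≤ ‖Y c - X c‖ + ‖∫ τ in c..s, (f' τ - f τ)‖ := by
        rw [e]; exact norm_add_le _ _
    _ ≤ _ := by linarith

variable {n : ℕ} {M : Type*} [TopologicalSpace M] [ChartedSpace (EuclideanSpace ℝ (Fin n)) M]
  [IsManifold (𝓡 n) ∞ M]

/-- An arc of the curve `x` which lies well inside a good ball of a chart, and which is so short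
that the differential equations of the family `𝓕`, cut off outside of this ball, are solved by
contraction. -/
structure IsShortArc (𝓕 : Set (VField n M)) (q : M) (ξ₀ : Eucl n) (r B L : ℝ) (x : ℝ → M)
    (c d : ℝ) : Prop where
  ball : IsGoodBall 𝓕 q ξ₀ r B L
  stays : StaysInBall q ξ₀ (r / 4) x c d
  short : (L + 2 * B / r) * (d - c) ≤ 1 / 2

namespace IsShortArc

variable {𝓕 : Set (VField n M)} {q : M} {ξ₀ : Eucl n} {r B L : ℝ} {x : ℝ → M} {c d : ℝ}

theorem stays' (h : IsShortArc 𝓕 q ξ₀ r B L x c d) : StaysInBall q ξ₀ r x c d := fun t ht =>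
  ⟨(h.stays t ht).1, Metric.closedBall_subset_closedBall (by linarith [h.ball.r_pos])
    (h.stays t ht).2⟩

theorem short' (h : IsShortArc 𝓕 q ξ₀ r B L x c d) (hcd : c ≤ d) : L * (d - c) ≤ 1 / 2 := by
  refine le_trans (mul_le_mul_of_nonneg_right ?_ (sub_nonneg.2 hcd)) h.short
  have := h.ball.r_pos
  have := h.ball.B_nonneg
  have : 0 ≤ 2 * B / r := by positivity
  linarith

end IsShortArc

theorem exists_isShortArc {𝓕 : Set (VField n M)} (h𝓕 : IsUniformlyC1 𝓕) {x : ℝ → M} {a b : ℝ}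
    (hx : ContinuousOn x (Icc a b)) {t : ℝ} (ht : t ∈ Icc a b) :
    ∃ (q : M) (ξ₀ : Eucl n) (r B L δ : ℝ), 0 < δ ∧ ∀ c d, a ≤ c → c ≤ d → d ≤ b → t - δ < c →
      d < t + δ → IsShortArc 𝓕 q ξ₀ r B L x c d := by
  have hsrc : x t ∈ (chart n (x t)).source := mem_extChartAt_source _
  obtain ⟨r, B, L, hball⟩ := h𝓕 (x t) _ ((chart n (x t)).map_source hsrc)
  have hr := hball.r_pos
  have hB := hball.B_nonneg
  have hL := hball.L_nonneg
  have hN : (chart n (x t)).source ∩ chart n (x t) ⁻¹'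
      Metric.closedBall (chart n (x t) (x t)) (r / 4) ∈ 𝓝 (x t) :=
    inter_mem ((isOpen_chart_source _).mem_nhds hsrc)
      ((chart_continuousAt hsrc).preimage_mem_nhds (Metric.closedBall_mem_nhds _ (by linarith)))
  obtain ⟨δ, hδ, h⟩ := Metric.mem_nhdsWithin_iff.1 ((hx t ht).preimage_mem_nhdsWithin hN)
  set κ := L + 2 * B / r + 1 with hκ
  have hκ0 : 0 < κ := by positivity
  refine ⟨x t, chart n (x t) (x t), r, B, L, min δ (1 / (4 * κ)), by positivity,
    fun c d hac hcd hdb h₁ h₂ => ⟨hball, fun s hs => ?_, ?_⟩⟩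
  · refine h ⟨?_, hac.trans hs.1, hs.2.trans hdb⟩
    rw [Metric.mem_ball, Real.dist_eq, abs_lt]
    have := min_le_left δ (1 / (4 * κ))
    constructor <;> linarith [hs.1, hs.2]
  · have := min_le_right δ (1 / (4 * κ))
    calc (L + 2 * B / r) * (d - c) ≤ κ * (2 * (1 / (4 * κ))) :=
          mul_le_mul (by linarith) (by linarith) (by linarith) hκ0.le
      _ = 1 / 2 := by field_simp; norm_num

theorem IsSolution.exists_isAdjoint {𝓕 : Set (VField n M)} (h𝓕 : IsUniformlyC1 𝓕)
    {g : ℝ → VField n M} (hg : IsAdmissible 𝓕 g) {x : ℝ → M} {a b : ℝ} (hab : a ≤ b)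
    (hx : IsSolution g x a b) (p₁ : Covec n) :
    ∃ p : ℝ → Covec n, p b = p₁ ∧ IsAdjoint g x p a b := by
  refine interval_induction (P := fun c d => ∀ p₁ : Covec n, ∃ p : ℝ → Covec n,
    p d = p₁ ∧ IsAdjoint g x p c d) hab (fun c d e _ hcd hde _ h₁ h₂ p₁ => ?_)
    (fun t ht => ?_) p₁
  · obtain ⟨p₂, hp₂, had₂⟩ := h₂ p₁
    obtain ⟨p₁', hp₁, had₁⟩ := h₁ (p₂ d)
    have hright : EqOn (fun t => if t ≤ d then p₁' t else p₂ t) p₂ (Icc d e) := by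
      intro t ht
      rcases eq_or_lt_of_le ht.1 with rfl | h
      · simp [hp₁]
      · simp [not_le.2 h]
    refine ⟨fun t => if t ≤ d then p₁' t else p₂ t, (hright ⟨hde, le_rfl⟩).trans hp₂, ?_⟩
    exact (had₁.congr (fun _ _ => rfl) (fun t ht => if_pos ht.2) fun _ _ => rfl).trans
      (had₂.congr (fun _ _ => rfl) hright fun _ _ => rfl)
  · obtain ⟨q, ξ₀, r, B, L, δ, hδ, h⟩ := exists_isShortArc h𝓕 hx.1.1 ht
    refine ⟨δ, hδ, fun c d hac hcd hdb h₁ h₂ p₁ => ?_⟩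
    have hs := h c d hac hcd hdb h₁ h₂
    exact exists_isAdjoint_local h𝓕 (hx.mono hac hdb) hs.ball hg hs.stays' hcd (hs.short' hcd) p₁

/-- An adjoint curve which does not vanish at the terminal time does not vanish at all. -/
theorem IsAdjoint.ne_zero {𝓕 : Set (VField n M)} (h𝓕 : IsUniformlyC1 𝓕)
    {g : ℝ → VField n M} (hg : IsAdmissible 𝓕 g) {x : ℝ → M} {p : ℝ → Covec n} {a b : ℝ}
    (hx : IsSolution g x a b) (hp : IsAdjoint g x p a b) (hb : p b ≠ 0) {t : ℝ}
    (ht : t ∈ Icc a b) : p t ≠ 0 := by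
  intro h0
  refine hb (interval_induction (P := fun c d => p c = 0 → p d = 0) ht.2
    (fun c d e _ _ _ _ h₁ h₂ h => h₂ (h₁ h)) (fun s hs => ?_) h0)
  replace hx := hx.mono ht.1 le_rfl
  replace hp := hp.mono ht.1 le_rfl
  obtain ⟨q, ξ₀, r, B, L, δ, hδ, h⟩ := exists_isShortArc h𝓕 hx.1.1 hs
  refine ⟨δ, hδ, fun c d hac hcd hdb h₁ h₂ hpc => ?_⟩
  have hs := h c d hac hcd hdb h₁ h₂
  have hp' := hp.mono hac hdb
  have hx' := hx.mono hac hdb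
  obtain ⟨K, hK⟩ := hp'.exists_lipschitzOnWith hx' hs.ball hg hs.stays' hcd
  have hcI : c ∈ Icc c d := ⟨le_rfl, hcd⟩
  have hdI : d ∈ Icc c d := ⟨hcd, le_rfl⟩
  have key := le_two_mul_of_forall_le (A := 0) hK.continuousOn.norm (fun S hS t ht => ?_) hdI
  · have h0 : coordCovec q (x d) (p d) = 0 := by
      rw [← norm_le_zero_iff]; linarith
    ext v
    rw [← coordCovec_toChart (hs.stays d hdI).1 (p d) v, h0]
    rfl
  · have hc0 : coordCovec q (x c) (p c) = 0 := by
      rw [hpc, coordCovec, ContinuousLinearMap.zero_comp]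
    rw [hp'.eq_add_integral hx' hs.ball hg hs.stays' hcI ht, hc0, zero_add, zero_add]
    have hS0 : 0 ≤ S := (norm_nonneg _).trans (hS c hcI)
    have hL := hs.ball.L_nonneg
    have hb := intervalIntegral.norm_integral_le_of_norm_le_const (a := c) (b := t)
      (f := fun τ => -((coordCovec q (x τ) (p τ)).comp
        (fderiv ℝ (coordField q (g τ)) (chart n q (x τ))))) (C := S * L) fun τ hτ => by
        have hτ' : τ ∈ Icc c d := by
          rw [uIoc_of_le ht.1] at hτ
          exact ⟨hτ.1.le, hτ.2.trans ht.2⟩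
        rw [norm_neg]
        exact (ContinuousLinearMap.opNorm_comp_le _ _).trans (mul_le_mul (hS τ hτ')
          (hs.ball.bound_fderiv _ (hg.mem τ) _ (hs.stays' τ hτ').2) (norm_nonneg _) hS0)
    refine hb.trans ?_
    rw [abs_of_nonneg (sub_nonneg.2 ht.1)]
    calc S * L * (t - c) ≤ S * L * (d - c) := by
          gcongr
          exact ht.2
      _ = S * (L * (d - c)) := by ring
      _ ≤ S * (1 / 2) := by gcongr; exact hs.short' hcd
      _ = S / 2 := by ring

end

section

/-! ### Perturbations of a short arc -/

variable {n : ℕ} {M : Type*} [TopologicalSpace M] [ChartedSpace (EuclideanSpace ℝ (Fin n)) M]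
  [IsManifold (𝓡 n) ∞ M]

/-- On `(a, b)`, the time-dependent fields `g` and `g'` coincide off a set of measure at most
`m`. -/
def DeviatesAtMost (g g' : ℝ → VField n M) (a b m : ℝ) : Prop :=
  ∃ D : Set ℝ, MeasurableSet D ∧ volume D ≤ ENNReal.ofReal m ∧ ∀ t ∈ Ioo a b, t ∉ D → g' t = g t

theorem DeviatesAtMost.mono {g g' : ℝ → VField n M} {a b c d m : ℝ}
    (h : DeviatesAtMost g g' a b m) (hac : a ≤ c) (hdb : d ≤ b) : DeviatesAtMost g g' c d m := by
  obtain ⟨D, h₁, h₂, h₃⟩ := h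
  exact ⟨D, h₁, h₂, fun t ht => h₃ t (Ioo_subset_Ioo hac hdb ht)⟩

variable {𝓕 : Set (VField n M)} {q : M} {ξ₀ : Eucl n} {r B L : ℝ} {c d : ℝ}

/-- Two solutions of nearby equations stay close. -/
theorem IsGoodBall.norm_sub_solution_le (hball : IsGoodBall 𝓕 q ξ₀ r B L)
    (hsmall : L * (d - c) ≤ 1 / 2) {g g' : ℝ → VField n M} (hg : IsAdmissible 𝓕 g)
    (hg' : IsAdmissible 𝓕 g') {x y : ℝ → M} (hxs : StaysInBall q ξ₀ r x c d)
    (hys : StaysInBall q ξ₀ r y c d) (hx : IsSolution g x c d) (hy : IsSolution g' y c d) {m : ℝ}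
    (hm : 0 ≤ m) (hdev : DeviatesAtMost g g' c d m) {t : ℝ} (ht : t ∈ Icc c d) :
    ‖chart n q (y t) - chart n q (x t)‖ ≤
      2 * (‖chart n q (y c) - chart n q (x c)‖ + 2 * B * m) := by
  obtain ⟨D, hDm, hD, hDeq⟩ := hdev
  have hcd : c ≤ d := ht.1.trans ht.2
  have hcI : c ∈ Icc c d := ⟨le_rfl, hcd⟩
  have hB := hball.B_nonneg
  refine norm_sub_le_of_velocity (X := fun t => chart n q (x t)) (Y := fun t => chart n q (y t))
    (f := fun t => coordField q (g t) (chart n q (x t)))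
    (f' := fun t => coordField q (g' t) (chart n q (y t)))
    hball.L_nonneg hsmall (hxs.continuousOn hx.1.1) (hys.continuousOn hy.1.1)
    (hball.intervalIntegrable_coordField hg hcd (hxs.continuousOn hx.1.1) hxs.mapsTo)
    (hball.intervalIntegrable_coordField hg' hcd (hys.continuousOn hy.1.1) hys.mapsTo)
    (fun t ht => hxs.eq_add_integral hball hg hx hcI ht)
    (fun t ht => hys.eq_add_integral hball hg' hy hcI ht) hDm (by positivity) hm hD
    (fun t ht => ?_) ht
  have ht' := Ioo_subset_Icc_self ht
  have h1 := hball.norm_sub_le (hg'.mem t) (hxs t ht').2 (hys t ht').2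
  have h2 : ‖coordField q (g' t) (chart n q (x t)) - coordField q (g t) (chart n q (x t))‖ ≤
      D.indicator (fun _ => 2 * B) t := by
    by_cases htD : t ∈ D
    · rw [indicator_of_mem htD]
      refine (_root_.norm_sub_le _ _).trans ?_
      linarith [hball.bound _ (hg.mem t) _ (hxs t ht').2, hball.bound _ (hg'.mem t) _ (hxs t ht').2]
    · rw [indicator_of_notMem htD, hDeq t ht htD, sub_self, norm_zero]
  calc _ = ‖(coordField q (g' t) (chart n q (y t)) - coordField q (g' t) (chart n q (x t))) +
        (coordField q (g' t) (chart n q (x t)) - coordField q (g t) (chart n q (x t)))‖ := by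
        congr 1; abel
    _ ≤ _ := (norm_add_le _ _).trans (add_le_add h1 h2)

/-- The pairing of an adjoint curve with a vector field, in coordinates, is integrable. -/
theorem IsAdjoint.intervalIntegrable_local {g g' : ℝ → VField n M} {x : ℝ → M} {p : ℝ → Covec n}
    (hball : IsGoodBall 𝓕 q ξ₀ r B L) (hcd : c ≤ d) (hxs : StaysInBall q ξ₀ r x c d)
    (hx : IsSolution g x c d) (hp : IsAdjoint g x p c d) (hg' : IsAdmissible 𝓕 g') :
    IntervalIntegrable (fun t => p t (g' t (x t))) volume c d := by
  have hAC := (hp.1 q c d le_rfl hcd le_rfl fun t ht => (hxs t ht).1).continuousOn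
  rw [uIcc_of_le hcd] at hAC
  obtain ⟨C, hC⟩ := isCompact_Icc.exists_bound_of_continuousOn hAC
  obtain ⟨X', hXm, hXK, hXeq⟩ :=
    (hxs.continuousOn hx.1.1).exists_measurable_extension hcd hxs.mapsTo
  obtain ⟨π', hm, -, heq⟩ := hAC.exists_measurable_extension hcd (mapsTo_univ _ _)
  have hval : ∀ t ∈ Icc c d, p t (g' t (x t)) =
      coordCovec q (x t) (p t) (coordField q (g' t) (chart n q (x t))) := by
    intro t ht
    rw [coordField_chart (hxs t ht).1, coordCovec_toChart (hxs t ht).1]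
  have hev : Continuous fun z : Covec n × Eucl n => z.1 z.2 := by fun_prop
  refine intervalIntegrable_of_norm_le (B := C * B)
    (G' := fun t => π' t (coordField q (g' t) (X' t))) hcd
    (hev.measurable.comp (hm.prodMk (measurable_comp_curve (G := fun t => coordField q (g' t))
      (fun x _ => hg'.measurable_coordField q x) (fun t => hball.continuousOn (hg'.mem t))
      hXm hXK))) (fun t ht => ?_) fun t ht => ?_
  · rw [hval t ht]
    simp only [← heq ht, ← hXeq ht]
  · rw [hval t ht]
    refine (ContinuousLinearMap.le_opNorm _ _).trans (mul_le_mul (hC t ht)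
      (hball.bound _ (hg'.mem t) _ (hxs t ht).2) (norm_nonneg _) ((norm_nonneg _).trans (hC t ht)))

/-- The adjoint curve propagates the first variation: along a perturbation `y` of the solution `x`,
the pairing of the adjoint curve with the deviation changes, to first order, by the integral of the
change of the Hamiltonian along `x`. -/
theorem IsAdjoint.pairing_local {g : ℝ → VField n M} {x : ℝ → M} {p : ℝ → Covec n}
    (hball : IsGoodBall 𝓕 q ξ₀ r B L) (hcd : c ≤ d) (hxs : StaysInBall q ξ₀ r x c d)
    (hg : IsAdmissible 𝓕 g) (hx : IsSolution g x c d) (hp : IsAdjoint g x p c d) :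
    ∃ C, 0 ≤ C ∧ ∀ η > 0, ∃ ρ > 0, ∀ (g' : ℝ → VField n M) (y : ℝ → M) (m R : ℝ),
      IsAdmissible 𝓕 g' → StaysInBall q ξ₀ r y c d → IsSolution g' y c d → 0 ≤ m →
      DeviatesAtMost g g' c d m →
      (∀ t ∈ Icc c d, ‖chart n q (y t) - chart n q (x t)‖ ≤ R) → R ≤ ρ →
      |coordCovec q (x d) (p d) (chart n q (y d) - chart n q (x d)) -
        coordCovec q (x c) (p c) (chart n q (y c) - chart n q (x c)) -
        ∫ t in c..d, (p t (g' t (x t)) - p t (g t (x t)))| ≤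
      C * (η * R * (d - c) + 2 * L * R * m) := by
  have hAC := (hp.1 q c d le_rfl hcd le_rfl fun t ht => (hxs t ht).1).continuousOn
  rw [uIcc_of_le hcd] at hAC
  obtain ⟨C, hC⟩ := isCompact_Icc.exists_bound_of_continuousOn hAC
  have hC0 : 0 ≤ C := (norm_nonneg _).trans (hC c ⟨le_rfl, hcd⟩)
  obtain ⟨K, hK⟩ := hp.exists_lipschitzOnWith hx hball hg hxs hcd
  refine ⟨C, hC0, fun η hη => ?_⟩
  obtain ⟨ρ, hρ, hT⟩ := hball.taylor hη
  refine ⟨ρ, hρ, fun g' y m R hg' hys hy hm hdev hR hRρ => ?_⟩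
  obtain ⟨D, hDm, hD, hDeq⟩ := hdev
  have hL := hball.L_nonneg
  have hR0 : 0 ≤ R := (norm_nonneg _).trans (hR c ⟨le_rfl, hcd⟩)
  set π : ℝ → Covec n := fun t => coordCovec q (x t) (p t) with hπ
  set X : ℝ → Eucl n := fun t => chart n q (x t) with hX
  set Y : ℝ → Eucl n := fun t => chart n q (y t) with hY
  have hXL := hxs.lipschitzOnWith hball hg hx
  have hYL := hys.lipschitzOnWith hball hg' hy
  have hACp : AbsolutelyContinuousOnInterval (fun t => π t (Y t - X t)) c d :=
    absolutelyContinuousOnInterval_comp (Ψ := fun z : Covec n × Eucl n => z.1 z.2)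
      (O := univ) isOpen_univ (contDiff_fst.clm_apply contDiff_snd).contDiffOn hcd
      (γ := fun t => (π t, Y t - X t)) (hK.prodMk (hYL.sub hXL)) (mapsTo_univ _ _)
  set G : ℝ → ℝ := deriv fun t => π t (Y t - X t) with hG
  have hFTC : π d (Y d - X d) - π c (Y c - X c) = ∫ t in c..d, G t :=
    hACp.integral_deriv_eq_sub.symm
  have hGint : IntervalIntegrable G volume c d := hACp.intervalIntegrable_deriv
  have hI₁ := hp.intervalIntegrable_local hball hcd hxs hx hg'
  have hI₂ := hp.intervalIntegrable_local hball hcd hxs hx hg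
  rw [hFTC, ← intervalIntegral.integral_sub hGint (hI₁.sub hI₂)]
  have hbd : IntervalIntegrable (fun t => C * (η * R) + D.indicator (fun _ => C * (2 * L * R)) t)
      volume c d := intervalIntegrable_const.add (intervalIntegrable_indicator hDm _ c d)
  have hmain : ‖∫ t in c..d, (G t - (p t (g' t (x t)) - p t (g t (x t))))‖ ≤
      ∫ t in c..d, (C * (η * R) + D.indicator (fun _ => C * (2 * L * R)) t) := by
    refine intervalIntegral.norm_integral_le_of_norm_le hcd ?_ hbd
    filter_upwards [hp.2 q, hx.2, hy.2, ae_ne d] with t htp htx hty hne htI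
    have htI : t ∈ Ioo c d := ⟨htI.1, lt_of_le_of_ne htI.2 hne⟩
    have htI' := Ioo_subset_Icc_self htI
    have hxsrc := (hxs t htI').1
    have hysrc := (hys t htI').1
    have hX' := (htx htI).hasDerivAt_chart hxsrc
    have hY' := (hty htI).hasDerivAt_chart hysrc
    rw [← coordField_chart hxsrc] at hX'
    rw [← coordField_chart hysrc] at hY'
    have hder := (htp htI hxsrc).clm_apply (hY'.sub hX')
    have hGt : G t = (-(π t).comp (fderiv ℝ (coordField q (g t)) (X t))) (Y t - X t) +
      π t (coordField q (g' t) (Y t) - coordField q (g t) (X t)) := hder.deriv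
    have hp1 : p t (g' t (x t)) = π t (coordField q (g' t) (X t)) := by
      rw [hX, coordField_chart hxsrc, hπ, coordCovec_toChart hxsrc]
    have hp2 : p t (g t (x t)) = π t (coordField q (g t) (X t)) := by
      rw [hX, coordField_chart hxsrc, hπ, coordCovec_toChart hxsrc]
    have hdec : G t - (p t (g' t (x t)) - p t (g t (x t))) =
        π t (coordField q (g' t) (Y t) - coordField q (g' t) (X t) -
          fderiv ℝ (coordField q (g' t)) (X t) (Y t - X t)) +
        π t ((fderiv ℝ (coordField q (g' t)) (X t) - fderiv ℝ (coordField q (g t)) (X t))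
          (Y t - X t)) := by
      rw [hGt, hp1, hp2]
      simp only [map_sub, neg_apply, sub_apply, ContinuousLinearMap.comp_apply]
      ring
    have hδ : ‖Y t - X t‖ ≤ R := hR t htI'
    rw [hdec]
    refine (norm_add_le _ _).trans (add_le_add ?_ ?_)
    · refine ((π t).le_opNorm _).trans (mul_le_mul (hC t htI') ?_ (norm_nonneg _) hC0)
      refine (hT _ (hg'.mem t) _ (hxs t htI').2 _ (hys t htI').2 (hδ.trans hRρ)).trans ?_
      gcongr
    · by_cases htD : t ∈ D
      · rw [indicator_of_mem htD]
        refine ((π t).le_opNorm _).trans (mul_le_mul (hC t htI') ?_ (norm_nonneg _) hC0)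
        refine (ContinuousLinearMap.le_opNorm _ _).trans
          (mul_le_mul ?_ hδ (norm_nonneg _) (by positivity))
        refine (_root_.norm_sub_le _ _).trans ?_
        linarith [hball.bound_fderiv _ (hg.mem t) _ (hxs t htI').2,
          hball.bound_fderiv _ (hg'.mem t) _ (hxs t htI').2]
      · rw [indicator_of_notMem htD, hDeq t htI htD, sub_self]
        simp
  rw [intervalIntegral.integral_add intervalIntegrable_const
    (intervalIntegrable_indicator hDm _ c d), intervalIntegral.integral_const, smul_eq_mul,
    Real.norm_eq_abs] at hmain
  refine hmain.trans ?_
  have := integral_indicator_le hDm (K := C * (2 * L * R)) (by positivity) hm hD hcd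
  calc _ ≤ (d - c) * (C * (η * R)) + C * (2 * L * R) * m := by gcongr
    _ = _ := by ring

/-- A Lipschitz cutoff function, equal to `1` on the ball of radius `r / 2` around `ξ₀` and to `0`
off the ball of radius `r`. -/
def cutoff (ξ₀ : Eucl n) (r : ℝ) (ξ : Eucl n) : ℝ := max 0 (min 1 (2 - 2 / r * ‖ξ - ξ₀‖))

theorem cutoff_nonneg (ξ₀ : Eucl n) (r : ℝ) (ξ : Eucl n) : 0 ≤ cutoff ξ₀ r ξ := le_max_left _ _

theorem cutoff_le_one (ξ₀ : Eucl n) (r : ℝ) (ξ : Eucl n) : cutoff ξ₀ r ξ ≤ 1 :=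
  max_le zero_le_one (min_le_left _ _)

theorem cutoff_eq_one {ξ₀ ξ : Eucl n} {r : ℝ} (hr : 0 < r)
    (h : ξ ∈ Metric.closedBall ξ₀ (r / 2)) : cutoff ξ₀ r ξ = 1 := by
  rw [Metric.mem_closedBall, dist_eq_norm] at h
  have : 2 / r * ‖ξ - ξ₀‖ ≤ 2 / r * (r / 2) := by gcongr
  have h2 : 2 / r * (r / 2) = 1 := by field_simp
  rw [cutoff, min_eq_left (by linarith), max_eq_right zero_le_one]

theorem cutoff_eq_zero {ξ₀ ξ : Eucl n} {r : ℝ} (hr : 0 < r)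
    (h : ξ ∉ Metric.closedBall ξ₀ r) : cutoff ξ₀ r ξ = 0 := by
  rw [Metric.mem_closedBall, dist_eq_norm, not_le] at h
  have : 2 / r * r ≤ 2 / r * ‖ξ - ξ₀‖ := by gcongr
  have h2 : 2 / r * r = 2 := by field_simp
  rw [cutoff, max_eq_left]
  exact (min_le_right _ _).trans (by linarith)

theorem abs_cutoff_sub_le (ξ₀ : Eucl n) {r : ℝ} (hr : 0 < r) (ξ ξ' : Eucl n) :
    |cutoff ξ₀ r ξ - cutoff ξ₀ r ξ'| ≤ 2 / r * ‖ξ - ξ'‖ := by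
  have h1 : |cutoff ξ₀ r ξ - cutoff ξ₀ r ξ'| ≤
      |(2 - 2 / r * ‖ξ - ξ₀‖) - (2 - 2 / r * ‖ξ' - ξ₀‖)| := by
    refine (abs_max_sub_max_le_max _ _ _ _).trans ?_
    rw [sub_self, abs_zero, max_eq_right (abs_nonneg _)]
    refine (abs_min_sub_min_le_max _ _ _ _).trans ?_
    rw [sub_self, abs_zero, max_eq_right (abs_nonneg _)]
  refine h1.trans ?_
  have h2 : (2 - 2 / r * ‖ξ - ξ₀‖) - (2 - 2 / r * ‖ξ' - ξ₀‖) =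
    2 / r * (‖ξ' - ξ₀‖ - ‖ξ - ξ₀‖) := by ring
  rw [h2, abs_mul, abs_of_pos (by positivity)]
  gcongr
  refine (abs_norm_sub_norm_le _ _).trans ?_
  rw [sub_sub_sub_cancel_right, norm_sub_rev]

/-- The field in the chart, cut off outside of a good ball, is globally Lipschitz. -/
theorem IsGoodBall.lipschitzWith_cutoff (hball : IsGoodBall 𝓕 q ξ₀ r B L) {V : VField n M}
    (hV : V ∈ 𝓕) (hk : 0 ≤ L + 2 * B / r) :
    LipschitzWith ⟨L + 2 * B / r, hk⟩ (fun ξ => cutoff ξ₀ r ξ • coordField q V ξ) := by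
  have hr := hball.r_pos
  have hB := hball.B_nonneg
  have hL := hball.L_nonneg
  -- one of the two points may be assumed to lie in the ball
  have key : ∀ ξ ξ', ξ ∈ Metric.closedBall ξ₀ r →
      ‖cutoff ξ₀ r ξ • coordField q V ξ - cutoff ξ₀ r ξ' • coordField q V ξ'‖ ≤
        (L + 2 * B / r) * ‖ξ - ξ'‖ := by
    intro ξ ξ' hξ
    have hb := hball.bound V hV ξ hξ
    have hc := abs_cutoff_sub_le ξ₀ hr ξ ξ'
    have e : cutoff ξ₀ r ξ • coordField q V ξ - cutoff ξ₀ r ξ' • coordField q V ξ' =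
        (cutoff ξ₀ r ξ - cutoff ξ₀ r ξ') • coordField q V ξ +
          cutoff ξ₀ r ξ' • (coordField q V ξ - coordField q V ξ') := by
      simp only [sub_smul, smul_sub]; abel
    have h1 : ‖(cutoff ξ₀ r ξ - cutoff ξ₀ r ξ') • coordField q V ξ‖ ≤
        2 / r * ‖ξ - ξ'‖ * B := by
      rw [norm_smul, Real.norm_eq_abs]
      gcongr
    have h2 : ‖cutoff ξ₀ r ξ' • (coordField q V ξ - coordField q V ξ')‖ ≤ L * ‖ξ - ξ'‖ := by
      by_cases hξ' : ξ' ∈ Metric.closedBall ξ₀ r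
      · rw [norm_smul, Real.norm_eq_abs, abs_of_nonneg (cutoff_nonneg _ _ _)]
        calc _ ≤ 1 * (L * ‖ξ - ξ'‖) := by
              gcongr
              · exact cutoff_le_one _ _ _
              · exact hball.norm_sub_le hV hξ' hξ
          _ = _ := one_mul _
      · rw [cutoff_eq_zero hr hξ', zero_smul, norm_zero]
        positivity
    rw [e]
    calc _ ≤ 2 / r * ‖ξ - ξ'‖ * B + L * ‖ξ - ξ'‖ := (norm_add_le _ _).trans (add_le_add h1 h2)
      _ = _ := by ring
  refine LipschitzWith.of_dist_le_mul fun ξ ξ' => ?_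
  rw [dist_eq_norm, dist_eq_norm]
  by_cases hξ : ξ ∈ Metric.closedBall ξ₀ r
  · exact key ξ ξ' hξ
  by_cases hξ' : ξ' ∈ Metric.closedBall ξ₀ r
  · rw [norm_sub_rev, norm_sub_rev ξ]
    exact key ξ' ξ hξ'
  · rw [cutoff_eq_zero hr hξ, cutoff_eq_zero hr hξ']
    simp only [zero_smul, sub_self, norm_zero]
    exact mul_nonneg hk (norm_nonneg _)

/-- Existence of a solution of a perturbed equation, near a short arc of a given solution. -/
theorem IsShortArc.exists_solution {x : ℝ → M} (hs : IsShortArc 𝓕 q ξ₀ r B L x c d) (hcd : c ≤ d)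
    {g g' : ℝ → VField n M} (hg : IsAdmissible 𝓕 g) (hg' : IsAdmissible 𝓕 g')
    (hx : IsSolution g x c d) {m : ℝ} (hm : 0 ≤ m) (hdev : DeviatesAtMost g g' c d m)
    {y₀ : M} (hy₀ : y₀ ∈ (chart n q).source)
    (hclose : 2 * (‖chart n q y₀ - chart n q (x c)‖ + 2 * B * m) ≤ r / 4) :
    ∃ y : ℝ → M, y c = y₀ ∧ IsSolution g' y c d ∧ StaysInBall q ξ₀ r y c d ∧
      ∀ t ∈ Icc c d, ‖chart n q (y t) - chart n q (x t)‖ ≤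
        2 * (‖chart n q y₀ - chart n q (x c)‖ + 2 * B * m) := by
  have hball := hs.ball
  have hr := hball.r_pos
  have hB := hball.B_nonneg
  have hL := hball.L_nonneg
  have hk : 0 ≤ L + 2 * B / r := by positivity
  have hcI : c ∈ Icc c d := ⟨le_rfl, hcd⟩
  have hbound : ∀ V ∈ 𝓕, ∀ ξ, ‖cutoff ξ₀ r ξ • coordField q V ξ‖ ≤ B := by
    intro V hV ξ
    by_cases hξ : ξ ∈ Metric.closedBall ξ₀ r
    · rw [norm_smul, Real.norm_eq_abs, abs_of_nonneg (cutoff_nonneg _ _ _), ← one_mul B]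
      exact mul_le_mul (cutoff_le_one _ _ _) (hball.bound V hV ξ hξ) (norm_nonneg _) zero_le_one
    · rw [cutoff_eq_zero hr hξ, zero_smul, norm_zero]
      exact hB
  have hmeas : ∀ ξ, Measurable fun t => cutoff ξ₀ r ξ • coordField q (g' t) ξ := fun ξ =>
    (hg'.measurable_coordField q ξ).const_smul (cutoff ξ₀ r ξ)
  obtain ⟨Y, hYc, hY⟩ := exists_integral_solution
    (G := fun t ξ => cutoff ξ₀ r ξ • coordField q (g' t) ξ) hmeas
    (fun t => hball.lipschitzWith_cutoff (hg'.mem t) hk) (B := B)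
    (fun t => hbound _ (hg'.mem t) 0) hs.short hcI (chart n q y₀)
  have hYc0 : Y c = chart n q y₀ := by
    rw [hY c hcI, intervalIntegral.integral_same, add_zero]
  have hYint : IntervalIntegrable (fun t => cutoff ξ₀ r (Y t) • coordField q (g' t) (Y t))
      volume c d := by
    refine intervalIntegrable_of_norm_le (B := B) hcd (G' := fun t => cutoff ξ₀ r (Y t) •
      coordField q (g' t) (Y t)) ?_ (fun _ _ => rfl) fun t _ => hbound _ (hg'.mem t) _
    exact measurable_comp_curve (K := univ)
      (G := fun t ξ => cutoff ξ₀ r ξ • coordField q (g' t) ξ) (fun ξ _ => hmeas ξ)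
      (fun t => (hball.lipschitzWith_cutoff (hg'.mem t) hk).continuous.continuousOn)
      hYc.measurable fun _ => mem_univ _
  obtain ⟨D, hDm, hD, hDeq⟩ := hdev
  have hXball : ∀ t ∈ Icc c d, chart n q (x t) ∈ Metric.closedBall ξ₀ (r / 2) := fun t ht =>
    Metric.closedBall_subset_closedBall (by linarith) (hs.stays t ht).2
  have hdist : ∀ t ∈ Icc c d, ‖Y t - chart n q (x t)‖ ≤
      2 * (‖chart n q y₀ - chart n q (x c)‖ + 2 * B * m) := by
    intro t ht
    rw [← hYc0]
    refine norm_sub_le_of_velocity (X := fun t => chart n q (x t))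
      (f := fun t => coordField q (g t) (chart n q (x t)))
      (f' := fun t => cutoff ξ₀ r (Y t) • coordField q (g' t) (Y t))
      hk hs.short (hs.stays.continuousOn hx.1.1) hYc.continuousOn
      (hball.intervalIntegrable_coordField hg hcd (hs.stays.continuousOn hx.1.1) hs.stays'.mapsTo)
      hYint (fun t ht => hs.stays'.eq_add_integral hball hg hx hcI ht)
      (fun t ht => by rw [hYc0]; exact hY t ht) hDm (by positivity) hm hD
      (fun t ht => ?_) ht
    have ht' := Ioo_subset_Icc_self ht
    have h1 := (hball.lipschitzWith_cutoff (hg'.mem t) hk).norm_sub_le (Y t) (chart n q (x t))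
    simp only [cutoff_eq_one hr (hXball t ht'), one_smul] at h1
    have h2 : ‖coordField q (g' t) (chart n q (x t)) - coordField q (g t) (chart n q (x t))‖ ≤
        D.indicator (fun _ => 2 * B) t := by
      by_cases htD : t ∈ D
      · rw [indicator_of_mem htD]
        refine (_root_.norm_sub_le _ _).trans ?_
        linarith [hball.bound _ (hg.mem t) _ (hs.stays' t ht').2,
          hball.bound _ (hg'.mem t) _ (hs.stays' t ht').2]
      · rw [indicator_of_notMem htD, hDeq t ht htD, sub_self, norm_zero]
    calc _ = ‖(cutoff ξ₀ r (Y t) • coordField q (g' t) (Y t) -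
          coordField q (g' t) (chart n q (x t))) +
          (coordField q (g' t) (chart n q (x t)) - coordField q (g t) (chart n q (x t)))‖ := by
          congr 1; abel
      _ ≤ _ := (norm_add_le _ _).trans (add_le_add h1 h2)
  -- the solution does not leave the part of the ball where the cutoff function is equal to one
  have hYhalf : ∀ t ∈ Icc c d, Y t ∈ Metric.closedBall ξ₀ (r / 2) := by
    intro t ht
    have h1 := hdist t ht
    have h2 := (hs.stays t ht).2
    rw [← dist_eq_norm] at h1
    rw [Metric.mem_closedBall] at h2 ⊢
    linarith [dist_triangle (Y t) (chart n q (x t)) ξ₀]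
  have hYball : MapsTo Y (Icc c d) (Metric.closedBall ξ₀ r) := fun t ht =>
    Metric.closedBall_subset_closedBall (by linarith) (hYhalf t ht)
  have hright : ∀ t ∈ Icc c d, chart n q ((chart n q).symm (Y t)) = Y t := fun t ht =>
    (chart n q).right_inv (hball.subset (hYball ht))
  refine ⟨fun t => (chart n q).symm (Y t), by simp only [hYc0, (chart n q).left_inv hy₀],
    hball.isSolution hg' hcd hYc.continuousOn hYball fun t ht => ?_, fun t ht => ⟨?_, ?_⟩,
    fun t ht => ?_⟩
  · rw [hY t ht, hYc0]
    congr 1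
    refine intervalIntegral.integral_congr fun s hs' => ?_
    simp only [cutoff_eq_one hr (hYhalf s (uIcc_subset_Icc hcI ht hs')), one_smul]
  · exact (chart n q).map_target (hball.subset (hYball ht))
  · rw [hright t ht]; exact hYball ht
  · rw [hright t ht]; exact hdist t ht

end

section

/-! ### Families of perturbed trajectories -/

variable {n : ℕ} {M : Type*} [TopologicalSpace M] [ChartedSpace (EuclideanSpace ℝ (Fin n)) M]

/-- The curves `xε ε` converge to `x` uniformly on `[a, b]` as `ε ↓ 0`, that is, in the
compact-open topology. -/
def UniformlyClose (x : ℝ → M) (xε : ℝ → ℝ → M) (a b : ℝ) : Prop :=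
  ∀ (c d : ℝ) (W : Set M), a ≤ c → d ≤ b → IsOpen W → MapsTo x (Icc c d) W →
    ∀ᶠ ε in 𝓝[>] (0 : ℝ), MapsTo (xε ε) (Icc c d) W

/-- The points `y ε` are at distance `O(ε)` from `x₀`, as measured by differentiable functions. -/
def IsFirstOrderClose (n : ℕ) {M : Type*} [TopologicalSpace M]
    [ChartedSpace (EuclideanSpace ℝ (Fin n)) M] (x₀ : M) (y : ℝ → M) : Prop :=
  Tendsto y (𝓝[>] 0) (𝓝 x₀) ∧ ∀ θ : M → Eucl n, MDifferentiableAt (𝓡 n) 𝓘(ℝ, Eucl n) θ x₀ →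
    (fun ε => θ (y ε) - θ x₀) =O[𝓝[>] 0] fun ε => ε

/-- The pairing of the covector `p` at `x₀` with the displacement from `x₀` to `y ε` is
`A ε + o(ε)`, the displacement being measured by functions with differential `p` at `x₀`. -/
def HasVariation (x₀ : M) (y : ℝ → M) (p : Covec n) (A : ℝ → ℝ) : Prop :=
  ∀ θ : M → ℝ, HasMFDerivAt (𝓡 n) 𝓘(ℝ, ℝ) θ x₀ (show TangentSpace (𝓡 n) x₀ →L[ℝ] ℝ from p) →
    (fun ε => θ (y ε) - θ x₀ - A ε) =o[𝓝[>] 0] fun ε => ε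

theorem UniformlyClose.mono {x : ℝ → M} {xε : ℝ → ℝ → M} {a b c d : ℝ}
    (h : UniformlyClose x xε a b) (hac : a ≤ c) (hdb : d ≤ b) : UniformlyClose x xε c d :=
  fun s t W hs ht hW hmap => h s t W (hac.trans hs) (ht.trans hdb) hW hmap

theorem UniformlyClose.trans {x : ℝ → M} {xε : ℝ → ℝ → M} {a b c : ℝ}
    (h₁ : UniformlyClose x xε a b) (h₂ : UniformlyClose x xε b c) : UniformlyClose x xε a c := by
  intro s t W hs ht hW hmap
  filter_upwards [h₁ s (min t b) W hs (min_le_right _ _) hW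
      (hmap.mono_left (Icc_subset_Icc_right (min_le_left _ _))),
    h₂ (max s b) t W (le_max_right _ _) ht hW
      (hmap.mono_left (Icc_subset_Icc_left (le_max_left _ _)))] with ε e₁ e₂ τ hτ
  rcases le_total τ b with h | h
  · exact e₁ ⟨hτ.1, le_min hτ.2 h⟩
  · exact e₂ ⟨max_le hτ.1 h, hτ.2⟩

theorem UniformlyClose.congr {x : ℝ → M} {xε yε : ℝ → ℝ → M} {a b : ℝ}
    (h : UniformlyClose x xε a b) (heq : ∀ᶠ ε in 𝓝[>] (0 : ℝ), EqOn (yε ε) (xε ε) (Icc a b)) :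
    UniformlyClose x yε a b := by
  intro s t W hs ht hW hmap
  filter_upwards [h s t W hs ht hW hmap, heq] with ε e₁ e₂
  exact e₁.congr (e₂.mono (Icc_subset_Icc hs ht)).symm

variable [IsManifold (𝓡 n) ∞ M]

theorem isFirstOrderClose_const (x₀ : M) : IsFirstOrderClose n x₀ fun _ => x₀ :=
  ⟨tendsto_const_nhds, fun θ _ => by
    simpa only [sub_self] using Asymptotics.isBigO_zero _ _⟩

theorem hasVariation_const (x₀ : M) (p : Covec n) : HasVariation x₀ (fun _ => x₀) p fun _ => 0 :=
  fun θ _ => by simp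

theorem IsFirstOrderClose.chart {x₀ q : M} {y : ℝ → M} (h : IsFirstOrderClose n x₀ y)
    (hq : x₀ ∈ (chart n q).source) :
    (fun ε => chart n q (y ε) - chart n q x₀) =O[𝓝[>] 0] fun ε => ε :=
  h.2 _ (hasMFDerivAt_chart hq).mdifferentiableAt

theorem eventuallyEq_chart_symm {x₀ q : M} {y : ℝ → M} (hy : Tendsto y (𝓝[>] 0) (𝓝 x₀))
    (hq : x₀ ∈ (chart n q).source) :
    ∀ᶠ ε in 𝓝[>] (0 : ℝ), (chart n q).symm (chart n q (y ε)) = y ε := by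
  filter_upwards [hy ((isOpen_chart_source q).mem_nhds hq)] with ε hε
  exact (chart n q).left_inv hε

theorem isFirstOrderClose_of_chart {x₀ q : M} {y : ℝ → M} (hy : Tendsto y (𝓝[>] 0) (𝓝 x₀))
    (hq : x₀ ∈ (chart n q).source)
    (h : (fun ε => chart n q (y ε) - chart n q x₀) =O[𝓝[>] 0] fun ε => ε) :
    IsFirstOrderClose n x₀ y := by
  refine ⟨hy, fun θ hθ => ?_⟩
  have hd := (hasFDerivAt_comp_chart_symm hq hθ).isBigO_sub
  have ht : Tendsto (fun ε => chart n q (y ε)) (𝓝[>] 0) (𝓝 (chart n q x₀)) :=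
    (chart_continuousAt hq).tendsto.comp hy
  refine ((hd.comp_tendsto ht).congr' ?_ EventuallyEq.rfl).trans h
  filter_upwards [eventuallyEq_chart_symm hy hq] with ε hε
  simp only [Function.comp_apply, hε, (chart n q).left_inv hq]

theorem HasVariation.chart {x₀ q : M} {y : ℝ → M} {p : Covec n} {A : ℝ → ℝ}
    (h : HasVariation x₀ y p A) (hq : x₀ ∈ (chart n q).source) :
    (fun ε => coordCovec q x₀ p (chart n q (y ε) - chart n q x₀) - A ε) =o[𝓝[>] 0]
      fun ε => ε := by
  have h1 := hasMFDerivAt_comp_chart hq (coordCovec q x₀ p).hasFDerivAt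
  have h2 : (coordCovec q x₀ p).comp (toChart q x₀) = p := by
    ext v
    exact coordCovec_toChart hq p v
  simpa only [map_sub] using h _ (h1.congr_mfderiv h2)

theorem hasVariation_of_chart {x₀ q : M} {y : ℝ → M} {p : Covec n} {A : ℝ → ℝ}
    (hy : IsFirstOrderClose n x₀ y) (hq : x₀ ∈ (chart n q).source)
    (h : (fun ε => coordCovec q x₀ p (chart n q (y ε) - chart n q x₀) - A ε) =o[𝓝[>] 0]
      fun ε => ε) : HasVariation x₀ y p A := by
  intro θ hθ
  have hd0 := hasFDerivAt_comp_chart_symm hq hθ.mdifferentiableAt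
  rw [hθ.mfderiv] at hd0
  have hd : HasFDerivAt (fun ξ => θ ((chart n q).symm ξ)) (coordCovec q x₀ p) (chart n q x₀) := hd0
  have ht : Tendsto (fun ε => chart n q (y ε)) (𝓝[>] 0) (𝓝 (chart n q x₀)) :=
    (chart_continuousAt hq).tendsto.comp hy.1
  have h1 := (hd.isLittleO.comp_tendsto ht).trans_isBigO (hy.chart hq)
  refine (h1.add h).congr' ?_ EventuallyEq.rfl
  filter_upwards [eventuallyEq_chart_symm hy.1 hq] with ε hε
  simp only [Function.comp_apply, hε, (chart n q).left_inv hq]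
  ring

/-- The fields `gε ε` are admissible, and differ from `g` on `[a, b]` only on a set of times of
measure `O(ε)`. -/
structure IsPerturbation (𝓕 : Set (VField n M)) (g : ℝ → VField n M) (gε : ℝ → ℝ → VField n M)
    (a b : ℝ) : Prop where
  admissible : ∀ ε, IsAdmissible 𝓕 (gε ε)
  deviates : ∃ C, 0 ≤ C ∧ ∀ᶠ ε in 𝓝[>] (0 : ℝ), DeviatesAtMost g (gε ε) a b (C * ε)

theorem IsPerturbation.mono {𝓕 : Set (VField n M)} {g : ℝ → VField n M} {gε : ℝ → ℝ → VField n M}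
    {a b c d : ℝ} (h : IsPerturbation 𝓕 g gε a b) (hac : a ≤ c) (hdb : d ≤ b) :
    IsPerturbation 𝓕 g gε c d := by
  obtain ⟨C, hC, hev⟩ := h.deviates
  exact ⟨h.admissible, C, hC, hev.mono fun ε hε => hε.mono hac hdb⟩

variable {𝓕 : Set (VField n M)} {q : M} {ξ₀ : Eucl n} {r B L : ℝ} {c d : ℝ}
  {g : ℝ → VField n M} {gε : ℝ → ℝ → VField n M} {x : ℝ → M} {xε : ℝ → ℝ → M}

theorem IsShortArc.eventually_staysInBall (hs : IsShortArc 𝓕 q ξ₀ r B L x c d)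
    (hclose : UniformlyClose x xε c d) :
    ∀ᶠ ε in 𝓝[>] (0 : ℝ), StaysInBall q ξ₀ r (xε ε) c d := by
  have hr := hs.ball.r_pos
  have hW : IsOpen ((chart n q).source ∩ chart n q ⁻¹' Metric.ball ξ₀ r) :=
    (continuousOn_extChartAt q).isOpen_inter_preimage (isOpen_chart_source q) Metric.isOpen_ball
  filter_upwards [hclose c d _ le_rfl le_rfl hW fun t ht => ⟨(hs.stays t ht).1,
    Metric.closedBall_subset_ball (by linarith) (hs.stays t ht).2⟩] with ε hε t ht
  exact ⟨(hε ht).1, Metric.ball_subset_closedBall (hε ht).2⟩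

/-- Perturbed trajectories deviate by `O(ε)` along a short arc, uniformly in time. -/
theorem IsShortArc.uniform_rate (hs : IsShortArc 𝓕 q ξ₀ r B L x c d) (hcd : c ≤ d)
    (hg : IsAdmissible 𝓕 g) (hgε : IsPerturbation 𝓕 g gε c d) (hx : IsSolution g x c d)
    (hxε : ∀ᶠ ε in 𝓝[>] (0 : ℝ), IsSolution (gε ε) (xε ε) c d)
    (hclose : UniformlyClose x xε c d) (hc : IsFirstOrderClose n (x c) fun ε => xε ε c) :
    ∃ K, 0 ≤ K ∧ ∀ᶠ ε in 𝓝[>] (0 : ℝ), ∀ t ∈ Icc c d,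
      ‖chart n q (xε ε t) - chart n q (x t)‖ ≤ K * ε := by
  obtain ⟨C, hC, hdev⟩ := hgε.deviates
  obtain ⟨C₁, hC₁, h₁⟩ := (hc.chart (hs.stays c ⟨le_rfl, hcd⟩).1).exists_nonneg
  have hB := hs.ball.B_nonneg
  refine ⟨2 * (C₁ + 2 * B * C), by positivity, ?_⟩
  filter_upwards [hdev, hxε, hs.eventually_staysInBall hclose, h₁.bound, self_mem_nhdsWithin]
    with ε hdev hxε hst h₁ hpos t ht
  have hpos : 0 < ε := hpos
  have := hs.ball.norm_sub_solution_le (hs.short' hcd) hg (hgε.admissible ε) hs.stays' hst hx hxε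
    (by positivity) hdev ht
  rw [Real.norm_eq_abs, abs_of_pos hpos] at h₁
  refine this.trans ?_
  calc _ ≤ 2 * (C₁ * ε + 2 * B * (C * ε)) := by gcongr
    _ = _ := by ring

theorem UniformlyClose.tendsto {a b : ℝ} (h : UniformlyClose x xε a b) {t : ℝ}
    (ht : t ∈ Icc a b) : Tendsto (fun ε => xε ε t) (𝓝[>] 0) (𝓝 (x t)) := by
  rw [tendsto_nhds]
  intro W hW hxW
  filter_upwards [h t t W ht.1 ht.2 hW fun s hs => by
    rw [Icc_self, mem_singleton_iff] at hs; rwa [hs]] with ε hε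
  exact hε ⟨le_rfl, le_rfl⟩

theorem IsShortArc.isFirstOrderClose (hs : IsShortArc 𝓕 q ξ₀ r B L x c d) (hcd : c ≤ d)
    (hg : IsAdmissible 𝓕 g) (hgε : IsPerturbation 𝓕 g gε c d) (hx : IsSolution g x c d)
    (hxε : ∀ᶠ ε in 𝓝[>] (0 : ℝ), IsSolution (gε ε) (xε ε) c d)
    (hclose : UniformlyClose x xε c d) (hc : IsFirstOrderClose n (x c) fun ε => xε ε c) {t : ℝ}
    (ht : t ∈ Icc c d) : IsFirstOrderClose n (x t) fun ε => xε ε t := by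
  obtain ⟨K, hK, h⟩ := hs.uniform_rate hcd hg hgε hx hxε hclose hc
  refine isFirstOrderClose_of_chart (hclose.tendsto ht) (hs.stays t ht).1
    (Asymptotics.IsBigO.of_bound K ?_)
  filter_upwards [h, self_mem_nhdsWithin] with ε hε hpos
  rw [Real.norm_eq_abs, abs_of_pos hpos]
  exact hε t ht

theorem IsShortArc.hasVariation (hs : IsShortArc 𝓕 q ξ₀ r B L x c d) (hcd : c ≤ d)
    (hg : IsAdmissible 𝓕 g) (hgε : IsPerturbation 𝓕 g gε c d) (hx : IsSolution g x c d)
    (hxε : ∀ᶠ ε in 𝓝[>] (0 : ℝ), IsSolution (gε ε) (xε ε) c d)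
    (hclose : UniformlyClose x xε c d) (hc : IsFirstOrderClose n (x c) fun ε => xε ε c)
    {p : ℝ → Covec n} (hp : IsAdjoint g x p c d) {A : ℝ → ℝ}
    (hA : HasVariation (x c) (fun ε => xε ε c) (p c) A) :
    HasVariation (x d) (fun ε => xε ε d) (p d) fun ε =>
      A ε + ∫ t in c..d, (p t (gε ε t (x t)) - p t (g t (x t))) := by
  have hdI : d ∈ Icc c d := ⟨hcd, le_rfl⟩
  obtain ⟨K, hK, hrate⟩ := hs.uniform_rate hcd hg hgε hx hxε hclose hc
  obtain ⟨C₀, hC₀, hdev⟩ := hgε.deviates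
  obtain ⟨C, hC, hpair⟩ := hp.pairing_local hs.ball hcd hs.stays' hg hx
  have hL := hs.ball.L_nonneg
  refine hasVariation_of_chart (hs.isFirstOrderClose hcd hg hgε hx hxε hclose hc hdI)
    (hs.stays d hdI).1 ?_
  have hA' := hA.chart (hs.stays c ⟨le_rfl, hcd⟩).1
  have hrest : (fun ε => coordCovec q (x d) (p d) (chart n q (xε ε d) - chart n q (x d)) -
      coordCovec q (x c) (p c) (chart n q (xε ε c) - chart n q (x c)) -
      ∫ t in c..d, (p t (gε ε t (x t)) - p t (g t (x t)))) =o[𝓝[>] 0] fun ε => ε := by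
    rw [Asymptotics.isLittleO_iff]
    intro κ hκ
    have hdc : 0 ≤ d - c := sub_nonneg.2 hcd
    set η := κ / 2 / (C * K * (d - c) + 1) with hη
    have hη0 : 0 < η := by positivity
    obtain ⟨ρ, hρ, hpair⟩ := hpair η hη0
    have hlim₁ : ∀ᶠ ε in 𝓝[>] (0 : ℝ), K * ε < ρ := by
      have : Tendsto (fun ε : ℝ => K * ε) (𝓝[>] 0) (𝓝 (K * 0)) :=
        (tendsto_id.const_mul K).mono_left nhdsWithin_le_nhds
      exact this.eventually_lt_const (by simpa using hρ)
    have hlim₂ : ∀ᶠ ε in 𝓝[>] (0 : ℝ), C * (2 * L * K * C₀) * ε < κ / 2 := by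
      have : Tendsto (fun ε : ℝ => C * (2 * L * K * C₀) * ε) (𝓝[>] 0)
          (𝓝 (C * (2 * L * K * C₀) * 0)) :=
        (tendsto_id.const_mul _).mono_left nhdsWithin_le_nhds
      exact this.eventually_lt_const (by simp [hκ])
    filter_upwards [hlim₁, hlim₂, hrate, hdev, hxε, hs.eventually_staysInBall hclose,
      self_mem_nhdsWithin] with ε h₁ h₂ hrate hdev hxε hst hpos
    have hpos : 0 < ε := hpos
    rw [Real.norm_eq_abs, Real.norm_eq_abs, abs_of_pos hpos]
    refine (hpair (gε ε) (xε ε) (C₀ * ε) (K * ε) (hgε.admissible ε) hst hxε (by positivity) hdev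
      hrate h₁.le).trans ?_
    have h3 : C * K * (d - c) * η ≤ κ / 2 := by
      rw [hη, mul_div_assoc', div_le_iff₀ (by positivity)]
      nlinarith
    calc C * (η * (K * ε) * (d - c) + 2 * L * (K * ε) * (C₀ * ε))
        = (C * K * (d - c) * η + C * (2 * L * K * C₀) * ε) * ε := by ring
      _ ≤ (κ / 2 + κ / 2) * ε := by gcongr
      _ = κ * ε := by ring
  refine (hrest.add hA').congr (fun ε => ?_) fun _ => rfl
  ring

theorem IsShortArc.exists_family (hs : IsShortArc 𝓕 q ξ₀ r B L x c d) (hcd : c ≤ d)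
    (hg : IsAdmissible 𝓕 g) (hgε : IsPerturbation 𝓕 g gε c d) (hx : IsSolution g x c d)
    {y₀ : ℝ → M} (hy₀ : IsFirstOrderClose n (x c) y₀) :
    ∃ xε : ℝ → ℝ → M, (∀ᶠ ε in 𝓝[>] (0 : ℝ), xε ε c = y₀ ε) ∧
      (∀ᶠ ε in 𝓝[>] (0 : ℝ), IsSolution (gε ε) (xε ε) c d) ∧ UniformlyClose x xε c d := by
  obtain ⟨C, hC, hdev⟩ := hgε.deviates
  have hcsrc := (hs.stays c ⟨le_rfl, hcd⟩).1
  obtain ⟨C₁, hC₁, h₁⟩ := (hy₀.chart hcsrc).exists_nonneg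
  have hB := hs.ball.B_nonneg
  have hr := hs.ball.r_pos
  set K := 2 * (C₁ + 2 * B * C) with hK
  have hlim : Tendsto (fun ε : ℝ => K * ε) (𝓝[>] 0) (𝓝 0) := by
    have : Tendsto (fun ε : ℝ => K * ε) (𝓝[>] 0) (𝓝 (K * 0)) :=
      (tendsto_id.const_mul K).mono_left nhdsWithin_le_nhds
    simpa using this
  have hex : ∀ᶠ ε in 𝓝[>] (0 : ℝ), ∃ y : ℝ → M, y c = y₀ ε ∧ IsSolution (gε ε) y c d ∧
      StaysInBall q ξ₀ r y c d ∧ ∀ t ∈ Icc c d, ‖chart n q (y t) - chart n q (x t)‖ ≤ K * ε := by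
    filter_upwards [hdev, h₁.bound, hlim.eventually_lt_const (u := r / 4) (by positivity),
      hy₀.1 ((isOpen_chart_source q).mem_nhds hcsrc), self_mem_nhdsWithin]
      with ε hdev h₁ hsmall hsrc hpos
    have hpos : 0 < ε := hpos
    rw [Real.norm_eq_abs, abs_of_pos hpos] at h₁
    have hle : 2 * (‖chart n q (y₀ ε) - chart n q (x c)‖ + 2 * B * (C * ε)) ≤ K * ε := by
      calc _ ≤ 2 * (C₁ * ε + 2 * B * (C * ε)) := by gcongr
        _ = _ := by ring
    obtain ⟨y, hyc, hy, hst, hyx⟩ := hs.exists_solution hcd hg (hgε.admissible ε) hx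
      (by positivity) hdev hsrc (hle.trans hsmall.le)
    exact ⟨y, hyc, hy, hst, fun t ht => (hyx t ht).trans hle⟩
  obtain ⟨xε, h⟩ := hex.choice
  refine ⟨xε, h.mono fun ε hε => hε.1, h.mono fun ε hε => hε.2.1, ?_⟩
  intro s t W hs' ht' hW hmap
  have hsub : Icc s t ⊆ Icc c d := Icc_subset_Icc hs' ht'
  have hcomp : IsCompact ((fun τ => chart n q (x τ)) '' Icc s t) :=
    isCompact_Icc.image_of_continuousOn ((hs.stays.continuousOn hx.1.1).mono hsub)
  have hO : IsOpen ((chart n q).target ∩ (chart n q).symm ⁻¹' W) :=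
    (continuousOn_extChartAt_symm q).isOpen_inter_preimage (isOpen_chart_target q) hW
  obtain ⟨δ, hδ, hthick⟩ := hcomp.exists_thickening_subset_open hO (by
    rintro _ ⟨τ, hτ, rfl⟩
    refine ⟨(chart n q).map_source (hs.stays τ (hsub hτ)).1, ?_⟩
    rw [mem_preimage, (chart n q).left_inv (hs.stays τ (hsub hτ)).1]
    exact hmap hτ)
  filter_upwards [h, hlim.eventually_lt_const hδ] with ε hε hlt τ hτ
  have hmem : chart n q (xε ε τ) ∈ (chart n q).target ∩ (chart n q).symm ⁻¹' W := by
    refine hthick (Metric.mem_thickening_iff.2 ⟨_, mem_image_of_mem _ hτ, ?_⟩)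
    rw [dist_eq_norm]
    exact (hε.2.2.2 τ (hsub hτ)).trans_lt hlt
  have := hmem.2
  rwa [mem_preimage, (chart n q).left_inv (hε.2.2.1 τ (hsub hτ)).1] at this

end

section

/-! ### The first variation along whole trajectories -/

variable {n : ℕ} {M : Type*} [TopologicalSpace M] [ChartedSpace (EuclideanSpace ℝ (Fin n)) M]
  [IsManifold (𝓡 n) ∞ M] {𝓕 : Set (VField n M)} {g : ℝ → VField n M}
  {gε : ℝ → ℝ → VField n M} {x : ℝ → M} {xε : ℝ → ℝ → M} {a b : ℝ}

/-- Perturbed trajectories deviate by `O(ε)`. -/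
theorem IsPerturbation.isFirstOrderClose (hgε : IsPerturbation 𝓕 g gε a b) (h𝓕 : IsUniformlyC1 𝓕)
    (hg : IsAdmissible 𝓕 g) (hx : IsSolution g x a b)
    (hxε : ∀ᶠ ε in 𝓝[>] (0 : ℝ), IsSolution (gε ε) (xε ε) a b)
    (hclose : UniformlyClose x xε a b) (ha : IsFirstOrderClose n (x a) fun ε => xε ε a) {t : ℝ}
    (ht : t ∈ Icc a b) : IsFirstOrderClose n (x t) fun ε => xε ε t := by
  refine interval_induction (P := fun c d => (IsFirstOrderClose n (x c) fun ε => xε ε c) →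
    IsFirstOrderClose n (x d) fun ε => xε ε d) ht.1 (fun c d e _ _ _ _ h₁ h₂ h => h₂ (h₁ h))
    (fun s hs => ?_) ha
  obtain ⟨q, ξ₀, r, B, L, δ, hδ, h⟩ := exists_isShortArc h𝓕 hx.1.1 ⟨hs.1, hs.2.trans ht.2⟩
  refine ⟨δ, hδ, fun c d hac hcd hdt h₁ h₂ hc => ?_⟩
  have hdb := hdt.trans ht.2
  exact (h c d hac hcd hdb h₁ h₂).isFirstOrderClose hcd hg (hgε.mono hac hdb) (hx.mono hac hdb)
    (hxε.mono fun ε h => h.mono hac hdb) (hclose.mono hac hdb) hc ⟨hcd, le_rfl⟩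

theorem IsAdjoint.intervalIntegrable {p : ℝ → Covec n} {g' : ℝ → VField n M}
    (hp : IsAdjoint g x p a b) (h𝓕 : IsUniformlyC1 𝓕) (hg' : IsAdmissible 𝓕 g')
    (hx : IsSolution g x a b) (hab : a ≤ b) :
    IntervalIntegrable (fun t => p t (g' t (x t))) volume a b := by
  refine interval_induction
    (P := IntervalIntegrable (fun t => p t (g' t (x t))) volume) hab
    (fun c d e _ _ _ _ h₁ h₂ => h₁.trans h₂) (fun s hs => ?_)
  obtain ⟨q, ξ₀, r, B, L, δ, hδ, h⟩ := exists_isShortArc h𝓕 hx.1.1 hs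
  refine ⟨δ, hδ, fun c d hac hcd hdb h₁ h₂ => ?_⟩
  have hsh := h c d hac hcd hdb h₁ h₂
  exact (hp.mono hac hdb).intervalIntegrable_local hsh.ball hcd hsh.stays' (hx.mono hac hdb) hg'

/-- The first variation formula: the pairing of the adjoint curve with the displacement changes by
the integral of the change of the Hamiltonian. -/
theorem IsPerturbation.hasVariation (hgε : IsPerturbation 𝓕 g gε a b) (h𝓕 : IsUniformlyC1 𝓕)
    (hg : IsAdmissible 𝓕 g) (hx : IsSolution g x a b)
    (hxε : ∀ᶠ ε in 𝓝[>] (0 : ℝ), IsSolution (gε ε) (xε ε) a b)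
    (hclose : UniformlyClose x xε a b) (ha : IsFirstOrderClose n (x a) fun ε => xε ε a)
    (hab : a ≤ b) {p : ℝ → Covec n} (hp : IsAdjoint g x p a b) {A : ℝ → ℝ}
    (hA : HasVariation (x a) (fun ε => xε ε a) (p a) A) :
    HasVariation (x b) (fun ε => xε ε b) (p b) fun ε =>
      A ε + ∫ t in a..b, (p t (gε ε t (x t)) - p t (g t (x t))) := by
  refine interval_induction (P := fun c d => a ≤ c → c ≤ d → d ≤ b →
    ∀ A, HasVariation (x c) (fun ε => xε ε c) (p c) A →
    HasVariation (x d) (fun ε => xε ε d) (p d) fun ε =>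
      A ε + ∫ t in c..d, (p t (gε ε t (x t)) - p t (g t (x t)))) hab
    (fun c d e hac hcd hde heb h₁ h₂ _ _ _ A hA => ?_) (fun s hs => ?_) le_rfl hab le_rfl A hA
  · have h := h₂ (hac.trans hcd) hde heb _ (h₁ hac hcd (hde.trans heb) A hA)
    refine fun θ hθ => (h θ hθ).congr (fun ε => ?_) fun _ => rfl
    have hI : ∀ u v, a ≤ u → u ≤ v → v ≤ b → IntervalIntegrable
        (fun t => p t (gε ε t (x t)) - p t (g t (x t))) volume u v := fun u v hu huv hv =>
      ((hp.mono hu hv).intervalIntegrable h𝓕 (hgε.admissible ε) (hx.mono hu hv) huv).sub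
        ((hp.mono hu hv).intervalIntegrable h𝓕 hg (hx.mono hu hv) huv)
    beta_reduce
    rw [← intervalIntegral.integral_add_adjacent_intervals (hI c d hac hcd (hde.trans heb))
      (hI d e (hac.trans hcd) hde heb), add_assoc]
  · obtain ⟨q, ξ₀, r, B, L, δ, hδ, h⟩ := exists_isShortArc h𝓕 hx.1.1 hs
    refine ⟨δ, hδ, fun c d hac hcd hdb h₁ h₂ _ _ _ A hA => ?_⟩
    exact (h c d hac hcd hdb h₁ h₂).hasVariation hcd hg (hgε.mono hac hdb) (hx.mono hac hdb)
      (hxε.mono fun ε h => h.mono hac hdb) (hclose.mono hac hdb)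
      (hgε.isFirstOrderClose h𝓕 hg hx hxε hclose ha ⟨hac, hcd.trans hdb⟩) (hp.mono hac hdb) hA

/-- Existence of perturbed trajectories with given, nearby initial states. -/
theorem IsPerturbation.exists_family (hgε : IsPerturbation 𝓕 g gε a b) (h𝓕 : IsUniformlyC1 𝓕)
    (hg : IsAdmissible 𝓕 g) (hx : IsSolution g x a b) (hab : a ≤ b) {y₀ : ℝ → M}
    (hy₀ : IsFirstOrderClose n (x a) y₀) :
    ∃ xε : ℝ → ℝ → M, (∀ᶠ ε in 𝓝[>] (0 : ℝ), xε ε a = y₀ ε) ∧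
      (∀ᶠ ε in 𝓝[>] (0 : ℝ), IsSolution (gε ε) (xε ε) a b) ∧ UniformlyClose x xε a b := by
  refine interval_induction (P := fun c d => a ≤ c → c ≤ d → d ≤ b →
    ∀ y₀ : ℝ → M, IsFirstOrderClose n (x c) y₀ →
    ∃ xε : ℝ → ℝ → M, (∀ᶠ ε in 𝓝[>] (0 : ℝ), xε ε c = y₀ ε) ∧
      (∀ᶠ ε in 𝓝[>] (0 : ℝ), IsSolution (gε ε) (xε ε) c d) ∧ UniformlyClose x xε c d) hab
    (fun c d e hac hcd hde heb h₁ h₂ _ _ _ y₀ hy₀ => ?_) (fun s hs => ?_) le_rfl hab le_rfl y₀ hy₀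
  · have hdb := hde.trans heb
    obtain ⟨xε₁, hi₁, hs₁, hu₁⟩ := h₁ hac hcd hdb y₀ hy₀
    have hc : IsFirstOrderClose n (x c) fun ε => xε₁ ε c := by
      refine ⟨hu₁.tendsto ⟨le_rfl, hcd⟩, fun θ hθ => (hy₀.2 θ hθ).congr' ?_ EventuallyEq.rfl⟩
      filter_upwards [hi₁] with ε hε
      rw [hε]
    have hd := (hgε.mono hac hdb).isFirstOrderClose h𝓕 hg (hx.mono hac hdb) hs₁ hu₁ hc
      ⟨hcd, le_rfl⟩
    obtain ⟨xε₂, hi₂, hs₂, hu₂⟩ := h₂ (hac.trans hcd) hde heb _ hd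
    set yε : ℝ → ℝ → M := fun ε t => if t ≤ d then xε₁ ε t else xε₂ ε t with hyε
    have hl : ∀ ε, EqOn (yε ε) (xε₁ ε) (Icc c d) := fun ε t ht => if_pos ht.2
    have hr : ∀ᶠ ε in 𝓝[>] (0 : ℝ), EqOn (yε ε) (xε₂ ε) (Icc d e) := by
      filter_upwards [hi₂] with ε hε t ht
      rcases eq_or_lt_of_le ht.1 with rfl | h
      · simp [hyε, hε]
      · simp [hyε, not_le.2 h]
    refine ⟨yε, ?_, ?_, ?_⟩
    · filter_upwards [hi₁] with ε hε
      rw [hl ε ⟨le_rfl, hcd⟩, hε]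
    · filter_upwards [hs₁, hs₂, hr] with ε h₁ h₂ h₃
      exact (h₁.congr (hl ε) fun _ _ => rfl).trans hcd hde (h₂.congr h₃ fun _ _ => rfl)
    · exact (hu₁.congr (Eventually.of_forall hl)).trans (hu₂.congr hr)
  · obtain ⟨q, ξ₀, r, B, L, δ, hδ, h⟩ := exists_isShortArc h𝓕 hx.1.1 hs
    refine ⟨δ, hδ, fun c d hac hcd hdb h₁ h₂ _ _ _ y₀ hy₀ => ?_⟩
    exact (h c d hac hcd hdb h₁ h₂).exists_family hcd hg (hgε.mono hac hdb) (hx.mono hac hdb) hy₀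

/-- A solution of `ẋ = 0` is constant. -/
theorem IsSolution.eq_of_zero (h𝓕 : IsUniformlyC1 𝓕) (h0 : (0 : VField n M) ∈ 𝓕)
    (hx : IsSolution g x a b) (hzero : ∀ t ∈ Ioo a b, g t = 0) {t : ℝ} (ht : t ∈ Icc a b) :
    x t = x a := by
  have hadm : IsAdmissible 𝓕 fun _ : ℝ => (0 : VField n M) :=
    ⟨fun _ => h0, fun _ => measurable_const⟩
  have hx0 : IsSolution (fun _ => 0) x a b := hx.congr (fun _ _ => rfl) fun t ht => (hzero t ht).symm
  refine interval_induction (P := fun c d => x d = x c) ht.1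
    (fun c d e _ _ _ _ h₁ h₂ => h₂.trans h₁) fun s hs => ?_
  obtain ⟨q, ξ₀, r, B, L, δ, hδ, h⟩ := exists_isShortArc h𝓕 hx.1.1 ⟨hs.1, hs.2.trans ht.2⟩
  refine ⟨δ, hδ, fun c d hac hcd hdt h₁ h₂ => ?_⟩
  have hdb := hdt.trans ht.2
  have hsh := h c d hac hcd hdb h₁ h₂
  have hcI : c ∈ Icc c d := ⟨le_rfl, hcd⟩
  have hdI : d ∈ Icc c d := ⟨hcd, le_rfl⟩
  have e := hsh.stays'.eq_add_integral hsh.ball hadm (hx0.mono hac hdb) hcI hdI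
  have hz : ∀ ξ, coordField q (0 : VField n M) ξ = 0 := fun ξ => by simp [coordField]
  simp only [hz, intervalIntegral.integral_zero, add_zero] at e
  exact (chart n q).injOn (hsh.stays d hdI).1 (hsh.stays c hcI).1 e

end

section

/-! ### The vector fields of a control system -/

variable {n m : ℕ} {M : Type*} [TopologicalSpace M] [ChartedSpace (EuclideanSpace ℝ (Fin n)) M]
  [IsManifold (𝓡 n) ∞ M]

/-- The vector field which the control value `v` selects. -/
def controlField (f : (x : M) → EuclideanSpace ℝ (Fin m) → TangentSpace (𝓡 n) x)
    (v : EuclideanSpace ℝ (Fin m)) : VField n M := fun x => f x v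

variable {f : (x : M) → EuclideanSpace ℝ (Fin m) → TangentSpace (𝓡 n) x}
  {U : Set (EuclideanSpace ℝ (Fin m))}

theorem contDiffOn_coordField
    (hf : ContMDiffOn ((𝓡 n).prod (𝓡 m)) (𝓡 n).tangent ∞
      (fun z : M × EuclideanSpace ℝ (Fin m) => (⟨z.1, f z.1 z.2⟩ : TangentBundle (𝓡 n) M))
      (univ ×ˢ U)) (q : M) :
    ContDiffOn ℝ ∞ (fun z : Eucl n × EuclideanSpace ℝ (Fin m) =>
      coordField q (controlField f z.2) z.1) ((chart n q).target ×ˢ U) := by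
  have h1 : ContMDiffOn ((𝓡 n).prod (𝓡 m)) (𝓡 n).tangent ∞
      (fun z : M × EuclideanSpace ℝ (Fin m) => (⟨z.1, f z.1 z.2⟩ : TangentBundle (𝓡 n) M))
      ((chart n q).source ×ˢ U) := hf.mono (prod_mono (subset_univ _) Subset.rfl)
  set e := trivializationAt (EuclideanSpace ℝ (Fin n)) (TangentSpace (𝓡 n) : M → Type _) q
  have hmaps : MapsTo
      (fun z : M × EuclideanSpace ℝ (Fin m) => (⟨z.1, f z.1 z.2⟩ : TangentBundle (𝓡 n) M))
      ((chart n q).source ×ˢ U) e.source := by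
    intro z hz
    rw [e.mem_source]
    simpa [e] using hz.1
  have h2 := ((e.contMDiffOn_iff (IB := 𝓡 n) hmaps).1 h1).2
  have h3 : ContMDiffOn 𝓘(ℝ, Eucl n × EuclideanSpace ℝ (Fin m)) ((𝓡 n).prod (𝓡 m)) ∞
      (fun z : Eucl n × EuclideanSpace ℝ (Fin m) => ((chart n q).symm z.1, z.2))
      ((chart n q).target ×ˢ U) :=
    ((contMDiffOn_extChartAt_symm q).comp contDiff_fst.contMDiff.contMDiffOn
      fun z hz => hz.1).prodMk contDiff_snd.contMDiff.contMDiffOn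
  have h4 := h2.comp h3 fun z hz => ⟨(chart n q).map_target hz.1, hz.2⟩
  rw [contMDiffOn_iff_contDiffOn] at h4
  refine h4.congr fun z hz => ?_
  have hb : (chart n q).symm z.1 ∈ e.baseSet := by
    simpa [e] using (chart n q).map_target hz.1
  exact Bundle.Trivialization.continuousLinearMapAt_apply_of_mem (R := ℝ) e hb _

/-- A `C¹` function on a product `T × U`, with `T` open and `U` arbitrary, is differentiable in the
first variable, and this partial derivative is continuous. -/
theorem partial_fderiv_of_contDiffOn {E F G : Type*} [NormedAddCommGroup E] [NormedSpace ℝ E]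
    [NormedAddCommGroup F] [NormedSpace ℝ F] [NormedAddCommGroup G] [NormedSpace ℝ G]
    {Φ : E × F → G} {T : Set E} {U : Set F} (hT : IsOpen T) (hΦ : ContDiffOn ℝ 1 Φ (T ×ˢ U)) :
    (∀ ξ ∈ T, ∀ v ∈ U, DifferentiableAt ℝ (fun ζ => Φ (ζ, v)) ξ) ∧
      ContinuousOn (fun z : E × F => fderiv ℝ (fun ζ => Φ (ζ, z.2)) z.1) (T ×ˢ U) := by
  have key : ∀ z₀ ∈ T ×ˢ U, ∃ u ∈ 𝓝[T ×ˢ U] z₀, ∃ Φ' : E × F → E × F →L[ℝ] G,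
      ContinuousWithinAt Φ' (T ×ˢ U) z₀ ∧ ∀ z ∈ u, z ∈ T ×ˢ U →
        HasFDerivAt (fun ζ => Φ (ζ, z.2)) ((Φ' z).comp (ContinuousLinearMap.inl ℝ E F)) z.1 := by
    intro z₀ hz₀
    obtain ⟨u, hu, hus, -, Φ', hΦ', hc⟩ :=
      (contDiffWithinAt_succ_iff_hasFDerivWithinAt' (n := 0) (by simp)).1 (hΦ z₀ hz₀)
    rw [insert_eq_of_mem hz₀] at hu
    refine ⟨u, hu, Φ', hc.continuousWithinAt, fun z hz hzT => ?_⟩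
    have h1 : HasFDerivWithinAt (fun ζ : E => (ζ, z.2)) (ContinuousLinearMap.inl ℝ E F) T z.1 :=
      ((hasFDerivAt_id z.1).prodMk (hasFDerivAt_const z.2 z.1)).hasFDerivWithinAt
    exact (HasFDerivWithinAt.comp (t := T ×ˢ U) z.1 (hΦ' z hz) h1
      fun ζ hζ => mk_mem_prod hζ hzT.2).hasFDerivAt (hT.mem_nhds hzT.1)
  refine ⟨fun ξ hξ v hv => ?_, fun z hz => ?_⟩
  · obtain ⟨u, hu, Φ', -, h⟩ := key (ξ, v) ⟨hξ, hv⟩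
    exact (h (ξ, v) (mem_of_mem_nhdsWithin (mk_mem_prod hξ hv) hu) ⟨hξ, hv⟩).differentiableAt
  · obtain ⟨u, hu, Φ', hc, h⟩ := key z hz
    refine ContinuousWithinAt.congr_of_eventuallyEq
      (f := fun z => (Φ' z).comp (ContinuousLinearMap.inl ℝ E F))
      (hc.clm_comp continuousWithinAt_const) ?_ (h z (mem_of_mem_nhdsWithin hz hu) hz).fderiv
    filter_upwards [hu, self_mem_nhdsWithin] with z' hz' hzT using (h z' hz' hzT).fderiv

/-- The vector fields of a control system, together with the zero field. -/
def controlFamily (f : (x : M) → EuclideanSpace ℝ (Fin m) → TangentSpace (𝓡 n) x)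
    (U : Set (EuclideanSpace ℝ (Fin m))) : Set (VField n M) :=
  insert 0 (controlField f '' U)

theorem coordField_zero (q : M) : coordField q (0 : VField n M) = 0 := by
  ext1 ξ
  simp [coordField]

theorem isUniformlyC1_controlFamily
    (hf : ContMDiffOn ((𝓡 n).prod (𝓡 m)) (𝓡 n).tangent ∞
      (fun z : M × EuclideanSpace ℝ (Fin m) => (⟨z.1, f z.1 z.2⟩ : TangentBundle (𝓡 n) M))
      (univ ×ˢ U)) (hU : IsCompact U) : IsUniformlyC1 (controlFamily f U) := by
  intro q ξ₀ hξ₀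
  obtain ⟨r, hr, hsub⟩ := Metric.nhds_basis_closedBall.mem_iff.1
    ((isOpen_chart_target q).mem_nhds hξ₀)
  have hC := contDiffOn_coordField hf q
  obtain ⟨hd, hc⟩ := partial_fderiv_of_contDiffOn (isOpen_chart_target q)
    (hC.of_le (by simp) : ContDiffOn ℝ 1 _ _)
  have hK : IsCompact (Metric.closedBall ξ₀ r ×ˢ U) := (isCompact_closedBall ξ₀ r).prod hU
  have hKsub : Metric.closedBall ξ₀ r ×ˢ U ⊆ (chart n q).target ×ˢ U := prod_mono hsub Subset.rfl
  obtain ⟨B, hB⟩ := hK.exists_bound_of_continuousOn (hC.continuousOn.mono hKsub)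
  obtain ⟨L, hL⟩ := hK.exists_bound_of_continuousOn (hc.mono hKsub)
  have hunif := hK.uniformContinuousOn_of_continuous (hc.mono hKsub)
  refine ⟨r, max B 0, max L 0, hr, le_max_right _ _, le_max_right _ _, hsub, ?_, ?_, ?_, ?_⟩
  · rintro V (rfl | ⟨v, hv, rfl⟩) ξ hξ
    · rw [coordField_zero]
      exact differentiableAt_const _
    · exact hd ξ (hsub hξ) v hv
  · rintro V (rfl | ⟨v, hv, rfl⟩) ξ hξ
    · simp [coordField_zero]
    · exact (hB (ξ, v) ⟨hξ, hv⟩).trans (le_max_left _ _)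
  · rintro V (rfl | ⟨v, hv, rfl⟩) ξ hξ
    · simp [coordField_zero]
    · exact (hL (ξ, v) ⟨hξ, hv⟩).trans (le_max_left _ _)
  · intro η hη
    obtain ⟨δ, hδ, H⟩ := Metric.uniformContinuousOn_iff.1 hunif η hη
    refine ⟨δ / 2, by positivity, ?_⟩
    rintro V (rfl | ⟨v, hv, rfl⟩) ξ hξ ξ' hξ' hd
    · simp [coordField_zero, hη.le]
    · have h1 := H (ξ', v) ⟨hξ', hv⟩ (ξ, v) ⟨hξ, hv⟩ (by
        rw [Prod.dist_eq, dist_self, max_eq_left dist_nonneg, dist_eq_norm]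
        linarith)
      rw [dist_eq_norm] at h1
      exact h1.le

theorem continuousOn_controlField
    (hf : ContMDiffOn ((𝓡 n).prod (𝓡 m)) (𝓡 n).tangent ∞
      (fun z : M × EuclideanSpace ℝ (Fin m) => (⟨z.1, f z.1 z.2⟩ : TangentBundle (𝓡 n) M))
      (univ ×ˢ U)) (x : M) : ContinuousOn (fun v => controlField f v x) U := by
  have hx : x ∈ (chart n x).source := mem_extChartAt_source _
  have h1 : ContinuousOn (fun v => coordField x (controlField f v) (chart n x x)) U :=
    (contDiffOn_coordField hf x).continuousOn.comp (f := fun v => (chart n x x, v))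
      (by fun_prop) fun v hv => ⟨(chart n x).map_source hx, hv⟩
  have h2 := (ofChart x x).continuous.comp_continuousOn h1
  refine h2.congr fun v _ => ?_
  simp only [Function.comp_apply, coordField_chart hx, ofChart_toChart hx]

open Classical in
/-- The time-dependent field generated by the control `u` at the times in `T`, and zero at all other
times. -/
def drive (f : (x : M) → EuclideanSpace ℝ (Fin m) → TangentSpace (𝓡 n) x) (T : Set ℝ)
    (u : ℝ → EuclideanSpace ℝ (Fin m)) (t : ℝ) : VField n M :=
  if t ∈ T then controlField f (u t) else 0

theorem drive_of_mem {T : Set ℝ} {u : ℝ → EuclideanSpace ℝ (Fin m)} {t : ℝ} (ht : t ∈ T) :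
    drive f T u t = controlField f (u t) := if_pos ht

theorem drive_of_notMem {T : Set ℝ} {u : ℝ → EuclideanSpace ℝ (Fin m)} {t : ℝ} (ht : t ∉ T) :
    drive f T u t = 0 := if_neg ht

theorem isAdmissible_drive
    (hf : ContMDiffOn ((𝓡 n).prod (𝓡 m)) (𝓡 n).tangent ∞
      (fun z : M × EuclideanSpace ℝ (Fin m) => (⟨z.1, f z.1 z.2⟩ : TangentBundle (𝓡 n) M))
      (univ ×ˢ U)) (hU : IsCompact U) {T : Set ℝ} (hT : MeasurableSet T)
    {u : ℝ → EuclideanSpace ℝ (Fin m)} (hu : Measurable u) (huU : ∀ t ∈ T, u t ∈ U) :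
    IsAdmissible (controlFamily f U) (drive f T u) := by
  classical
  refine ⟨fun t => ?_, fun x => ?_⟩
  · by_cases ht : t ∈ T
    · rw [drive_of_mem ht]
      exact Or.inr ⟨_, huU t ht, rfl⟩
    · rw [drive_of_notMem ht]
      exact Or.inl rfl
  · have h1 : Measurable (U.piecewise (fun v => controlField f v x) fun _ => 0) :=
      (continuousOn_controlField hf x).measurable_piecewise continuousOn_const hU.measurableSet
    have h2 : Measurable (T.piecewise
        (U.piecewise (fun v => controlField f v x) (fun _ => 0) ∘ u) fun _ => 0) :=
      (h1.comp hu).piecewise hT measurable_const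
    refine (congrArg Measurable (funext fun t => ?_)).mpr h2
    by_cases ht : t ∈ T
    · simp [drive_of_mem ht, ht, huU t ht]
    · simp [drive_of_notMem ht, ht]

/-- Along a trajectory with an adjoint curve, the Hamiltonian is continuous in time and control. -/
theorem IsAdjoint.continuousOn_pairing
    (hf : ContMDiffOn ((𝓡 n).prod (𝓡 m)) (𝓡 n).tangent ∞
      (fun z : M × EuclideanSpace ℝ (Fin m) => (⟨z.1, f z.1 z.2⟩ : TangentBundle (𝓡 n) M))
      (univ ×ˢ U)) {g : ℝ → VField n M} {x : ℝ → M} {p : ℝ → Covec n} {a b : ℝ}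
    (hx : ContinuousOn x (Icc a b)) (hp : IsAdjoint g x p a b) :
    ContinuousOn (fun z : ℝ × EuclideanSpace ℝ (Fin m) => p z.1 (controlField f z.2 (x z.1)))
      (Icc a b ×ˢ U) := by
  rintro ⟨t, v⟩ ⟨ht, hv⟩
  set q := x t with hq
  have hsrc : x t ∈ (chart n q).source := mem_extChartAt_source _
  obtain ⟨δ, hδ, hball⟩ := Metric.mem_nhdsWithin_iff.1
    ((hx t ht).preimage_mem_nhdsWithin ((isOpen_chart_source q).mem_nhds hsrc))
  set c := max a (t - δ / 2)
  set d := min b (t + δ / 2)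
  have hct : c ≤ t := max_le ht.1 (by linarith)
  have htd : t ≤ d := le_min ht.2 (by linarith)
  have hsub : Icc c d ⊆ Icc a b := Icc_subset_Icc (le_max_left _ _) (min_le_left _ _)
  have hmap : MapsTo x (Icc c d) (chart n q).source := fun s hs => by
    refine hball ⟨?_, hsub hs⟩
    have h1 := (le_max_right _ _).trans hs.1
    have h2 := hs.2.trans (min_le_right _ _)
    rw [Metric.mem_ball, Real.dist_eq, abs_lt]
    constructor <;> linarith
  have hcov : ContinuousOn (fun s => coordCovec q (x s) (p s)) (Icc c d) := by
    have := (hp.1 q c d (le_max_left _ _) (hct.trans htd) (min_le_left _ _) hmap).continuousOn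
    rwa [uIcc_of_le (hct.trans htd)] at this
  have hcur : ContinuousOn (fun s => chart n q (x s)) (Icc c d) := fun s hs =>
    (chart_continuousAt (hmap hs)).comp_continuousWithinAt ((hx.mono hsub) s hs)
  have hloc : ContinuousOn (fun z : ℝ × EuclideanSpace ℝ (Fin m) =>
      p z.1 (controlField f z.2 (x z.1))) (Icc c d ×ˢ U) := by
    have h1 : ContinuousOn (fun z : ℝ × EuclideanSpace ℝ (Fin m) =>
        coordField q (controlField f z.2) (chart n q (x z.1))) (Icc c d ×ˢ U) :=
      (contDiffOn_coordField hf q).continuousOn.comp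
        (f := fun z : ℝ × EuclideanSpace ℝ (Fin m) => (chart n q (x z.1), z.2))
        ((hcur.comp continuousOn_fst fun z hz => hz.1).prodMk continuousOn_snd)
        fun z hz => ⟨(chart n q).map_source (hmap hz.1), hz.2⟩
    refine ((hcov.comp continuousOn_fst fun z hz => hz.1).clm_apply h1).congr fun z hz => ?_
    simp only [Function.comp_apply, coordField_chart (hmap hz.1), coordCovec_toChart (hmap hz.1)]
  refine (hloc (t, v) ⟨⟨hct, htd⟩, hv⟩).mono_of_mem_nhdsWithin ?_
  rw [nhdsWithin_prod_eq]
  refine prod_mem_prod ?_ self_mem_nhdsWithin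
  filter_upwards [self_mem_nhdsWithin, mem_nhdsWithin_of_mem_nhds
    (Icc_mem_nhds (show t - δ / 2 < t by linarith) (show t < t + δ / 2 by linarith))] with s h1 h2
  exact ⟨max_le h1.1 h2.1, le_min h1.2 h2.2⟩

end

section

/-! ### Lebesgue points of controls -/

section Lebesgue

variable {m : ℕ} {U : Set (EuclideanSpace ℝ (Fin m))} {u : ℝ → EuclideanSpace ℝ (Fin m)}

theorem intervalIntegrable_norm_sub (hU : IsCompact U) (hu : Measurable u) {α β : ℝ} (hαβ : α ≤ β)
    (hmem : ∀ t ∈ Ioo α β, u t ∈ U) (w : EuclideanSpace ℝ (Fin m)) :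
    IntervalIntegrable (fun t => ‖u t - w‖) volume α β := by
  obtain ⟨R, hR⟩ := hU.exists_bound_of_continuousOn (f := fun v => ‖v - w‖) (by fun_prop)
  rw [intervalIntegrable_iff_integrableOn_Ioo_of_le hαβ]
  refine ⟨(hu.sub_const w).norm.aestronglyMeasurable, ?_⟩
  refine HasFiniteIntegral.restrict_of_bounded R (by simp) ?_
  filter_upwards [ae_restrict_mem measurableSet_Ioo] with t ht using hR _ (hmem t ht)

/-- If the control is close in the mean to the value `w` on windows of length `O(ε)` near the time
`t₁`, then the integral of a continuous function of time and control over these windows is computed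
by freezing the time at `t₁` and the control at `w`. -/
theorem integral_window {K : ℝ × EuclideanSpace ℝ (Fin m) → ℝ} {a b t₁ C : ℝ}
    {w : EuclideanSpace ℝ (Fin m)} (hU : IsCompact U) (hK : ContinuousOn K (Icc a b ×ˢ U))
    (ht₁ : t₁ ∈ Icc a b) (hw : w ∈ U) (hC : 0 ≤ C) {u : ℝ → ℝ → EuclideanSpace ℝ (Fin m)}
    {α β : ℝ → ℝ}
    (hwin : ∀ᶠ ε in 𝓝[>] (0 : ℝ), α ε ≤ β ε ∧ a ≤ α ε ∧ β ε ≤ b ∧ t₁ - C * ε ≤ α ε ∧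
      β ε ≤ t₁ + C * ε)
    (hu : ∀ ε, Measurable (u ε))
    (huU : ∀ᶠ ε in 𝓝[>] (0 : ℝ), ∀ t ∈ Ioo (α ε) (β ε), u ε t ∈ U)
    (hint : ∀ᶠ ε in 𝓝[>] (0 : ℝ),
      IntervalIntegrable (fun t => K (t, u ε t)) volume (α ε) (β ε))
    (hmean : (fun ε => ∫ t in (α ε)..(β ε), ‖u ε t - w‖) =o[𝓝[>] 0] fun ε => ε) :
    (fun ε => (∫ t in (α ε)..(β ε), K (t, u ε t)) - (β ε - α ε) * K (t₁, w)) =o[𝓝[>] 0]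
      fun ε => ε := by
  have hcomp : IsCompact (Icc a b ×ˢ U) := isCompact_Icc.prod hU
  obtain ⟨B, hB⟩ := hcomp.exists_bound_of_continuousOn hK
  have hB0 : 0 ≤ B := (norm_nonneg _).trans (hB (t₁, w) ⟨ht₁, hw⟩)
  rw [Asymptotics.isLittleO_iff]
  intro κ hκ
  set η := κ / (2 * (2 * C + 1)) with hη
  have hη0 : 0 < η := by positivity
  obtain ⟨δ, hδ, hcont⟩ := Metric.continuousWithinAt_iff.1 (hK (t₁, w) ⟨ht₁, hw⟩) η hη0
  have hbound : ∀ t ∈ Icc a b, ∀ v ∈ U, |t - t₁| < δ →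
      ‖K (t, v) - K (t₁, w)‖ ≤ η + 2 * B / δ * ‖v - w‖ := by
    intro t ht v hv htδ
    have h0 : 0 ≤ 2 * B / δ * ‖v - w‖ := by positivity
    rcases lt_or_ge ‖v - w‖ δ with h | h
    · have h1 := hcont (x := (t, v)) ⟨ht, hv⟩ (by
        rw [Prod.dist_eq, max_lt_iff, Real.dist_eq, dist_eq_norm]; exact ⟨htδ, h⟩)
      rw [dist_eq_norm] at h1
      linarith
    · have h1 : 2 * B ≤ 2 * B / δ * ‖v - w‖ := by
        rw [div_mul_eq_mul_div, le_div_iff₀ hδ]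
        gcongr
      have h2 := norm_sub_le (K (t, v)) (K (t₁, w))
      linarith [hB (t, v) ⟨ht, hv⟩, hB (t₁, w) ⟨ht₁, hw⟩]
  have hsmall : ∀ᶠ ε in 𝓝[>] (0 : ℝ), C * ε < δ := by
    have : Tendsto (fun ε : ℝ => C * ε) (𝓝[>] 0) (𝓝 (C * 0)) :=
      (tendsto_id.const_mul C).mono_left nhdsWithin_le_nhds
    exact this.eventually_lt_const (by simpa using hδ)
  filter_upwards [hwin, huU, hint, hsmall, self_mem_nhdsWithin,
    (Asymptotics.isLittleO_iff.1 hmean) (c := κ / (2 * (2 * B / δ + 1))) (by positivity)]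
    with ε ⟨hαβ, haα, hβb, hα, hβ⟩ huU hint hsmall hpos hmean
  have hpos : 0 < ε := hpos
  rw [Real.norm_eq_abs ε, abs_of_pos hpos] at hmean ⊢
  have hn := intervalIntegrable_norm_sub hU (hu ε) hαβ huU w
  have e : (∫ t in (α ε)..(β ε), K (t, u ε t)) - (β ε - α ε) * K (t₁, w) =
      ∫ t in (α ε)..(β ε), (K (t, u ε t) - K (t₁, w)) := by
    rw [intervalIntegral.integral_sub hint intervalIntegrable_const,
      intervalIntegral.integral_const, smul_eq_mul]
  have hle : ‖∫ t in (α ε)..(β ε), (K (t, u ε t) - K (t₁, w))‖ ≤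
      ∫ t in (α ε)..(β ε), (η + 2 * B / δ * ‖u ε t - w‖) := by
    refine intervalIntegral.norm_integral_le_of_norm_le hαβ ?_
      (intervalIntegrable_const.add (hn.const_mul _))
    filter_upwards [ae_ne (β ε)] with t htne ht
    refine hbound t ⟨haα.trans ht.1.le, ht.2.trans hβb⟩ _ (huU t ⟨ht.1, ht.2.lt_of_ne htne⟩) ?_
    rw [abs_lt]
    constructor <;> linarith [ht.1, ht.2]
  rw [intervalIntegral.integral_add intervalIntegrable_const (hn.const_mul _),
    intervalIntegral.integral_const, intervalIntegral.integral_const_mul, smul_eq_mul] at hle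
  have h1 : (β ε - α ε) * η ≤ κ / 2 * ε := by
    calc (β ε - α ε) * η ≤ (2 * C * ε) * η := by gcongr; linarith
      _ = (2 * C) / (2 * C + 1) * (κ / 2 * ε) := by rw [hη]; field_simp
      _ ≤ 1 * (κ / 2 * ε) := by
        gcongr
        rw [div_le_one (by positivity)]
        linarith
      _ = _ := one_mul _
  have h2 : 2 * B / δ * ∫ t in (α ε)..(β ε), ‖u ε t - w‖ ≤ κ / 2 * ε := by
    calc _ ≤ 2 * B / δ * (κ / (2 * (2 * B / δ + 1)) * ε) := by
          gcongr
          exact (le_abs_self _).trans hmean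
      _ = (2 * B / δ) / (2 * B / δ + 1) * (κ / 2 * ε) := by field_simp
      _ ≤ 1 * (κ / 2 * ε) := by
        gcongr
        rw [div_le_one (by positivity)]
        linarith
      _ = _ := one_mul _
  rw [e]
  linarith

theorem IsLebesguePoint.isLittleO {t : ℝ} (h : IsLebesguePoint u t) :
    (fun ε => ∫ τ in t..(t + ε), ‖u τ - u t‖) =o[𝓝[>] 0] fun ε => ε := by
  rw [Asymptotics.isLittleO_iff_tendsto']
  · refine h.congr fun ε => ?_
    rw [one_div, div_eq_inv_mul]
  · filter_upwards [self_mem_nhdsWithin] with ε hε h0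
    exact absurd h0 (ne_of_gt hε)

theorem IsLeftLebesgueValue.isLittleO {t : ℝ} {w : EuclideanSpace ℝ (Fin m)}
    (h : IsLeftLebesgueValue u t w) :
    (fun ε => ∫ τ in (t - ε)..t, ‖u τ - w‖) =o[𝓝[>] 0] fun ε => ε := by
  rw [Asymptotics.isLittleO_iff_tendsto']
  · refine h.congr fun ε => ?_
    rw [one_div, div_eq_inv_mul]
  · filter_upwards [self_mem_nhdsWithin] with ε hε h0
    exact absurd h0 (ne_of_gt hε)

theorem isLittleO_comp_mul {F : ℝ → ℝ} (h : F =o[𝓝[>] 0] fun ε => ε) {C : ℝ} (hC : 0 < C) :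
    (fun ε => F (C * ε)) =o[𝓝[>] 0] fun ε => ε := by
  have ht : Tendsto (fun ε : ℝ => C * ε) (𝓝[>] 0) (𝓝[>] 0) := by
    refine tendsto_nhdsWithin_iff.2 ⟨?_, ?_⟩
    · have : Tendsto (fun ε : ℝ => C * ε) (𝓝[>] 0) (𝓝 (C * 0)) :=
        (tendsto_id.const_mul C).mono_left nhdsWithin_le_nhds
      simpa using this
    · filter_upwards [self_mem_nhdsWithin] with ε hε using mul_pos hC hε
  exact (h.comp_tendsto ht).trans_isBigO
    (Asymptotics.isBigO_const_mul_self C _ _)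

/-- The left value of a control with values in a compact set belongs to this set. -/
theorem IsLeftLebesgueValue.mem {t a : ℝ} {w : EuclideanSpace ℝ (Fin m)}
    (h : IsLeftLebesgueValue u t w) (hU : IsCompact U) (hu : Measurable u) (hat : a < t)
    (hmem : ∀ τ ∈ Ico a t, u τ ∈ U) : w ∈ U := by
  by_contra hw
  obtain ⟨δ, hδ, hball⟩ := Metric.mem_nhds_iff.1 (hU.isClosed.isOpen_compl.mem_nhds hw)
  have hev : ∀ᶠ ε in 𝓝[>] (0 : ℝ), δ ≤ (1 / ε) * ∫ τ in (t - ε)..t, ‖u τ - w‖ := by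
    filter_upwards [self_mem_nhdsWithin,
      mem_nhdsWithin_of_mem_nhds (Iio_mem_nhds (sub_pos.2 hat))] with ε hε hε'
    have hε : 0 < ε := hε
    have hε' : ε < t - a := hε'
    have hmem' : ∀ τ ∈ Ioo (t - ε) t, u τ ∈ U := fun τ hτ =>
      hmem τ ⟨by linarith [hτ.1], hτ.2⟩
    have h1 : ∫ _ in (t - ε)..t, δ ≤ ∫ τ in (t - ε)..t, ‖u τ - w‖ := by
      refine intervalIntegral.integral_mono_ae_restrict (by linarith) intervalIntegrable_const
        (intervalIntegrable_norm_sub hU hu (by linarith) hmem' w) ?_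
      rw [← restrict_Ioo_eq_restrict_Icc]
      filter_upwards [ae_restrict_mem measurableSet_Ioo] with τ hτ
      by_contra hlt
      have hin : u τ ∈ Metric.ball w δ := by
        rw [Metric.mem_ball, dist_eq_norm]
        exact not_le.1 hlt
      exact hball hin (hmem' τ hτ)
    rw [intervalIntegral.integral_const, sub_sub_cancel, smul_eq_mul] at h1
    rw [one_div, ← div_eq_inv_mul, le_div_iff₀ hε]
    linarith
  exact absurd (ge_of_tendsto h hev) (not_le.2 hδ)

theorem isLeftLebesgueValue_of_eventually {t : ℝ} {w : EuclideanSpace ℝ (Fin m)} {c : ℝ}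
    (hc : c < t) (h : ∀ τ ∈ Ioo c t, u τ = w) : IsLeftLebesgueValue u t w := by
  refine tendsto_const_nhds.congr' ?_
  filter_upwards [self_mem_nhdsWithin,
    mem_nhdsWithin_of_mem_nhds (Iio_mem_nhds (sub_pos.2 hc))] with ε hε hε'
  have hε : 0 < ε := hε
  have hε' : ε < t - c := hε'
  rw [intervalIntegral.integral_zero_ae, mul_zero]
  filter_upwards [ae_ne t] with τ hne hτ
  rw [uIoc_of_le (by linarith)] at hτ
  rw [h τ ⟨by linarith [hτ.1], hτ.2.lt_of_ne hne⟩, sub_self, norm_zero]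

theorem IsLeftLebesgueValue.congr {u' : ℝ → EuclideanSpace ℝ (Fin m)} {t c : ℝ}
    {w : EuclideanSpace ℝ (Fin m)} (h : IsLeftLebesgueValue u t w) (hc : c < t)
    (heq : ∀ τ ∈ Ioo c t, u' τ = u τ) : IsLeftLebesgueValue u' t w := by
  refine Tendsto.congr' ?_ h
  filter_upwards [self_mem_nhdsWithin,
    mem_nhdsWithin_of_mem_nhds (Iio_mem_nhds (sub_pos.2 hc))] with ε hε hε'
  have hε : 0 < ε := hε
  have hε' : ε < t - c := hε'
  congr 1
  refine intervalIntegral.integral_congr_ae ?_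
  filter_upwards [ae_ne t] with τ hne hτ
  rw [uIoc_of_le (by linarith)] at hτ
  rw [heq τ ⟨by linarith [hτ.1], hτ.2.lt_of_ne hne⟩]

/-- Almost every time is a Lebesgue point of a bounded control. -/
theorem ae_isLebesguePoint (hU : IsCompact U) (hu : Measurable u) {a b : ℝ}
    (hmem : ∀ t ∈ Ico a b, u t ∈ U) : ∀ᵐ t : ℝ, t ∈ Ico a b → IsLebesguePoint u t := by
  obtain ⟨R, hR⟩ := hU.exists_bound_of_continuousOn (f := fun v => v) (by fun_prop)
  have hint : Integrable ((Ico a b).indicator u) volume := by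
    rw [integrable_indicator_iff measurableSet_Ico]
    refine ⟨hu.aestronglyMeasurable, HasFiniteIntegral.restrict_of_bounded R (by simp) ?_⟩
    filter_upwards [ae_restrict_mem measurableSet_Ico] with t ht using hR _ (hmem t ht)
  filter_upwards [IsUnifLocDoublingMeasure.ae_tendsto_average_norm_sub volume
    hint.locallyIntegrable 1, ae_ne a] with t ht hne htI
  have hta : a < t := htI.1.lt_of_ne' hne
  have hlim : Tendsto (fun ε : ℝ => ε / 2) (𝓝[>] 0) (𝓝[>] 0) := by
    refine tendsto_nhdsWithin_iff.2 ⟨?_, ?_⟩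
    · have : Tendsto (fun ε : ℝ => ε / 2) (𝓝[>] 0) (𝓝 (0 / 2)) :=
        (tendsto_id.div_const 2).mono_left nhdsWithin_le_nhds
      simpa using this
    · filter_upwards [self_mem_nhdsWithin] with ε hε using half_pos (mem_Ioi.1 hε)
  have h1 := ht (w := fun ε : ℝ => t + ε / 2) (δ := fun ε => ε / 2) hlim (by
    filter_upwards [self_mem_nhdsWithin] with ε hε
    have hε : 0 < ε := hε
    rw [Metric.mem_closedBall, Real.dist_eq, one_mul, abs_le]
    constructor <;> linarith)
  refine h1.congr' ?_
  filter_upwards [self_mem_nhdsWithin,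
    mem_nhdsWithin_of_mem_nhds (Iio_mem_nhds (sub_pos.2 htI.2))] with ε hε hε'
  have hε : 0 < ε := hε
  have hε' : ε < b - t := hε'
  rw [setAverage_eq, Real.closedBall_eq_Icc, intervalIntegral.integral_of_le (by linarith),
    integral_Icc_eq_integral_Ioc, smul_eq_mul, measureReal_def, Real.volume_Icc,
    show t + ε / 2 - ε / 2 = t by ring, show t + ε / 2 + ε / 2 = t + ε by ring, add_sub_cancel_left,
    ENNReal.toReal_ofReal hε.le, one_div]
  congr 1
  refine setIntegral_congr_fun measurableSet_Ioc fun τ hτ => ?_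
  have h2 : τ ∈ Ico a b := ⟨hta.le.trans hτ.1.le, by linarith [hτ.2]⟩
  simp only [indicator_of_mem h2, indicator_of_mem htI]

end Lebesgue

end

section

/-! ### Hypersurfaces and their conormals -/

variable {n m : ℕ} {M : Type*} [TopologicalSpace M] [ChartedSpace (EuclideanSpace ℝ (Fin n)) M]
  [IsManifold (𝓡 n) ∞ M]

theorem contDiffAt_comp_chart_symm {q x : M} (hx : x ∈ (chart n q).source) {φ : M → ℝ}
    (hφ : ContMDiffAt (𝓡 n) 𝓘(ℝ, ℝ) ∞ φ x) :
    ContDiffAt ℝ ∞ (fun ξ => φ ((chart n q).symm ξ)) (chart n q x) := by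
  have h1 : ContMDiffAt 𝓘(ℝ, Eucl n) (𝓡 n) ∞ (chart n q).symm (chart n q x) :=
    (contMDiffOn_extChartAt_symm q).contMDiffAt
      ((isOpen_chart_target q).mem_nhds ((chart n q).map_source hx))
  have h2 : ContMDiffAt (𝓡 n) 𝓘(ℝ, ℝ) ∞ φ ((chart n q).symm (chart n q x)) := by
    rwa [(chart n q).left_inv hx]
  exact (ContMDiffAt.comp _ h2 h1).contDiffAt

/-- The differential `dφ(x)` of a function, as a linear form on the model space. -/
def differential (n : ℕ) {M : Type*} [TopologicalSpace M]
    [ChartedSpace (EuclideanSpace ℝ (Fin n)) M] (φ : M → ℝ) (x : M) : Covec n :=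
  (mfderiv (𝓡 n) 𝓘(ℝ, ℝ) φ x : TangentSpace (𝓡 n) x →L[ℝ] ℝ)

theorem hasMFDerivAt_differential {φ : M → ℝ} {x : M}
    (h : MDifferentiableAt (𝓡 n) 𝓘(ℝ, ℝ) φ x) : HasMFDerivAt (𝓡 n) 𝓘(ℝ, ℝ) φ x
      (show TangentSpace (𝓡 n) x →L[ℝ] ℝ from differential n φ x) := h.hasMFDerivAt

theorem fderiv_comp_chart_symm {q x : M} (hx : x ∈ (chart n q).source) {φ : M → ℝ}
    (hφ : ContMDiffAt (𝓡 n) 𝓘(ℝ, ℝ) ∞ φ x) (e : Eucl n) :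
    fderiv ℝ (fun ξ => φ ((chart n q).symm ξ)) (chart n q x) e =
      differential n φ x (ofChart q x e) := by
  rw [(hasFDerivAt_comp_chart_symm hx (hφ.mdifferentiableAt (by simp))).fderiv]
  rfl

/-- The kernel of the differential of a defining function of a hypersurface consists of tangent
vectors: by the Lagrange multiplier rule, the differential of a function which vanishes on the
hypersurface is a multiple of the differential of the defining function. -/
theorem isTangentTo_of_differential_eq_zero {S V : Set M} {x : M} {φ : M → ℝ} (hV : IsOpen V)
    (hx : x ∈ V) (hxS : x ∈ S) (hφ : ContMDiffOn (𝓡 n) 𝓘(ℝ, ℝ) ∞ φ V)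
    (hS : ∀ y ∈ V, y ∈ S ↔ φ y = 0) (hne : differential n φ x ≠ 0)
    {v : Eucl n} (hv : differential n φ x v = 0) :
    IsTangentTo S x (show TangentSpace (𝓡 n) x from v) := by
  intro ψ hψ hψS
  have hsrc : x ∈ (chart n x).source := mem_extChartAt_source _
  have hφx : ContMDiffAt (𝓡 n) 𝓘(ℝ, ℝ) ∞ φ x := hφ.contMDiffAt (hV.mem_nhds hx)
  set φ' : Eucl n → ℝ := fun ξ => φ ((chart n x).symm ξ) with hφ'
  set ψ' : Eucl n → ℝ := fun ξ => ψ ((chart n x).symm ξ) with hψ'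
  have hl : (chart n x).symm (chart n x x) = x := (chart n x).left_inv hsrc
  have hsymm : Tendsto (chart n x).symm (𝓝 (chart n x x)) (𝓝 x) := by
    have := chart_symm_continuousAt ((chart n x).map_source hsrc)
    rwa [ContinuousAt, hl] at this
  have hφ0 : φ' (chart n x x) = 0 := by
    simp only [hφ', hl]
    exact (hS x hx).1 hxS
  have hψ0 : ∀ᶠ ξ in 𝓝[{ξ | φ' ξ = φ' (chart n x x)}] (chart n x x), ψ' ξ = 0 := by
    have h1 : Tendsto (chart n x).symm (𝓝[{ξ | φ' ξ = φ' (chart n x x)}] (chart n x x))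
        (𝓝[S] x) := by
      refine tendsto_nhdsWithin_iff.2 ⟨hsymm.mono_left nhdsWithin_le_nhds, ?_⟩
      filter_upwards [self_mem_nhdsWithin,
        (hsymm.mono_left nhdsWithin_le_nhds) (hV.mem_nhds hx)] with ξ hξ hξV
      exact (hS _ hξV).2 (hξ.trans hφ0)
    exact h1.eventually hψS
  have hextr : IsLocalExtrOn ψ' {ξ | φ' ξ = φ' (chart n x x)} (chart n x x) := by
    have h0 : ψ' (chart n x x) = 0 := hψ0.self_of_nhdsWithin rfl
    refine Or.inl ?_
    filter_upwards [hψ0] with ξ hξ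
    rw [hξ, h0]
  obtain ⟨a, b, hab, hmul⟩ := hextr.exists_multipliers_of_hasStrictFDerivAt_1d
    ((contDiffAt_comp_chart_symm hsrc hφx).hasStrictFDerivAt (by simp))
    ((contDiffAt_comp_chart_symm hsrc hψ).hasStrictFDerivAt (by simp))
  have hmul' : ∀ w : Eucl n, a * differential n φ x w + b * differential n ψ x w = 0 := by
    intro w
    have h1 := DFunLike.congr_fun hmul (toChart x x w)
    simp only [add_apply, smul_apply, smul_eq_mul, zero_apply] at h1
    rw [fderiv_comp_chart_symm hsrc hφx, fderiv_comp_chart_symm hsrc hψ,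
      ofChart_toChart hsrc] at h1
    exact h1
  have hb : b ≠ 0 := by
    rintro rfl
    have ha : a ≠ 0 := by
      rintro rfl
      exact hab rfl
    refine hne (ContinuousLinearMap.ext fun w => ?_)
    have := hmul' w
    rw [zero_mul, add_zero] at this
    exact (mul_eq_zero.1 this).resolve_left ha
  have := hmul' v
  rw [hv, mul_zero, zero_add] at this
  exact (mul_eq_zero.1 this).resolve_left hb

/-- A hypersurface has, near a point at which `v` is not tangent to it, a defining function with
derivative one along `v`. -/
theorem IsEmbeddedHypersurface.exists_definingFunction {S : Set M} (hS : IsEmbeddedHypersurface n S)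
    {x : M} (hx : x ∈ S) {v : Eucl n}
    (hv : ¬ IsTangentTo S x (show TangentSpace (𝓡 n) x from v)) :
    ∃ V : Set M, IsOpen V ∧ x ∈ V ∧ ∃ φ : M → ℝ, ContMDiffOn (𝓡 n) 𝓘(ℝ, ℝ) ∞ φ V ∧
      (∀ y ∈ V, y ∈ S ↔ φ y = 0) ∧ differential n φ x v = 1 := by
  obtain ⟨V, hV, hxV, φ, hφ, hφS, hne⟩ := hS x hx
  have hc : differential n φ x v ≠ 0 := fun h =>
    hv (isTangentTo_of_differential_eq_zero hV hxV hx hφ hφS (hne x hxV) h)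
  set c : ℝ := differential n φ x v with hcdef
  refine ⟨V, hV, hxV, fun y => c⁻¹ * φ y, contMDiffOn_const.mul hφ, fun y hy => ?_, ?_⟩
  · rw [hφS y hy, mul_eq_zero, or_iff_right (inv_ne_zero hc)]
  · have h1 := ((hφ.contMDiffAt (hV.mem_nhds hxV)).mdifferentiableAt (by simp)).hasMFDerivAt
    have h2 : HasMFDerivAt (𝓡 n) 𝓘(ℝ, ℝ) (fun y => c⁻¹ * φ y) x
        (c⁻¹ • mfderiv (𝓡 n) 𝓘(ℝ, ℝ) φ x) := h1.const_smul c⁻¹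
    have h3 : differential n (fun y => c⁻¹ * φ y) x = c⁻¹ • differential n φ x := h2.mfderiv
    rw [h3, smul_apply, smul_eq_mul, ← hcdef, inv_mul_cancel₀ hc]

theorem differential_eq_zero_of_isTangentTo {S V : Set M} {x : M} {φ : M → ℝ} (hV : IsOpen V)
    (hx : x ∈ V) (hφ : ContMDiffOn (𝓡 n) 𝓘(ℝ, ℝ) ∞ φ V) (hS : ∀ y ∈ V, y ∈ S ↔ φ y = 0)
    {v : Eucl n} (hv : IsTangentTo S x (show TangentSpace (𝓡 n) x from v)) :
    differential n φ x v = 0 := by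
  refine hv φ (hφ.contMDiffAt (hV.mem_nhds hx)) ?_
  filter_upwards [self_mem_nhdsWithin, mem_nhdsWithin_of_mem_nhds (hV.mem_nhds hx)] with y hy hyV
  exact (hS y hyV).1 hy

/-- Transversality to a hypersurface is an open condition on the point, for a differentiable vector
field. -/
theorem eventually_not_isTangentTo {S V : Set M} {x : M} {φ : M → ℝ} (hV : IsOpen V)
    (hx : x ∈ V) (hφ : ContMDiffOn (𝓡 n) 𝓘(ℝ, ℝ) ∞ φ V) (hS : ∀ y ∈ V, y ∈ S ↔ φ y = 0)
    {W : VField n M} (hW : ContinuousAt (coordField x W) (chart n x x))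
    (hne : differential n φ x (W x) ≠ 0) :
    ∀ᶠ y in 𝓝 x, ¬ IsTangentTo S y (show TangentSpace (𝓡 n) y from W y) := by
  have hsrc : x ∈ (chart n x).source := mem_extChartAt_source _
  have key : ∀ y ∈ V ∩ (chart n x).source,
      fderiv ℝ (fun ξ => φ ((chart n x).symm ξ)) (chart n x y) (coordField x W (chart n x y)) =
        differential n φ y (W y) := by
    intro y hy
    rw [fderiv_comp_chart_symm hy.2 (hφ.contMDiffAt (hV.mem_nhds hy.1)), coordField_chart hy.2,
      ofChart_toChart hy.2]
  have hc : ContinuousAt (fun y => fderiv ℝ (fun ξ => φ ((chart n x).symm ξ)) (chart n x y)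
      (coordField x W (chart n x y))) x := by
    have h1 : ContinuousAt (fderiv ℝ (fun ξ => φ ((chart n x).symm ξ))) (chart n x x) :=
      (contDiffAt_comp_chart_symm hsrc (hφ.contMDiffAt (hV.mem_nhds hx))).continuousAt_fderiv
        (by simp)
    exact (ContinuousAt.comp (f := chart n x) h1 (chart_continuousAt hsrc)).clm_apply
      (ContinuousAt.comp (f := chart n x) hW (chart_continuousAt hsrc))
  have hne' : fderiv ℝ (fun ξ => φ ((chart n x).symm ξ)) (chart n x x)
      (coordField x W (chart n x x)) ≠ 0 := by
    rw [key x ⟨hx, hsrc⟩]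
    exact hne
  filter_upwards [hc.eventually_ne hne', hV.mem_nhds hx, (isOpen_chart_source x).mem_nhds hsrc]
    with y h1 h2 h3 htan
  rw [key y ⟨h2, h3⟩] at h1
  exact h1 (differential_eq_zero_of_isTangentTo hV h2 hφ hS htan)

/-- Every covector is represented by a vector, with respect to the Riemannian metric. -/
theorem exists_inner_eq (g : Bundle.ContMDiffRiemannianMetric (𝓡 n) ∞ (EuclideanSpace ℝ (Fin n))
      (TangentSpace (𝓡 n) : M → Type _)) (x : M) (α : TangentSpace (𝓡 n) x →L[ℝ] ℝ) :
    ∃ N : TangentSpace (𝓡 n) x, g.inner x N = α := by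
  have : FiniteDimensional ℝ (TangentSpace (𝓡 n) x) :=
    inferInstanceAs (FiniteDimensional ℝ (EuclideanSpace ℝ (Fin n)))
  let T : TangentSpace (𝓡 n) x →ₗ[ℝ] Module.Dual ℝ (TangentSpace (𝓡 n) x) :=
    { toFun := fun v => (g.inner x v).toLinearMap
      map_add' := fun v w => by ext; simp
      map_smul' := fun c v => by ext; simp }
  have hinj : Function.Injective T := by
    rw [injective_iff_map_eq_zero]
    intro v hv
    by_contra hne
    have h1 : g.inner x v v = 0 := DFunLike.congr_fun hv v
    exact (g.pos x v hne).ne' h1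
  have hsurj := (LinearMap.injective_iff_surjective_of_finrank_eq_finrank
    (Subspace.dual_finrank_eq (K := ℝ) (V := TangentSpace (𝓡 n) x)).symm).1 hinj
  obtain ⟨N, hN⟩ := hsurj α.toLinearMap
  exact ⟨N, ContinuousLinearMap.ext fun w => DFunLike.congr_fun hN w⟩

end

section

/-! ### Control variations along an arc -/

variable {n m : ℕ} {M : Type*} [TopologicalSpace M] [ChartedSpace (EuclideanSpace ℝ (Fin n)) M]
  [IsManifold (𝓡 n) ∞ M] {f : (x : M) → EuclideanSpace ℝ (Fin m) → TangentSpace (𝓡 n) x}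
  {U : Set (EuclideanSpace ℝ (Fin m))} {u : ℝ → EuclideanSpace ℝ (Fin m)} {x : ℝ → M}
  {p : ℝ → Covec n} {a s b : ℝ}

/-- The Hamiltonian `(t, v) ↦ ⟨p(t), f(x(t), v)⟩` along a curve with covectors. -/
def arcHamiltonian (f : (x : M) → EuclideanSpace ℝ (Fin m) → TangentSpace (𝓡 n) x) (x : ℝ → M)
    (p : ℝ → Covec n) (z : ℝ × EuclideanSpace ℝ (Fin m)) : ℝ := p z.1 (controlField f z.2 (x z.1))

/-- On `[a, b]`, the curve `x` is a trajectory of the control `u` which is driven up to the time `s`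
and rests afterwards, and `p` is an adjoint curve along `x`. -/
structure IsAdjointArc (f : (x : M) → EuclideanSpace ℝ (Fin m) → TangentSpace (𝓡 n) x)
    (U : Set (EuclideanSpace ℝ (Fin m))) (u : ℝ → EuclideanSpace ℝ (Fin m)) (x : ℝ → M)
    (p : ℝ → Covec n) (a s b : ℝ) : Prop where
  smooth : ContMDiffOn ((𝓡 n).prod (𝓡 m)) (𝓡 n).tangent ∞
    (fun z : M × EuclideanSpace ℝ (Fin m) => (⟨z.1, f z.1 z.2⟩ : TangentBundle (𝓡 n) M))
    (univ ×ˢ U)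
  isCompact : IsCompact U
  measurable : Measurable u
  mem : ∀ t, u t ∈ U
  left_le : a ≤ s
  le_right : s ≤ b
  solution : IsSolution (drive f (Ico a s) u) x a b
  adjoint : IsAdjoint (drive f (Ico a s) u) x p a b

/-- The controls `uε ε`, active on `[α ε, β ε)`, differ from the control `u`, active on `[a, s)`, on
sets of times of measure `O(ε)`. -/
structure IsControlVariation (f : (x : M) → EuclideanSpace ℝ (Fin m) → TangentSpace (𝓡 n) x)
    (U : Set (EuclideanSpace ℝ (Fin m))) (u : ℝ → EuclideanSpace ℝ (Fin m)) (a s b : ℝ)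
    (uε : ℝ → ℝ → EuclideanSpace ℝ (Fin m)) (α β : ℝ → ℝ) : Prop where
  measurable : ∀ ε, Measurable (uε ε)
  mem : ∀ ε t, uε ε t ∈ U
  window : ∀ᶠ ε in 𝓝[>] (0 : ℝ), a ≤ α ε ∧ α ε ≤ β ε ∧ β ε ≤ b
  deviates : ∃ C, 0 ≤ C ∧ ∀ᶠ ε in 𝓝[>] (0 : ℝ), DeviatesAtMost (drive f (Ico a s) u)
    (drive f (Ico (α ε) (β ε)) (uε ε)) a b (C * ε)

theorem deviatesAtMost_of_Icc {g g' : ℝ → VField n M} {c d c' d' k : ℝ} (hcd : c ≤ d)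
    (hcd' : c' ≤ d') (hk : (d - c) + (d' - c') ≤ k)
    (h : ∀ t ∈ Ioo a b, t ∉ Icc c d → t ∉ Icc c' d' → g' t = g t) : DeviatesAtMost g g' a b k := by
  refine ⟨Icc c d ∪ Icc c' d', measurableSet_Icc.union measurableSet_Icc, ?_, fun t ht hD =>
    h t ht (fun h1 => hD (Or.inl h1)) fun h2 => hD (Or.inr h2)⟩
  refine (measure_union_le _ _).trans ?_
  rw [Real.volume_Icc, Real.volume_Icc,
    ← ENNReal.ofReal_add (sub_nonneg.2 hcd) (sub_nonneg.2 hcd')]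
  exact ENNReal.ofReal_le_ofReal hk

theorem drive_Ico {c d t : ℝ} (hc : c ≤ t) (hd : t < d) :
    drive f (Ico c d) u t = controlField f (u t) := drive_of_mem ⟨hc, hd⟩

/-- Stopping a driven trajectory at the time `σ`. -/
theorem IsSolution.freeze {c d σ : ℝ} (h : IsSolution (drive f (Ico c d) u) x a b) (haσ : a ≤ σ)
    (hσb : σ ≤ b) (hσd : σ ≤ d) :
    IsSolution (drive f (Ico c σ) u) (fun t => x (min t σ)) a b := by
  refine IsSolution.trans haσ hσb ((h.mono le_rfl hσb).congr (fun t ht => ?_) fun t ht => ?_)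
    ((isSolution_const (g := drive f (Ico c σ) u) (x σ) fun t ht =>
      drive_of_notMem fun h' => absurd h'.2 (not_lt.2 ht.1.le)).congr (fun t ht => ?_)
      fun _ _ => rfl)
  · simp only [min_eq_left ht.2]
  · by_cases hc : c ≤ t
    · rw [drive_Ico hc ht.2, drive_Ico hc (ht.2.trans_le hσd)]
    · rw [drive_of_notMem fun h' => hc h'.1, drive_of_notMem fun h' => hc h'.1]
  · simp only [min_eq_right ht.1]

theorem tendsto_mul_nhdsGT (C : ℝ) : Tendsto (fun ε : ℝ => C * ε) (𝓝[>] 0) (𝓝 0) := by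
  have : Tendsto (fun ε : ℝ => C * ε) (𝓝[>] 0) (𝓝 (C * 0)) :=
    (tendsto_id.const_mul C).mono_left nhdsWithin_le_nhds
  simpa using this

theorem exists_mapsTo_Icc_left (hab : a < b) (hx : ContinuousOn x (Icc a b)) {W : Set M}
    (hW : IsOpen W) (hb : x b ∈ W) : ∃ c, a ≤ c ∧ c < b ∧ MapsTo x (Icc c b) W := by
  obtain ⟨δ, hδ, hball⟩ := Metric.mem_nhdsWithin_iff.1
    ((hx b ⟨hab.le, le_rfl⟩).preimage_mem_nhdsWithin (hW.mem_nhds hb))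
  refine ⟨max a (b - δ / 2), le_max_left _ _, max_lt hab (by linarith),
    fun t ht => hball ⟨?_, (le_max_left _ _).trans ht.1, ht.2⟩⟩
  have h1 := (le_max_right _ _).trans ht.1
  rw [Metric.mem_ball, Real.dist_eq, abs_lt]
  constructor <;> linarith [ht.2]

/-- Stopping the curves of a uniformly close family shortly before the final time. -/
theorem UniformlyClose.freeze {xε : ℝ → ℝ → M} (h : UniformlyClose x xε a b) (hab : a < b)
    (hx : ContinuousOn x (Icc a b)) (C : ℝ) :
    UniformlyClose x (fun ε t => xε ε (min t (b - C * ε))) a b := by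
  intro c d W hac hdb hW hmap
  rcases lt_or_ge d c with hdc | hcd
  · exact Eventually.of_forall fun ε t ht => absurd (ht.1.trans ht.2) (not_le.2 hdc)
  obtain ⟨c', hac', hc'b, hc'c, hmap'⟩ : ∃ c', a ≤ c' ∧ c' < b ∧ c' ≤ c ∧
      MapsTo x (Icc c' d) W := by
    rcases lt_or_ge c b with hcb | hbc
    · exact ⟨c, hac, hcb, le_rfl, hmap⟩
    obtain rfl : c = b := le_antisymm (hcd.trans hdb) hbc
    obtain rfl : c = d := le_antisymm hcd hdb
    obtain ⟨c', h1, h2, h3⟩ := exists_mapsTo_Icc_left hab hx hW (hmap ⟨le_rfl, le_rfl⟩)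
    exact ⟨c', h1, h2, h2.le, h3⟩
  filter_upwards [h c' d W hac' hdb hW hmap',
    (tendsto_mul_nhdsGT C).eventually_lt_const (sub_pos.2 hc'b)] with ε h1 h2 t ht
  exact h1 ⟨le_min (hc'c.trans ht.1) (by linarith), (min_le_left _ _).trans ht.2⟩

namespace IsAdjointArc

variable {uε : ℝ → ℝ → EuclideanSpace ℝ (Fin m)} {α β : ℝ → ℝ} {xε : ℝ → ℝ → M}

theorem le (h : IsAdjointArc f U u x p a s b) : a ≤ b := h.left_le.trans h.le_right

theorem isUniformlyC1 (h : IsAdjointArc f U u x p a s b) : IsUniformlyC1 (controlFamily f U) :=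
  isUniformlyC1_controlFamily h.smooth h.isCompact

theorem isAdmissible_drive (h : IsAdjointArc f U u x p a s b) {u' : ℝ → EuclideanSpace ℝ (Fin m)}
    (hu' : Measurable u') (hmem : ∀ t, u' t ∈ U) (c d : ℝ) :
    IsAdmissible (controlFamily f U) (drive f (Ico c d) u') :=
  HybridControl.isAdmissible_drive h.smooth h.isCompact measurableSet_Ico hu' fun t _ => hmem t

theorem isPerturbation (h : IsAdjointArc f U u x p a s b)
    (hv : IsControlVariation f U u a s b uε α β) :
    IsPerturbation (controlFamily f U) (drive f (Ico a s) u)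
      (fun ε => drive f (Ico (α ε) (β ε)) (uε ε)) a b :=
  ⟨fun ε => h.isAdmissible_drive (hv.measurable ε) (hv.mem ε) _ _, hv.deviates⟩

theorem continuousOn_arcHamiltonian (h : IsAdjointArc f U u x p a s b) :
    ContinuousOn (arcHamiltonian f x p) (Icc a b ×ˢ U) :=
  h.adjoint.continuousOn_pairing h.smooth h.solution.1.1

theorem intervalIntegrable (h : IsAdjointArc f U u x p a s b)
    {u' : ℝ → EuclideanSpace ℝ (Fin m)} (hu' : Measurable u') (hmem : ∀ t, u' t ∈ U) {c d : ℝ}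
    (hac : a ≤ c) (hcd : c ≤ d) (hdb : d ≤ b) :
    IntervalIntegrable (fun t => arcHamiltonian f x p (t, u' t)) volume c d := by
  have h1 := (h.adjoint.mono hac hdb).intervalIntegrable h.isUniformlyC1
    (h.isAdmissible_drive hu' hmem c d) (h.solution.mono hac hdb) hcd
  refine h1.congr_ae ?_
  rw [uIoc_of_le hcd]
  filter_upwards [ae_restrict_mem measurableSet_Ioc, ae_restrict_of_ae (ae_ne d)] with t ht htd
  rw [drive_Ico ht.1.le (ht.2.lt_of_ne htd)]
  rfl

theorem integral_drive (h : IsAdjointArc f U u x p a s b)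
    {u' : ℝ → EuclideanSpace ℝ (Fin m)} (hu' : Measurable u') (hmem : ∀ t, u' t ∈ U) {c d : ℝ}
    (hac : a ≤ c) (hcd : c ≤ d) (hdb : d ≤ b) :
    ∫ t in a..b, p t (drive f (Ico c d) u' t (x t)) =
      ∫ t in c..d, arcHamiltonian f x p (t, u' t) := by
  have hI : ∀ v w, a ≤ v → v ≤ w → w ≤ b → IntervalIntegrable
      (fun t => p t (drive f (Ico c d) u' t (x t))) volume v w := fun v w hv hvw hw =>
    (h.adjoint.mono hv hw).intervalIntegrable h.isUniformlyC1
      (h.isAdmissible_drive hu' hmem c d) (h.solution.mono hv hw) hvw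
  rw [← intervalIntegral.integral_add_adjacent_intervals (hI a c le_rfl hac (hcd.trans hdb))
    (hI c b hac (hcd.trans hdb) le_rfl), ← intervalIntegral.integral_add_adjacent_intervals
    (hI c d hac hcd hdb) (hI d b (hac.trans hcd) hdb le_rfl)]
  have e1 : ∫ t in a..c, p t (drive f (Ico c d) u' t (x t)) = 0 := by
    refine intervalIntegral.integral_zero_ae ?_
    filter_upwards [ae_ne c] with t hne ht
    rw [uIoc_of_le hac] at ht
    rw [drive_of_notMem fun h' => absurd h'.1 (not_le.2 (ht.2.lt_of_ne hne))]
    exact map_zero _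
  have e2 : ∫ t in d..b, p t (drive f (Ico c d) u' t (x t)) = 0 := by
    refine intervalIntegral.integral_zero_ae (Eventually.of_forall fun t ht => ?_)
    rw [uIoc_of_le hdb] at ht
    rw [drive_of_notMem fun h' => absurd h'.2 (not_lt.2 ht.1.le)]
    exact map_zero _
  have e3 : ∫ t in c..d, p t (drive f (Ico c d) u' t (x t)) =
      ∫ t in c..d, arcHamiltonian f x p (t, u' t) := by
    refine intervalIntegral.integral_congr_ae ?_
    filter_upwards [ae_ne d] with t hne ht
    rw [uIoc_of_le hcd] at ht
    rw [drive_Ico ht.1.le (ht.2.lt_of_ne hne)]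
    rfl
  rw [e1, e2, e3, zero_add, add_zero]

theorem exists_family (h : IsAdjointArc f U u x p a s b)
    (hv : IsControlVariation f U u a s b uε α β) {y₀ : ℝ → M}
    (hy₀ : IsFirstOrderClose n (x a) y₀) :
    ∃ xε : ℝ → ℝ → M, (∀ᶠ ε in 𝓝[>] (0 : ℝ), xε ε a = y₀ ε) ∧
      (∀ᶠ ε in 𝓝[>] (0 : ℝ), IsSolution (drive f (Ico (α ε) (β ε)) (uε ε)) (xε ε) a b) ∧
      UniformlyClose x xε a b :=
  (h.isPerturbation hv).exists_family h.isUniformlyC1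
    (h.isAdmissible_drive h.measurable h.mem _ _) h.solution h.le hy₀

theorem isFirstOrderClose (h : IsAdjointArc f U u x p a s b)
    (hv : IsControlVariation f U u a s b uε α β)
    (hxε : ∀ᶠ ε in 𝓝[>] (0 : ℝ), IsSolution (drive f (Ico (α ε) (β ε)) (uε ε)) (xε ε) a b)
    (hclose : UniformlyClose x xε a b) (ha : IsFirstOrderClose n (x a) fun ε => xε ε a) {t : ℝ}
    (ht : t ∈ Icc a b) : IsFirstOrderClose n (x t) fun ε => xε ε t :=
  (h.isPerturbation hv).isFirstOrderClose h.isUniformlyC1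
    (h.isAdmissible_drive h.measurable h.mem _ _) h.solution hxε hclose ha ht

/-- The first variation formula for control variations. -/
theorem hasVariation (h : IsAdjointArc f U u x p a s b)
    (hv : IsControlVariation f U u a s b uε α β)
    (hxε : ∀ᶠ ε in 𝓝[>] (0 : ℝ), IsSolution (drive f (Ico (α ε) (β ε)) (uε ε)) (xε ε) a b)
    (hclose : UniformlyClose x xε a b) (ha : IsFirstOrderClose n (x a) fun ε => xε ε a)
    {A : ℝ → ℝ} (hA : HasVariation (x a) (fun ε => xε ε a) (p a) A) :
    HasVariation (x b) (fun ε => xε ε b) (p b) fun ε => A ε +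
      ((∫ t in (α ε)..(β ε), arcHamiltonian f x p (t, uε ε t)) -
        ∫ t in a..s, arcHamiltonian f x p (t, u t)) := by
  intro θ hθ
  refine ((h.isPerturbation hv).hasVariation h.isUniformlyC1
    (h.isAdmissible_drive h.measurable h.mem _ _) h.solution hxε hclose ha h.le h.adjoint hA
    θ hθ).congr' ?_ EventuallyEq.rfl
  filter_upwards [hv.window] with ε hw
  rw [intervalIntegral.integral_sub (h.adjoint.intervalIntegrable h.isUniformlyC1
      (h.isAdmissible_drive (hv.measurable ε) (hv.mem ε) _ _) h.solution h.le)
    (h.adjoint.intervalIntegrable h.isUniformlyC1 (h.isAdmissible_drive h.measurable h.mem _ _)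
      h.solution h.le), h.integral_drive (hv.measurable ε) (hv.mem ε) hw.1 hw.2.1 hw.2.2,
    h.integral_drive h.measurable h.mem le_rfl h.left_le h.le_right]

end IsAdjointArc

theorem HasVariation.congr_isLittleO {x₀ : M} {y : ℝ → M} {π : Covec n} {A A' : ℝ → ℝ}
    (h : HasVariation x₀ y π A) (hA : (fun ε => A ε - A' ε) =o[𝓝[>] 0] fun ε => ε) :
    HasVariation x₀ y π A' := fun θ hθ =>
  ((h θ hθ).add hA).congr (fun ε => by ring) fun _ => rfl

theorem HasVariation.congr_left {x₀ : M} {y y' : ℝ → M} {π : Covec n} {A : ℝ → ℝ}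
    (h : HasVariation x₀ y π A) (hy : ∀ᶠ ε in 𝓝[>] (0 : ℝ), y' ε = y ε) :
    HasVariation x₀ y' π A := fun θ hθ =>
  (h θ hθ).congr' (hy.mono fun ε hε => by simp only [hε]) EventuallyEq.rfl

theorem IsFirstOrderClose.congr {x₀ : M} {y y' : ℝ → M} (h : IsFirstOrderClose n x₀ y)
    (hy : ∀ᶠ ε in 𝓝[>] (0 : ℝ), y' ε = y ε) : IsFirstOrderClose n x₀ y' :=
  ⟨h.1.congr' (hy.mono fun ε hε => hε.symm), fun θ hθ => (h.2 θ hθ).congr'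
    (hy.mono fun ε hε => by simp only [hε]) EventuallyEq.rfl⟩

theorem IsFirstOrderClose.comp {x₀ : M} {y : ℝ → M} (h : IsFirstOrderClose n x₀ y) {ζ : M → M}
    (hζ : MDifferentiableAt (𝓡 n) (𝓡 n) ζ x₀) :
    IsFirstOrderClose n (ζ x₀) fun ε => ζ (y ε) :=
  ⟨hζ.continuousAt.tendsto.comp h.1, fun θ hθ => h.2 (fun x => θ (ζ x)) (hθ.comp x₀ hζ)⟩

/-! ### Pulses, delays and needles -/

/-- A trajectory which rests at `x₀`, with a constant covector. -/
theorem isAdjointArc_const (hf : ContMDiffOn ((𝓡 n).prod (𝓡 m)) (𝓡 n).tangent ∞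
      (fun z : M × EuclideanSpace ℝ (Fin m) => (⟨z.1, f z.1 z.2⟩ : TangentBundle (𝓡 n) M))
      (univ ×ˢ U)) (hU : IsCompact U) {v : EuclideanSpace ℝ (Fin m)} (hv : v ∈ U) (hab : a ≤ b)
    (x₀ : M) (π : Covec n) :
    IsAdjointArc f U (fun _ => v) (fun _ => x₀) (fun _ => π) a a b where
  smooth := hf
  isCompact := hU
  measurable := measurable_const
  mem _ := hv
  left_le := le_rfl
  le_right := hab
  solution := isSolution_const x₀ fun t _ => drive_of_notMem (by simp)
  adjoint := isAdjoint_const x₀ π fun t _ => drive_of_notMem (by simp)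

theorem isControlVariation_pulse {v : EuclideanSpace ℝ (Fin m)} (hv : v ∈ U) {α β : ℝ → ℝ} {C : ℝ}
    (hC : 0 ≤ C) (hwin : ∀ᶠ ε in 𝓝[>] (0 : ℝ), a ≤ α ε ∧ α ε ≤ β ε ∧ β ε ≤ b ∧ β ε - α ε ≤ C * ε) :
    IsControlVariation f U (fun _ => v) a a b (fun _ _ => v) α β where
  measurable _ := measurable_const
  mem _ _ := hv
  window := hwin.mono fun ε h => ⟨h.1, h.2.1, h.2.2.1⟩
  deviates := by
    refine ⟨C, hC, hwin.mono fun ε h => ?_⟩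
    refine deviatesAtMost_of_Icc (c' := a) (d' := a) h.2.1 le_rfl (by linarith [h.2.2.2])
      fun t _ h1 _ => ?_
    rw [drive_of_notMem fun h' => h1 (Ico_subset_Icc_self h'), drive_of_notMem (by simp)]

theorem isControlVariation_delay (hu : Measurable u) (hmem : ∀ t, u t ∈ U) (hab : a < b) {C : ℝ}
    (hC : 0 ≤ C) : IsControlVariation f U u a b b (fun _ => u) (fun ε => a + C * ε) fun _ => b where
  measurable _ := hu
  mem _ := hmem
  window := by
    filter_upwards [(tendsto_mul_nhdsGT C).eventually_lt_const (sub_pos.2 hab),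
      self_mem_nhdsWithin] with ε h1 h2
    have : 0 ≤ C * ε := mul_nonneg hC (le_of_lt h2)
    exact ⟨by linarith, by linarith, le_rfl⟩
  deviates := by
    refine ⟨C, hC, ?_⟩
    filter_upwards [self_mem_nhdsWithin] with ε h2
    have : 0 ≤ C * ε := mul_nonneg hC (le_of_lt h2)
    refine deviatesAtMost_of_Icc (c := a) (d := a + C * ε) (c' := a) (d' := a) (by linarith) le_rfl
      (by linarith) fun t ht h1 _ => ?_
    rw [drive_Ico ht.1.le ht.2, drive_Ico ?_ ht.2]
    by_contra h
    exact h1 ⟨ht.1.le, (not_le.1 h).le⟩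

open Classical in
/-- The needle variation of a control `u`, with value `v` on `[t₁, t₁ + ε)`. -/
def needle (u : ℝ → EuclideanSpace ℝ (Fin m)) (t₁ : ℝ) (v : EuclideanSpace ℝ (Fin m)) (ε : ℝ) :
    ℝ → EuclideanSpace ℝ (Fin m) := fun t => if t ∈ Ico t₁ (t₁ + ε) then v else u t

theorem needle_of_mem {t₁ : ℝ} {v : EuclideanSpace ℝ (Fin m)} {ε t : ℝ}
    (h : t ∈ Ico t₁ (t₁ + ε)) : needle u t₁ v ε t = v := if_pos h

theorem needle_of_notMem {t₁ : ℝ} {v : EuclideanSpace ℝ (Fin m)} {ε t : ℝ}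
    (h : t ∉ Ico t₁ (t₁ + ε)) : needle u t₁ v ε t = u t := if_neg h

theorem measurable_needle (hu : Measurable u) (t₁ : ℝ) (v : EuclideanSpace ℝ (Fin m)) (ε : ℝ) :
    Measurable (needle u t₁ v ε) := Measurable.ite measurableSet_Ico measurable_const hu

theorem needle_mem (hmem : ∀ t, u t ∈ U) (t₁ : ℝ) {v : EuclideanSpace ℝ (Fin m)} (hv : v ∈ U)
    (ε t : ℝ) : needle u t₁ v ε t ∈ U := by
  unfold needle
  split_ifs
  exacts [hv, hmem t]

/-- A needle variation, with the motion stopped at time `b - C ε`; here `C = 0` is allowed. -/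
theorem isControlVariation_needle (hu : Measurable u) (hmem : ∀ t, u t ∈ U) (hab : a < b) {t₁ : ℝ}
    {v : EuclideanSpace ℝ (Fin m)} (hv : v ∈ U) {C : ℝ} (hC : 0 ≤ C) :
    IsControlVariation f U u a b b (fun ε => needle u t₁ v ε) (fun _ => a) fun ε => b - C * ε where
  measurable := measurable_needle hu t₁ v
  mem := needle_mem hmem t₁ hv
  window := by
    filter_upwards [(tendsto_mul_nhdsGT C).eventually_lt_const (sub_pos.2 hab),
      self_mem_nhdsWithin] with ε h1 h2
    have : 0 ≤ C * ε := mul_nonneg hC (le_of_lt h2)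
    exact ⟨le_rfl, by linarith, by linarith⟩
  deviates := by
    refine ⟨1 + C, by linarith, ?_⟩
    filter_upwards [self_mem_nhdsWithin] with ε h2
    have h2 : 0 < ε := h2
    have : 0 ≤ C * ε := mul_nonneg hC h2.le
    refine deviatesAtMost_of_Icc (c := t₁) (d := t₁ + ε) (c' := b - C * ε) (d' := b) (by linarith)
      (by linarith) (by linarith) fun t ht h3 h4 => ?_
    rw [drive_Ico ht.1.le ht.2, drive_Ico ht.1.le ?_,
      needle_of_notMem fun h => h3 (Ico_subset_Icc_self h)]
    by_contra h
    exact h4 ⟨not_lt.1 h, ht.2.le⟩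

namespace IsAdjointArc

theorem integral_pulse {x₀ : M} {π : Covec n} {v : EuclideanSpace ℝ (Fin m)} (α β : ℝ) :
    ∫ t in α..β, arcHamiltonian f (fun _ => x₀) (fun _ => π) (t, v) =
      (β - α) * π (controlField f v x₀) := by
  simp [arcHamiltonian]

/-- The Hamiltonian near a Lebesgue point. -/
theorem integral_head (h : IsAdjointArc f U u x p a s b) {t₁ : ℝ} (ht₁ : t₁ ∈ Ico a b)
    (hL : IsLebesguePoint u t₁) {C : ℝ} (hC : 0 < C) :
    (fun ε => (∫ t in t₁..(t₁ + C * ε), arcHamiltonian f x p (t, u t)) -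
      C * ε * arcHamiltonian f x p (t₁, u t₁)) =o[𝓝[>] 0] fun ε => ε := by
  have hev : ∀ᶠ ε in 𝓝[>] (0 : ℝ), 0 ≤ C * ε ∧ t₁ + C * ε ≤ b := by
    filter_upwards [(tendsto_mul_nhdsGT C).eventually_lt_const (sub_pos.2 ht₁.2),
      self_mem_nhdsWithin] with ε h1 h2
    exact ⟨mul_nonneg hC.le (le_of_lt h2), by linarith⟩
  refine (integral_window (α := fun _ => t₁) (β := fun ε => t₁ + C * ε) (u := fun _ => u)
    h.isCompact h.continuousOn_arcHamiltonian ⟨ht₁.1, ht₁.2.le⟩ (h.mem t₁) hC.le ?_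
    (fun _ => h.measurable) (Eventually.of_forall fun ε t _ => h.mem t) ?_
    (isLittleO_comp_mul hL.isLittleO hC)).congr (fun ε => by ring) fun _ => rfl
  · filter_upwards [hev] with ε hε
    exact ⟨by linarith, ht₁.1, hε.2, by linarith, le_rfl⟩
  · filter_upwards [hev] with ε hε
    exact h.intervalIntegrable h.measurable h.mem ht₁.1 (by linarith) hε.2

/-- The Hamiltonian of a constant control on a short window. -/
theorem integral_head_const (h : IsAdjointArc f U u x p a s b) {t₁ : ℝ} (ht₁ : t₁ ∈ Ico a b)
    {v : EuclideanSpace ℝ (Fin m)} (hv : v ∈ U) :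
    (fun ε => (∫ t in t₁..(t₁ + ε), arcHamiltonian f x p (t, v)) -
      ε * arcHamiltonian f x p (t₁, v)) =o[𝓝[>] 0] fun ε => ε := by
  have hev : ∀ᶠ ε in 𝓝[>] (0 : ℝ), 0 ≤ ε ∧ t₁ + ε ≤ b := by
    filter_upwards [mem_nhdsWithin_of_mem_nhds (Iio_mem_nhds (sub_pos.2 ht₁.2)),
      self_mem_nhdsWithin] with ε h1 h2
    have h1 : ε < b - t₁ := h1
    exact ⟨le_of_lt h2, by linarith⟩
  refine (integral_window (α := fun _ => t₁) (β := fun ε => t₁ + ε) (u := fun _ _ => v) (w := v)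
    h.isCompact h.continuousOn_arcHamiltonian ⟨ht₁.1, ht₁.2.le⟩ hv zero_le_one ?_
    (fun _ => measurable_const) (Eventually.of_forall fun ε t _ => hv) ?_
    ?_).congr (fun ε => by ring) fun _ => rfl
  · filter_upwards [hev] with ε hε
    exact ⟨by linarith, ht₁.1, hε.2, by linarith, by linarith⟩
  · filter_upwards [hev] with ε hε
    exact h.intervalIntegrable measurable_const (fun _ => hv) ht₁.1 (by linarith) hε.2
  · simp

/-- The Hamiltonian before a time at which the control has a left value. -/
theorem integral_tail (h : IsAdjointArc f U u x p a s b) (hab : a < b)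
    {w : EuclideanSpace ℝ (Fin m)} (hw : w ∈ U) (hL : IsLeftLebesgueValue u b w) {C : ℝ}
    (hC : 0 < C) :
    (fun ε => (∫ t in (b - C * ε)..b, arcHamiltonian f x p (t, u t)) -
      C * ε * arcHamiltonian f x p (b, w)) =o[𝓝[>] 0] fun ε => ε := by
  have hev : ∀ᶠ ε in 𝓝[>] (0 : ℝ), 0 ≤ C * ε ∧ a ≤ b - C * ε := by
    filter_upwards [(tendsto_mul_nhdsGT C).eventually_lt_const (sub_pos.2 hab),
      self_mem_nhdsWithin] with ε h1 h2
    exact ⟨mul_nonneg hC.le (le_of_lt h2), by linarith⟩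
  refine (integral_window (α := fun ε => b - C * ε) (β := fun _ => b) (u := fun _ => u)
    h.isCompact h.continuousOn_arcHamiltonian ⟨hab.le, le_rfl⟩ hw hC.le ?_
    (fun _ => h.measurable) (Eventually.of_forall fun ε t _ => h.mem t) ?_
    (isLittleO_comp_mul hL.isLittleO hC)).congr (fun ε => by ring) fun _ => rfl
  · filter_upwards [hev] with ε hε
    exact ⟨by linarith, hε.2, le_rfl, le_rfl, by linarith⟩
  · filter_upwards [hev] with ε hε
    exact h.intervalIntegrable h.measurable h.mem hε.2 (by linarith) le_rfl

theorem integral_needle (h : IsAdjointArc f U u x p a s b) {t₁ : ℝ}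
    {v : EuclideanSpace ℝ (Fin m)} (hv : v ∈ U) {ε d : ℝ} (hε : 0 ≤ ε) (hat : a ≤ t₁)
    (htd : t₁ + ε ≤ d) (hdb : d ≤ b) :
    (∫ t in a..d, arcHamiltonian f x p (t, needle u t₁ v ε t)) -
      (∫ t in a..b, arcHamiltonian f x p (t, u t)) =
      (∫ t in t₁..(t₁ + ε), arcHamiltonian f x p (t, v)) -
      (∫ t in t₁..(t₁ + ε), arcHamiltonian f x p (t, u t)) -
      ∫ t in d..b, arcHamiltonian f x p (t, u t) := by
  have hN : ∀ c d, a ≤ c → c ≤ d → d ≤ b → IntervalIntegrable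
      (fun t => arcHamiltonian f x p (t, needle u t₁ v ε t)) volume c d := fun c d =>
    h.intervalIntegrable (measurable_needle h.measurable t₁ v ε) (needle_mem h.mem t₁ hv ε)
  have hN0 : ∀ c d, a ≤ c → c ≤ d → d ≤ b → IntervalIntegrable
      (fun t => arcHamiltonian f x p (t, u t)) volume c d := fun c d =>
    h.intervalIntegrable h.measurable h.mem
  have htb : t₁ + ε ≤ b := htd.trans hdb
  have h1 := intervalIntegral.integral_add_adjacent_intervals
    (hN a t₁ le_rfl hat (by linarith)) (hN t₁ (t₁ + ε) hat (by linarith) htb)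
  have h2 := intervalIntegral.integral_add_adjacent_intervals
    (hN a (t₁ + ε) le_rfl (by linarith) htb) (hN (t₁ + ε) d (by linarith) htd hdb)
  have h3 := intervalIntegral.integral_add_adjacent_intervals
    (hN0 a t₁ le_rfl hat (by linarith)) (hN0 t₁ (t₁ + ε) hat (by linarith) htb)
  have h4 := intervalIntegral.integral_add_adjacent_intervals
    (hN0 a (t₁ + ε) le_rfl (by linarith) htb) (hN0 (t₁ + ε) d (by linarith) htd hdb)
  have h5 := intervalIntegral.integral_add_adjacent_intervals
    (hN0 a d le_rfl (by linarith) hdb) (hN0 d b (by linarith) hdb le_rfl)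
  have e1 : ∫ t in a..t₁, arcHamiltonian f x p (t, needle u t₁ v ε t) =
      ∫ t in a..t₁, arcHamiltonian f x p (t, u t) := by
    refine intervalIntegral.integral_congr_ae ?_
    filter_upwards [ae_ne t₁] with t hne ht
    rw [uIoc_of_le hat] at ht
    rw [needle_of_notMem fun h' => absurd h'.1 (not_le.2 (ht.2.lt_of_ne hne))]
  have e2 : ∫ t in t₁..(t₁ + ε), arcHamiltonian f x p (t, needle u t₁ v ε t) =
      ∫ t in t₁..(t₁ + ε), arcHamiltonian f x p (t, v) := by
    refine intervalIntegral.integral_congr_ae ?_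
    filter_upwards [ae_ne (t₁ + ε)] with t hne ht
    rw [uIoc_of_le (by linarith)] at ht
    rw [needle_of_mem ⟨ht.1.le, ht.2.lt_of_ne hne⟩]
  have e3 : ∫ t in (t₁ + ε)..d, arcHamiltonian f x p (t, needle u t₁ v ε t) =
      ∫ t in (t₁ + ε)..d, arcHamiltonian f x p (t, u t) := by
    refine intervalIntegral.integral_congr_ae (Eventually.of_forall fun t ht => ?_)
    rw [uIoc_of_le htd] at ht
    rw [needle_of_notMem fun h' => absurd h'.2 (not_lt.2 ht.1.le)]
  linarith

theorem integral_needle_isLittleO (h : IsAdjointArc f U u x p a s b) {t₁ : ℝ} (ht₁ : t₁ ∈ Ico a b)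
    (hL : IsLebesguePoint u t₁) {v : EuclideanSpace ℝ (Fin m)} (hv : v ∈ U) :
    (fun ε => (∫ t in a..b, arcHamiltonian f x p (t, needle u t₁ v ε t)) -
      (∫ t in a..b, arcHamiltonian f x p (t, u t)) -
      ε * (arcHamiltonian f x p (t₁, v) - arcHamiltonian f x p (t₁, u t₁))) =o[𝓝[>] 0]
      fun ε => ε := by
  refine ((h.integral_head_const ht₁ hv).sub (h.integral_head ht₁ hL one_pos)).congr' ?_
    EventuallyEq.rfl
  filter_upwards [mem_nhdsWithin_of_mem_nhds (Iio_mem_nhds (sub_pos.2 ht₁.2)),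
    self_mem_nhdsWithin] with ε h1 h2
  have h1 : ε < b - t₁ := h1
  have h2 : 0 < ε := h2
  rw [h.integral_needle hv h2.le ht₁.1 (by linarith) le_rfl, intervalIntegral.integral_same]
  simp only [one_mul]
  ring

theorem integral_needle_freeze_isLittleO (h : IsAdjointArc f U u x p a s b) {t₁ : ℝ}
    (ht₁ : t₁ ∈ Ico a b) (hL : IsLebesguePoint u t₁) {v w : EuclideanSpace ℝ (Fin m)} (hv : v ∈ U)
    (hw : w ∈ U) (hLw : IsLeftLebesgueValue u b w) {C : ℝ} (hC : 0 < C) :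
    (fun ε => (∫ t in a..(b - C * ε), arcHamiltonian f x p (t, needle u t₁ v ε t)) -
      (∫ t in a..b, arcHamiltonian f x p (t, u t)) -
      ε * (arcHamiltonian f x p (t₁, v) - arcHamiltonian f x p (t₁, u t₁) -
        C * arcHamiltonian f x p (b, w))) =o[𝓝[>] 0] fun ε => ε := by
  refine (((h.integral_head_const ht₁ hv).sub (h.integral_head ht₁ hL one_pos)).sub
    (h.integral_tail (ht₁.1.trans_lt ht₁.2) hw hLw hC)).congr' ?_ EventuallyEq.rfl
  filter_upwards [(tendsto_mul_nhdsGT (1 + C)).eventually_lt_const (sub_pos.2 ht₁.2),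
    self_mem_nhdsWithin] with ε h1 h2
  have h2 : 0 < ε := h2
  have h3 : 0 < C * ε := mul_pos hC h2
  rw [h.integral_needle hv h2.le ht₁.1 (by linarith) (by linarith)]
  simp only [one_mul]
  ring

end IsAdjointArc

end

section

/-! ### Arrival at the switching hypersurface -/

variable {n m : ℕ} {M : Type*} [TopologicalSpace M] [ChartedSpace (EuclideanSpace ℝ (Fin n)) M]
  [IsManifold (𝓡 n) ∞ M] {f : (x : M) → EuclideanSpace ℝ (Fin m) → TangentSpace (𝓡 n) x}
  {U : Set (EuclideanSpace ℝ (Fin m))} {u : ℝ → EuclideanSpace ℝ (Fin m)} {x : ℝ → M}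
  {p : ℝ → Covec n} {a s b : ℝ}

/-- Changing the covector at the final time. -/
theorem IsAdjointArc.exists_adjoint (h : IsAdjointArc f U u x p a s b) (π : Covec n) :
    ∃ p', p' b = π ∧ IsAdjointArc f U u x p' a s b := by
  obtain ⟨p', hp', had⟩ := h.solution.exists_isAdjoint h.isUniformlyC1
    (h.isAdmissible_drive h.measurable h.mem a s) h.le π
  exact ⟨p', hp', { h with adjoint := had }⟩

theorem isControlVariation_freeze (hu : Measurable u) (hmem : ∀ t, u t ∈ U) (hab : a < b) :
    IsControlVariation f U u a b b (fun _ => u) (fun _ => a) fun ε => b - 1 * ε where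
  measurable _ := hu
  mem _ := hmem
  window := by
    filter_upwards [(tendsto_mul_nhdsGT 1).eventually_lt_const (sub_pos.2 hab),
      self_mem_nhdsWithin] with ε h1 h2
    have h2 : 0 < ε := h2
    exact ⟨le_rfl, by linarith, by linarith⟩
  deviates := by
    refine ⟨1, zero_le_one, ?_⟩
    filter_upwards [self_mem_nhdsWithin] with ε h2
    have h2 : 0 < ε := h2
    refine deviatesAtMost_of_Icc (c := b - 1 * ε) (d := b) (c' := b) (d' := b) (by linarith) le_rfl
      (by linarith) fun t ht h3 _ => ?_
    rw [drive_Ico ht.1.le ht.2, drive_Ico ht.1.le ?_]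
    by_contra h
    exact h3 ⟨not_lt.1 h, ht.2.le⟩

theorem uniformlyClose_const (x : ℝ → M) (a b : ℝ) : UniformlyClose x (fun _ => x) a b :=
  fun _ _ _ _ _ _ hmap => Eventually.of_forall fun _ => hmap

/-- Variation of the stopped trajectories of a needle variation, stopped at the time `b - C ε`. -/
theorem IsAdjointArc.hasVariation_needle_freeze (h : IsAdjointArc f U u x p a b b) (hab : a < b)
    {t₁ : ℝ} (ht₁ : t₁ ∈ Ico a b) (hL : IsLebesguePoint u t₁) {v w : EuclideanSpace ℝ (Fin m)}
    (hv : v ∈ U) (hw : w ∈ U) (hLw : IsLeftLebesgueValue u b w) {xε : ℝ → ℝ → M}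
    (hinit : ∀ᶠ ε in 𝓝[>] (0 : ℝ), xε ε a = x a)
    (hxε : ∀ᶠ ε in 𝓝[>] (0 : ℝ), IsSolution (drive f (Ico a b) (needle u t₁ v ε)) (xε ε) a b)
    (hclose : UniformlyClose x xε a b) {C : ℝ} (hC : 0 < C) :
    IsFirstOrderClose n (x b) (fun ε => xε ε (b - C * ε)) ∧
    HasVariation (x b) (fun ε => xε ε (b - C * ε)) (p b) fun ε =>
      ε * (arcHamiltonian f x p (t₁, v) - arcHamiltonian f x p (t₁, u t₁) -
        C * arcHamiltonian f x p (b, w)) := by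
  have hev : ∀ᶠ ε in 𝓝[>] (0 : ℝ), 0 ≤ C * ε ∧ a ≤ b - C * ε := by
    filter_upwards [(tendsto_mul_nhdsGT C).eventually_lt_const (sub_pos.2 hab),
      self_mem_nhdsWithin] with ε h1 h2
    exact ⟨mul_nonneg hC.le (le_of_lt h2), by linarith⟩
  have hv' : IsControlVariation f U u a b b _ _ _ :=
    isControlVariation_needle h.measurable h.mem hab (t₁ := t₁) hv hC.le
  have hcl := hclose.freeze hab h.solution.1.1 C
  have hs : ∀ᶠ ε in 𝓝[>] (0 : ℝ), IsSolution (drive f (Ico a (b - C * ε)) (needle u t₁ v ε))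
      (fun t => xε ε (min t (b - C * ε))) a b := by
    filter_upwards [hxε, hev] with ε h1 h2
    exact h1.freeze h2.2 (by linarith) (by linarith)
  have hin : ∀ᶠ ε in 𝓝[>] (0 : ℝ), xε ε (min a (b - C * ε)) = x a := by
    filter_upwards [hinit, hev] with ε h1 h2
    rw [min_eq_left h2.2, h1]
  have hfin : ∀ᶠ ε in 𝓝[>] (0 : ℝ), xε ε (b - C * ε) = xε ε (min b (b - C * ε)) := by
    filter_upwards [hev] with ε h2
    rw [min_eq_right (by linarith)]
  have hfo := (isFirstOrderClose_const (n := n) (x a)).congr hin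
  refine ⟨(h.isFirstOrderClose hv' hs hcl hfo ⟨hab.le, le_rfl⟩).congr hfin, ?_⟩
  have hvar := h.hasVariation hv' hs hcl hfo ((hasVariation_const (x a) (p a)).congr_left hin)
  refine (hvar.congr_left hfin).congr_isLittleO
    ((h.integral_needle_freeze_isLittleO ht₁ hL hv hw hLw hC).congr (fun ε => by ring) fun _ => rfl)

/-- If a function grows with unit speed along the velocity at the final time, then it is bounded
above by a linear function along the trajectory. -/
theorem IsAdjointArc.exists_le_linear (h : IsAdjointArc f U u x p a b b) (hab : a < b)
    {w : EuclideanSpace ℝ (Fin m)} (hw : w ∈ U) (hLw : IsLeftLebesgueValue u b w) {φ : M → ℝ}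
    (hφ : MDifferentiableAt (𝓡 n) 𝓘(ℝ, ℝ) φ (x b)) (hφ0 : φ (x b) = 0)
    (hφ1 : differential n φ (x b) (controlField f w (x b)) = 1) :
    ∃ c, a ≤ c ∧ c < b ∧ ∀ t ∈ Icc c b, φ (x t) ≤ -(b - t) / 2 := by
  obtain ⟨p', hp', h'⟩ := h.exists_adjoint (differential n φ (x b))
  have hev : ∀ᶠ ε in 𝓝[>] (0 : ℝ), 0 < ε ∧ a ≤ b - 1 * ε := by
    filter_upwards [(tendsto_mul_nhdsGT 1).eventually_lt_const (sub_pos.2 hab),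
      self_mem_nhdsWithin] with ε h1 h2
    exact ⟨h2, by linarith⟩
  have hs : ∀ᶠ ε in 𝓝[>] (0 : ℝ), IsSolution (drive f (Ico a (b - 1 * ε)) u)
      (fun t => x (min t (b - 1 * ε))) a b := by
    filter_upwards [hev] with ε h2
    exact h.solution.freeze h2.2 (by linarith) (by linarith)
  have hin : ∀ᶠ ε in 𝓝[>] (0 : ℝ), x (min a (b - 1 * ε)) = x a := by
    filter_upwards [hev] with ε h2
    rw [min_eq_left h2.2]
  have hvar := h'.hasVariation (isControlVariation_freeze h.measurable h.mem hab) hs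
    ((uniformlyClose_const x a b).freeze hab h.solution.1.1 1)
    ((isFirstOrderClose_const (n := n) (x a)).congr hin)
    ((hasVariation_const (x a) (p' a)).congr_left hin) φ (by
      rw [hp']
      exact hasMFDerivAt_differential hφ)
  have hH : arcHamiltonian f x p' (b, w) = 1 := by
    rw [arcHamiltonian, hp']
    exact hφ1
  have hlim : (fun ε => φ (x (b - ε)) + ε) =o[𝓝[>] 0] fun ε : ℝ => ε := by
    refine (hvar.sub (h'.integral_tail hab hw hLw one_pos)).congr' ?_ EventuallyEq.rfl
    filter_upwards [hev] with ε h2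
    have h3 := intervalIntegral.integral_add_adjacent_intervals
      (h'.intervalIntegrable h.measurable h.mem le_rfl h2.2 (by linarith))
      (h'.intervalIntegrable h.measurable h.mem h2.2 (show b - 1 * ε ≤ b by linarith) le_rfl)
    rw [hφ0, hH, min_eq_right (by linarith), ← h3]
    simp only [one_mul]
    ring
  have hev2 : ∀ᶠ ε in 𝓝[>] (0 : ℝ), φ (x (b - ε)) ≤ -ε / 2 := by
    filter_upwards [(Asymptotics.isLittleO_iff.1 hlim) (c := 1 / 2) (by norm_num),
      self_mem_nhdsWithin] with ε h1 h2
    have h2 : 0 < ε := h2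
    rw [Real.norm_eq_abs, Real.norm_eq_abs, abs_of_pos h2] at h1
    linarith [(abs_le.1 h1).2]
  obtain ⟨δ, hδ, hsub⟩ := mem_nhdsGT_iff_exists_Ioo_subset.1 hev2
  have hδ : 0 < δ := hδ
  refine ⟨max a (b - δ / 2), le_max_left _ _, max_lt hab (by linarith), fun t ht => ?_⟩
  rcases eq_or_lt_of_le ht.2 with rfl | htb
  · rw [hφ0]
    simp
  · have h1 := (le_max_right _ _).trans ht.1
    have h2 : b - t ∈ Ioo 0 δ := ⟨by linarith, by linarith⟩
    have h3 : φ (x (b - (b - t))) ≤ -(b - t) / 2 := hsub h2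
    rwa [sub_sub_cancel] at h3

/-- The values of a smooth function along perturbed trajectories deviate by `O(ε)` near the final
time. -/
theorem IsAdjointArc.exists_rate (h : IsAdjointArc f U u x p a b b) (hab : a < b)
    {uε : ℝ → ℝ → EuclideanSpace ℝ (Fin m)} {α β : ℝ → ℝ} {xε : ℝ → ℝ → M}
    (hv : IsControlVariation f U u a b b uε α β)
    (hxε : ∀ᶠ ε in 𝓝[>] (0 : ℝ), IsSolution (drive f (Ico (α ε) (β ε)) (uε ε)) (xε ε) a b)
    (hclose : UniformlyClose x xε a b) (ha : IsFirstOrderClose n (x a) fun ε => xε ε a)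
    {φ : M → ℝ} (hφ : ContMDiffAt (𝓡 n) 𝓘(ℝ, ℝ) ∞ φ (x b)) :
    ∃ K c, 0 ≤ K ∧ a ≤ c ∧ c < b ∧
      ∀ᶠ ε in 𝓝[>] (0 : ℝ), ∀ t ∈ Icc c b, |φ (xε ε t) - φ (x t)| ≤ K * ε := by
  obtain ⟨q, ξ₀, r, B, L, δ, hδ, hshort⟩ :=
    exists_isShortArc h.isUniformlyC1 h.solution.1.1 (⟨hab.le, le_rfl⟩ : b ∈ Icc a b)
  set c₀ := max a (b - δ / 2) with hc₀
  have hac₀ : a ≤ c₀ := le_max_left _ _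
  have hc₀b : c₀ < b := max_lt hab (by linarith)
  have hs := hshort c₀ b hac₀ hc₀b.le le_rfl
    (by linarith [le_max_right a (b - δ / 2)]) (by linarith)
  have hsrc := (hs.stays b ⟨hc₀b.le, le_rfl⟩).1
  obtain ⟨l, T, hT, hlip⟩ :=
    ((contDiffAt_comp_chart_symm hsrc hφ).of_le (by simp) : ContDiffAt ℝ 1 _ _).exists_lipschitzOnWith
  have hWo : IsOpen ((chart n q).source ∩ chart n q ⁻¹' interior T) :=
    (continuousOn_extChartAt q).isOpen_inter_preimage (isOpen_chart_source q) isOpen_interior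
  obtain ⟨c, hc₀c, hcb, hmap⟩ := exists_mapsTo_Icc_left hc₀b
    (h.solution.1.1.mono (Icc_subset_Icc_left hac₀)) hWo ⟨hsrc, mem_interior_iff_mem_nhds.2 hT⟩
  have hp := (h.isPerturbation hv).mono hac₀ le_rfl
  have hclose₀ := hclose.mono hac₀ le_rfl
  obtain ⟨K, hK, hrate⟩ := hs.uniform_rate hc₀b.le (h.isAdmissible_drive h.measurable h.mem a b) hp
    (h.solution.mono hac₀ le_rfl) (hxε.mono fun ε hε => hε.mono hac₀ le_rfl) hclose₀
    (h.isFirstOrderClose hv hxε hclose ha ⟨hac₀, hc₀b.le⟩)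
  refine ⟨l * K, c, by positivity, hac₀.trans hc₀c, hcb, ?_⟩
  filter_upwards [hrate, hclose₀ c b _ hc₀c le_rfl hWo hmap] with ε h1 h2 t ht
  have h3 := hlip.norm_sub_le (interior_subset (h2 ht).2) (interior_subset (hmap ht).2)
  simp only [(chart n q).left_inv (h2 ht).1, (chart n q).left_inv (hmap ht).1] at h3
  calc _ ≤ l * ‖chart n q (xε ε t) - chart n q (x t)‖ := h3
    _ ≤ l * (K * ε) := by
      gcongr
      exact h1 t ⟨hc₀c.trans ht.1, ht.2⟩
    _ = _ := by ring

end

section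

variable {n m : ℕ} {M : Type*} [TopologicalSpace M] [ChartedSpace (EuclideanSpace ℝ (Fin n)) M]
  [IsManifold (𝓡 n) ∞ M] {f : (x : M) → EuclideanSpace ℝ (Fin m) → TangentSpace (𝓡 n) x}
  {U : Set (EuclideanSpace ℝ (Fin m))} {u : ℝ → EuclideanSpace ℝ (Fin m)} {z : ℝ → M}
  {r : ℝ → Covec n} {b t_s : ℝ}

/-- A pulse does not move the state before it begins. -/
theorem IsSolution.eq_start_of_pulse (hf : ContMDiffOn ((𝓡 n).prod (𝓡 m)) (𝓡 n).tangent ∞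
      (fun z : M × EuclideanSpace ℝ (Fin m) => (⟨z.1, f z.1 z.2⟩ : TangentBundle (𝓡 n) M))
      (univ ×ˢ U)) (hU : IsCompact U) {x : ℝ → M} {a c d e : ℝ}
    (h : IsSolution (drive f (Ico c d) u) x a e) (hac : a ≤ c) (hce : c ≤ e) : x c = x a :=
  (h.mono le_rfl hce).eq_of_zero (isUniformlyC1_controlFamily hf hU) (Or.inl rfl)
    (fun _ ht => drive_of_notMem fun h' => absurd h'.1 (not_le.2 ht.2)) ⟨hac, le_rfl⟩

/-- A pulse does not move the state after it ends. -/
theorem IsSolution.eq_end_of_pulse (hf : ContMDiffOn ((𝓡 n).prod (𝓡 m)) (𝓡 n).tangent ∞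
      (fun z : M × EuclideanSpace ℝ (Fin m) => (⟨z.1, f z.1 z.2⟩ : TangentBundle (𝓡 n) M))
      (univ ×ˢ U)) (hU : IsCompact U) {x : ℝ → M} {a c d e : ℝ}
    (h : IsSolution (drive f (Ico c d) u) x a e) (had : a ≤ d) (hde : d ≤ e) : x e = x d :=
  (h.mono had le_rfl).eq_of_zero (isUniformlyC1_controlFamily hf hU) (Or.inl rfl)
    (fun _ ht => drive_of_notMem fun h' => absurd h'.2 (not_lt.2 ht.1.le)) ⟨hde, le_rfl⟩

/-- Perturbed trajectories hit the hypersurface `φ = 0`. The states `y₀ ε` lie before the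
hypersurface, at the times `t_s - C ε`; from there on, the constant control `w`, which crosses the
hypersurface with unit speed at `yₛ`, leads to a first hitting time `s ε < t_s + C ε`. -/
theorem exists_hitting (hf : ContMDiffOn ((𝓡 n).prod (𝓡 m)) (𝓡 n).tangent ∞
      (fun z : M × EuclideanSpace ℝ (Fin m) => (⟨z.1, f z.1 z.2⟩ : TangentBundle (𝓡 n) M))
      (univ ×ˢ U)) (hU : IsCompact U) {w : EuclideanSpace ℝ (Fin m)} (hw : w ∈ U) {yₛ : M}
    {y₀ : ℝ → M} (hy₀ : IsFirstOrderClose n yₛ y₀) {V : Set M} (hV : IsOpen V) (hyV : yₛ ∈ V)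
    {φ : M → ℝ} (hφ : ContMDiffOn (𝓡 n) 𝓘(ℝ, ℝ) ∞ φ V) (hφ0 : φ yₛ = 0)
    (hφ1 : differential n φ yₛ (controlField f w yₛ) = 1) {C D : ℝ} (hCD : |D| < C)
    (hvar : HasVariation yₛ y₀ (differential n φ yₛ) fun ε => ε * (D - C)) (t_s : ℝ) :
    ∃ (Y : ℝ → ℝ → M) (s : ℝ → ℝ),
      (∀ᶠ ε in 𝓝[>] (0 : ℝ), Y ε (t_s - C * ε) = y₀ ε ∧ t_s - C * ε < s ε ∧ s ε < t_s + C * ε ∧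
        IsSolution (fun _ => controlField f w) (Y ε) (t_s - C * ε) (s ε) ∧
        φ (Y ε (s ε)) = 0 ∧
        ∀ t ∈ Ico (t_s - C * ε) (s ε), Y ε t ∈ V ∧ φ (Y ε t) ≠ 0) ∧
      IsFirstOrderClose n yₛ (fun ε => Y ε (s ε)) ∧
      ∀ (π : Covec n) (A : ℝ → ℝ), HasVariation yₛ y₀ π A →
        HasVariation yₛ (fun ε => Y ε (s ε)) π fun ε =>
          A ε + (s ε - (t_s - C * ε)) * π (controlField f w yₛ) := by
  have hC : 0 < C := (abs_nonneg D).trans_lt hCD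
  obtain ⟨hD1, hD2⟩ := abs_lt.1 hCD
  set a := t_s - 1 with ha
  set b := t_s + 1 with hb
  have hab : a ≤ b := by linarith
  have hφm : MDifferentiableAt (𝓡 n) 𝓘(ℝ, ℝ) φ yₛ :=
    (hφ.contMDiffAt (hV.mem_nhds hyV)).mdifferentiableAt (by simp)
  have harc := fun π : Covec n => isAdjointArc_const hf hU hw hab yₛ π
  have hev : ∀ᶠ ε in 𝓝[>] (0 : ℝ), 0 < ε ∧ 0 < C * ε ∧ C * ε < 1 := by
    filter_upwards [(tendsto_mul_nhdsGT C).eventually_lt_const one_pos,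
      self_mem_nhdsWithin] with ε h1 h2
    exact ⟨h2, mul_pos hC h2, h1⟩
  have hpulse : IsControlVariation f U (fun _ => w) a a b (fun _ _ => w) (fun ε => t_s - C * ε)
      fun ε => t_s + C * ε := by
    refine isControlVariation_pulse (C := 2 * C) hw (by positivity) ?_
    filter_upwards [hev] with ε ⟨_, h1, h2⟩
    exact ⟨by linarith, by linarith, by linarith, by linarith⟩
  obtain ⟨Y, hinit, hsol, hclose⟩ := (harc 0).exists_family hpulse hy₀
  have hfo : IsFirstOrderClose n yₛ fun ε => Y ε a := hy₀.congr hinit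
  -- before the pulse the defining function is negative, and after it positive
  have hneg : ∀ᶠ ε in 𝓝[>] (0 : ℝ), φ (y₀ ε) < 0 := by
    have h1 := hvar φ (hasMFDerivAt_differential hφm)
    filter_upwards [(Asymptotics.isLittleO_iff.1 h1) (c := (C - D) / 2) (by linarith), hev]
      with ε h2 ⟨h3, _⟩
    rw [Real.norm_eq_abs, Real.norm_eq_abs, abs_of_pos h3, hφ0] at h2
    nlinarith [(abs_le.1 h2).2, mul_pos h3 (show 0 < C - D by linarith)]
  have hpos : ∀ᶠ ε in 𝓝[>] (0 : ℝ), 0 < φ (Y ε b) := by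
    have h1 := (harc (differential n φ yₛ)).hasVariation hpulse hsol hclose hfo
      (hvar.congr_left hinit) φ (hasMFDerivAt_differential hφm)
    filter_upwards [(Asymptotics.isLittleO_iff.1 h1) (c := (C + D) / 2) (by linarith), hev]
      with ε h2 ⟨h3, _⟩
    rw [Real.norm_eq_abs, Real.norm_eq_abs, abs_of_pos h3, hφ0, IsAdjointArc.integral_pulse,
      intervalIntegral.integral_same, hφ1] at h2
    nlinarith [(abs_le.1 h2).1, mul_pos h3 (show 0 < C + D by linarith)]
  have hstart : ∀ᶠ ε in 𝓝[>] (0 : ℝ), Y ε (t_s - C * ε) = y₀ ε := by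
    filter_upwards [hinit, hsol, hev] with ε h1 h2 ⟨_, h3, h4⟩
    rw [h2.eq_start_of_pulse hf hU (by linarith) (by linarith), h1]
  have hend : ∀ᶠ ε in 𝓝[>] (0 : ℝ), Y ε b = Y ε (t_s + C * ε) := by
    filter_upwards [hsol, hev] with ε h2 ⟨_, h3, h4⟩
    exact h2.eq_end_of_pulse hf hU (by linarith) (by linarith)
  have hYV := hclose a b V le_rfl le_rfl hV fun _ _ => hyV
  have hex : ∀ᶠ ε in 𝓝[>] (0 : ℝ), ∃ s, t_s - C * ε < s ∧ s < t_s + C * ε ∧ φ (Y ε s) = 0 ∧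
      ∀ t ∈ Ico (t_s - C * ε) s, φ (Y ε t) ≠ 0 := by
    filter_upwards [hneg, hpos, hstart, hend, hYV, hsol, hev]
      with ε hneg hpos hstart hend hYV hsol ⟨_, h3, h4⟩
    have hsub : Icc (t_s - C * ε) (t_s + C * ε) ⊆ Icc a b :=
      Icc_subset_Icc (by linarith) (by linarith)
    have hcont : ContinuousOn (fun t => φ (Y ε t)) (Icc (t_s - C * ε) (t_s + C * ε)) :=
      hφ.continuousOn.comp (hsol.1.1.mono hsub) fun t ht => hYV (hsub ht)
    have hne : (Icc (t_s - C * ε) (t_s + C * ε) ∩ (fun t => φ (Y ε t)) ⁻¹' {0}).Nonempty := by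
      obtain ⟨t, ht, h0⟩ := intermediate_value_Icc (by linarith) hcont
        (show (0 : ℝ) ∈ Icc _ _ from ⟨by rw [hstart]; exact hneg.le, by rw [← hend]; exact hpos.le⟩)
      exact ⟨t, ht, h0⟩
    obtain ⟨s, ⟨hsI, hs0⟩, hleast⟩ := (isCompact_Icc.of_isClosed_subset
      (hcont.preimage_isClosed_of_isClosed isClosed_Icc isClosed_singleton)
      inter_subset_left).exists_isLeast hne
    have hs0 : φ (Y ε s) = 0 := hs0
    refine ⟨s, hsI.1.lt_of_ne ?_, hsI.2.lt_of_ne ?_, hs0, fun t ht h0 => ?_⟩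
    · rintro rfl
      rw [hstart] at hs0
      exact hneg.ne hs0
    · rintro rfl
      rw [← hend] at hs0
      exact hpos.ne' hs0
    · exact absurd (hleast ⟨⟨ht.1, ht.2.le.trans hsI.2⟩, h0⟩) (not_le.2 ht.2)
  obtain ⟨s, hs⟩ := hex.choice
  -- the trajectories stopped at the hitting time
  have hpulse' : IsControlVariation f U (fun _ => w) a a b (fun _ _ => w) (fun ε => t_s - C * ε)
      s := by
    refine isControlVariation_pulse (C := 2 * C) hw (by positivity) ?_
    filter_upwards [hev, hs] with ε ⟨_, h1, h2⟩ ⟨h3, h4, _⟩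
    exact ⟨by linarith, by linarith, by linarith, by linarith⟩
  have hsol' : ∀ᶠ ε in 𝓝[>] (0 : ℝ), IsSolution (drive f (Ico (t_s - C * ε) (s ε)) fun _ => w)
      (fun t => Y ε (min t (s ε))) a b := by
    filter_upwards [hsol, hev, hs] with ε h0 ⟨_, h1, h2⟩ ⟨h3, h4, _⟩
    exact h0.freeze (by linarith) (by linarith) h4.le
  have hclose' : UniformlyClose (fun _ => yₛ) (fun ε t => Y ε (min t (s ε))) a b := by
    intro c d W hac hdb hW hmap
    rcases lt_or_ge d c with hdc | hcd
    · exact Eventually.of_forall fun ε t ht => absurd (ht.1.trans ht.2) (not_le.2 hdc)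
    filter_upwards [hclose a b W le_rfl le_rfl hW fun _ _ => hmap ⟨le_rfl, hcd⟩, hev, hs]
      with ε h0 ⟨_, h1, h2⟩ ⟨h3, h4, _⟩ t ht
    exact h0 ⟨le_min (hac.trans ht.1) (by linarith), (min_le_left _ _).trans (ht.2.trans hdb)⟩
  have hinit' : ∀ᶠ ε in 𝓝[>] (0 : ℝ), Y ε (min a (s ε)) = y₀ ε := by
    filter_upwards [hinit, hev, hs] with ε h0 ⟨_, h1, h2⟩ ⟨h3, h4, _⟩
    rw [min_eq_left (by linarith), h0]
  have hfin' : ∀ᶠ ε in 𝓝[>] (0 : ℝ), Y ε (s ε) = Y ε (min b (s ε)) := by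
    filter_upwards [hev, hs] with ε ⟨_, h1, h2⟩ ⟨h3, h4, _⟩
    rw [min_eq_right (by linarith)]
  refine ⟨Y, s, ?_, ((harc 0).isFirstOrderClose hpulse' hsol' hclose' (hy₀.congr hinit')
    ⟨hab, le_rfl⟩).congr hfin', fun π A hA => ?_⟩
  · filter_upwards [hstart, hs, hsol, hev, hYV] with ε h1 ⟨h2, h3, h4, h5⟩ h6 ⟨_, h7, h8⟩ h9
    refine ⟨h1, h2, h3, ?_, h4, fun t ht => ⟨h9 ⟨by linarith [ht.1], by linarith [ht.2]⟩, h5 t ht⟩⟩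
    exact (h6.mono (by linarith) (by linarith)).congr (fun _ _ => rfl) fun t ht =>
      (drive_Ico (u := fun _ => w) ht.1.le (ht.2.trans h3)).symm
  · refine (((harc π).hasVariation hpulse' hsol' hclose' (hy₀.congr hinit')
      (hA.congr_left hinit')).congr_left hfin').congr_isLittleO ?_
    simp only [IsAdjointArc.integral_pulse, intervalIntegral.integral_same, sub_zero, sub_self]
    exact Asymptotics.isLittleO_zero _ _

open Classical in
/-- Restart after the switching: from the states `z₀ ε` at times `s ε`, the control is held at its
value at the nominal switching time `t_s` until the time `t_s + C ε`, and is unchanged afterwards. -/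
theorem IsAdjointArc.exists_restart (h : IsAdjointArc f U u z r t_s b b) (hb : t_s < b)
    (hL : IsLebesguePoint u t_s) {z₀ : ℝ → M} (hz₀ : IsFirstOrderClose n (z t_s) z₀) {C : ℝ}
    (hC : 0 < C) {s : ℝ → ℝ}
    (hs : ∀ᶠ ε in 𝓝[>] (0 : ℝ), t_s - C * ε < s ε ∧ s ε < t_s + C * ε) :
    ∃ Z : ℝ → ℝ → M,
      (∀ᶠ ε in 𝓝[>] (0 : ℝ), Z ε (s ε) = z₀ ε ∧
        IsSolution (fun t => controlField f (if t < t_s + C * ε then u t_s else u t)) (Z ε)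
          (s ε) b) ∧
      ∀ A : ℝ → ℝ, HasVariation (z t_s) z₀ (r t_s) A →
        HasVariation (z b) (fun ε => Z ε b) (r b) fun ε =>
          A ε + (t_s - s ε) * arcHamiltonian f z r (t_s, u t_s) := by
  have hf := h.smooth
  have hU := h.isCompact
  set a := t_s - 1 with ha
  set e := t_s + 1 with he
  have hae : a ≤ e := by linarith
  have harc := isAdjointArc_const hf hU (h.mem t_s) hae (z t_s) (r t_s)
  have hev : ∀ᶠ ε in 𝓝[>] (0 : ℝ), 0 < C * ε ∧ C * ε < 1 ∧ t_s + C * ε < b := by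
    filter_upwards [(tendsto_mul_nhdsGT C).eventually_lt_const one_pos,
      (tendsto_mul_nhdsGT C).eventually_lt_const (sub_pos.2 hb), self_mem_nhdsWithin] with ε h1 h2 h3
    exact ⟨mul_pos hC h3, h1, by linarith⟩
  have hpulse : IsControlVariation f U (fun _ => u t_s) a a e (fun _ _ => u t_s) s
      fun ε => t_s + C * ε := by
    refine isControlVariation_pulse (C := 2 * C) (h.mem t_s) (by positivity) ?_
    filter_upwards [hev, hs] with ε ⟨h1, h2, _⟩ ⟨h3, h4⟩
    exact ⟨by linarith, by linarith, by linarith, by linarith⟩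
  obtain ⟨X, hXinit, hXsol, hXclose⟩ := harc.exists_family hpulse hz₀
  have hXfo : IsFirstOrderClose n (z t_s) fun ε => X ε a := hz₀.congr hXinit
  have hXe := harc.isFirstOrderClose hpulse hXsol hXclose hXfo ⟨hae, le_rfl⟩
  have hdelay : IsControlVariation f U u t_s b b (fun _ => u) (fun ε => t_s + C * ε) fun _ => b :=
    isControlVariation_delay h.measurable h.mem hb hC.le
  obtain ⟨Z', hZinit, hZsol, hZclose⟩ := h.exists_family hdelay hXe
  have hglue : ∀ᶠ ε in 𝓝[>] (0 : ℝ), Z' ε (t_s + C * ε) = X ε (t_s + C * ε) := by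
    filter_upwards [hXsol, hZinit, hZsol, hev, hs] with ε h1 h2 h3 ⟨h4, h5, h6⟩ ⟨h7, h8⟩
    rw [h3.eq_start_of_pulse hf hU (by linarith) h6.le, h2,
      h1.eq_end_of_pulse hf hU (by linarith) (by linarith)]
  set Z : ℝ → ℝ → M := fun ε t => if t ≤ t_s + C * ε then X ε t else Z' ε t with hZ
  have hZ1 : ∀ ε t, t ≤ t_s + C * ε → Z ε t = X ε t := fun ε t ht => if_pos ht
  have hZ2 : ∀ᶠ ε in 𝓝[>] (0 : ℝ), ∀ t, t_s + C * ε ≤ t → Z ε t = Z' ε t := by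
    filter_upwards [hglue] with ε hε t ht
    rcases eq_or_lt_of_le ht with rfl | h'
    · rw [hZ1 _ _ le_rfl, hε]
    · exact if_neg (not_le.2 h')
  refine ⟨Z, ?_, fun A hA => ?_⟩
  · filter_upwards [hXinit, hXsol, hZsol, hZ2, hev, hs]
      with ε h1 h2 h3 h0 ⟨h4, h5, h6⟩ ⟨h7, h8⟩
    refine ⟨?_, ?_⟩
    · rw [hZ1 _ _ h8.le, h2.eq_start_of_pulse hf hU (by linarith) (by linarith), h1]
    · refine IsSolution.trans h8.le h6.le ((h2.mono (by linarith) (by linarith)).congr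
        (fun t ht => hZ1 _ _ ht.2) fun t ht => ?_) ((h3.mono (by linarith) le_rfl).congr
        (fun t ht => h0 t ht.1) fun t ht => ?_)
      · rw [if_pos ht.2, drive_Ico (u := fun _ => u t_s) ht.1.le ht.2]
      · rw [if_neg (not_lt.2 ht.1.le), drive_Ico ht.1.le ht.2]
  · have hXvar := harc.hasVariation hpulse hXsol hXclose hXfo (hA.congr_left hXinit)
    have hZvar := h.hasVariation hdelay hZsol hZclose (hXe.congr hZinit)
      (hXvar.congr_left hZinit)
    refine (hZvar.congr_left ?_).congr_isLittleO ?_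
    · filter_upwards [hZ2, hev] with ε h0 h1
      exact h0 b h1.2.2.le
    · refine (h.integral_head ⟨le_rfl, hb⟩ hL hC).neg_left.congr' ?_ EventuallyEq.rfl
      filter_upwards [hev] with ε ⟨h4, h5, h6⟩
      have h7 := intervalIntegral.integral_add_adjacent_intervals
        (h.intervalIntegrable h.measurable h.mem le_rfl (show t_s ≤ t_s + C * ε by linarith) h6.le)
        (h.intervalIntegrable h.measurable h.mem (by linarith) h6.le le_rfl)
      rw [IsAdjointArc.integral_pulse, intervalIntegral.integral_same, ← h7]
      simp only [arcHamiltonian]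
      ring

end

section

/-! ### Minimization of the Hamiltonian -/

variable {n m : ℕ} {M : Type*} [TopologicalSpace M] [ChartedSpace (EuclideanSpace ℝ (Fin n)) M]
  [IsManifold (𝓡 n) ∞ M]

theorem nonneg_of_isLittleO {F : ℝ → ℝ} {Δ : ℝ} (h : (fun ε => F ε - ε * Δ) =o[𝓝[>] 0] fun ε => ε)
    (hF : ∀ᶠ ε in 𝓝[>] (0 : ℝ), 0 ≤ F ε) : 0 ≤ Δ := by
  by_contra! hΔ
  obtain ⟨ε, h1, h2, h3⟩ := ((Asymptotics.isLittleO_iff.1 h (c := -Δ / 2) (by linarith)).and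
    (hF.and self_mem_nhdsWithin)).exists
  have h3 : 0 < ε := h3
  rw [Real.norm_eq_abs, Real.norm_eq_abs, abs_of_pos h3] at h1
  nlinarith [(abs_le.1 h1).2, mul_pos h3 (neg_pos.2 hΔ)]

theorem isSolution_drive_Ico {f : (x : M) → EuclideanSpace ℝ (Fin m) → TangentSpace (𝓡 n) x}
    {u : ℝ → EuclideanSpace ℝ (Fin m)} {x : ℝ → M} {a b : ℝ} :
    IsSolution (drive f (Ico a b) u) x a b ↔ IsControlledCurve f u x a b :=
  ⟨fun h => h.congr (g' := fun t => controlField f (u t)) (fun _ _ => rfl) fun _ ht =>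
      (drive_Ico ht.1.le ht.2).symm,
    fun h => IsSolution.congr (g := fun t => controlField f (u t)) h (fun _ _ => rfl) fun _ ht =>
      drive_Ico ht.1.le ht.2⟩

theorem IsControlledCurve.congr
    {f : (x : M) → EuclideanSpace ℝ (Fin m) → TangentSpace (𝓡 n) x}
    {u u' : ℝ → EuclideanSpace ℝ (Fin m)} {x : ℝ → M} {a b : ℝ} (h : IsControlledCurve f u x a b)
    (hu : ∀ t ∈ Ioo a b, u' t = u t) : IsControlledCurve f u' x a b :=
  IsSolution.congr (g := fun t => controlField f (u t)) (g' := fun t => controlField f (u' t)) h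
    (fun _ _ => rfl) fun t ht => by rw [hu t ht]

/-- Variations are mapped by the jump map, the covector being pulled back by its differential; the
differential of a function `φ` may be added to the covector if `φ` vanishes at `y₀` and at all
points `y ε`. -/
theorem HasVariation.jump {y₀ : M} {y : ℝ → M} {ζ : M → M} {φ : M → ℝ} {π ρ : Covec n} {μ : ℝ}
    {A : ℝ → ℝ} (h : HasVariation y₀ y π A) (hζ : MDifferentiableAt (𝓡 n) (𝓡 n) ζ y₀)
    (hφ : MDifferentiableAt (𝓡 n) 𝓘(ℝ, ℝ) φ y₀) (hφ0 : φ y₀ = 0)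
    (hφy : ∀ᶠ ε in 𝓝[>] (0 : ℝ), φ (y ε) = 0)
    (hπ : π = ρ.comp (show Eucl n →L[ℝ] Eucl n from mfderiv (𝓡 n) (𝓡 n) ζ y₀) +
      μ • differential n φ y₀) : HasVariation (ζ y₀) (fun ε => ζ (y ε)) ρ A := by
  intro θ hθ
  have h1 : HasMFDerivAt (𝓡 n) 𝓘(ℝ, ℝ) (fun x => θ (ζ x) + μ * φ x) y₀
      (show TangentSpace (𝓡 n) y₀ →L[ℝ] ℝ from π) := by
    rw [hπ]
    exact (HasMFDerivAt.comp y₀ hθ hζ.hasMFDerivAt).add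
      ((hasMFDerivAt_differential hφ).const_smul μ)
  refine (h _ h1).congr' ?_ EventuallyEq.rfl
  filter_upwards [hφy] with ε hε
  rw [hε, hφ0]
  ring

variable {𝓗 : ImpulsiveHybridSystem n m M} {h : M → ℝ} {t₀ t_f t_s : ℝ} {x₀ : M}
  {u : ℝ → EuclideanSpace ℝ (Fin m)} {y z : ℝ → M} {w : EuclideanSpace ℝ (Fin m)}
  {p r : ℝ → Covec n} {t₁ : ℝ} {v : EuclideanSpace ℝ (Fin m)}

theorem hasVariation_cost {A : ℝ → ℝ} {Z : ℝ → M} {x₁ : M} (hh : ContMDiff (𝓡 n) 𝓘(ℝ, ℝ) 1 h)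
    (hZ : HasVariation x₁ Z (differential n h x₁) A) :
    (fun ε => h (Z ε) - h x₁ - A ε) =o[𝓝[>] 0] fun ε => ε :=
  hZ h (hasMFDerivAt_differential ((hh x₁).mdifferentiableAt (by simp)))

/-- Needle variations after the switching time are hybrid trajectories with the same switching. -/
theorem IsMayerOptimal.le_after_switch (hopt : IsMayerOptimal 𝓗 h t₀ t_f x₀ u t_s y z w)
    (hh : ContMDiff (𝓡 n) 𝓘(ℝ, ℝ) 1 h)
    (arc₁ : IsAdjointArc (𝓗.f 1) 𝓗.U u z r t_s t_f t_f)
    (hr : r t_f = differential n h (z t_f)) (ht₁ : t₁ ∈ Ico t_s t_f) (hL : IsLebesguePoint u t₁)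
    (hv : v ∈ 𝓗.U) :
    arcHamiltonian (𝓗.f 1) z r (t₁, u t₁) ≤ arcHamiltonian (𝓗.f 1) z r (t₁, v) := by
  obtain ⟨htr, hmin⟩ := hopt
  have hlt := htr.switch_lt
  have hcv : IsControlVariation (𝓗.f 1) 𝓗.U u t_s t_f t_f (fun ε => needle u t₁ v ε)
      (fun _ => t_s) fun _ => t_f := by
    simpa using isControlVariation_needle (f := 𝓗.f 1) arc₁.measurable arc₁.mem hlt (t₁ := t₁) hv
      (le_refl (0 : ℝ))
  obtain ⟨Z, hinit, hsol, hclose⟩ := arc₁.exists_family hcv (isFirstOrderClose_const (z t_s))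
  have hvar := arc₁.hasVariation hcv hsol hclose ((isFirstOrderClose_const (z t_s)).congr hinit)
    ((hasVariation_const (z t_s) (r t_s)).congr_left hinit)
  rw [hr] at hvar
  refine sub_nonneg.1 (nonneg_of_isLittleO ((hasVariation_cost hh (hvar.congr_isLittleO
    ((arc₁.integral_needle_isLittleO ht₁ hL hv).congr (fun ε => by ring) fun _ => rfl)))) ?_)
  filter_upwards [hinit, hsol] with ε h1 h2
  have heq : ∀ t < t_s, needle u t₁ v ε t = u t := fun t ht =>
    needle_of_notMem fun h' => absurd (ht₁.1.trans h'.1) (not_le.2 ht)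
  refine sub_nonneg.2 (hmin (needle u t₁ v ε) t_s y (Z ε) w ?_)
  exact { htr with
    measurable_u := measurable_needle arc₁.measurable t₁ v ε
    u_mem := fun t _ => needle_mem arc₁.mem t₁ hv ε t
    dynamics₀ := htr.dynamics₀.congr fun t ht => heq t ht.2
    leftValue := htr.leftValue.congr htr.lt_switch fun τ hτ => heq τ hτ.2
    jump := by rw [h1, htr.jump]
    dynamics₁ := isSolution_drive_Ico.1 h2 }

open Classical in
/-- Needle variations before the switching time. The perturbed trajectory follows the needle
variation until the time `t_s - C ε`, then uses the control value `u(t_s⁻)` until it hits the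
switching manifold, and then the value `u(t_s)` until the time `t_s + C ε`. By the continuity of the
Hamiltonian at the switching time, the change of the switching time has no influence on the cost to
first order. -/
theorem IsMayerOptimal.le_before_switch (hopt : IsMayerOptimal 𝓗 h t₀ t_f x₀ u t_s y z w)
    (hh : ContMDiff (𝓡 n) 𝓘(ℝ, ℝ) 1 h) (hLs : IsLebesguePoint u t_s)
    (hcl : ∀ t ∈ Ico t₀ t_s, y t ∉ closure 𝓗.S)
    (arc₀ : IsAdjointArc (𝓗.f 0) 𝓗.U u y p t₀ t_s t_s)
    (arc₁ : IsAdjointArc (𝓗.f 1) 𝓗.U u z r t_s t_f t_f)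
    (hr : r t_f = differential n h (z t_f)) {V : Set M} (hV : IsOpen V) (hyV : y t_s ∈ V)
    {φ : M → ℝ} (hφ : ContMDiffOn (𝓡 n) 𝓘(ℝ, ℝ) ∞ φ V) (hφS : ∀ x ∈ V, x ∈ 𝓗.S ↔ φ x = 0)
    (hφ1 : differential n φ (y t_s) (controlField (𝓗.f 0) w (y t_s)) = 1) {μ : ℝ}
    (hp : p t_s = (r t_s).comp
      (show Eucl n →L[ℝ] Eucl n from mfderiv (𝓡 n) (𝓡 n) 𝓗.ζ (y t_s)) +
        μ • differential n φ (y t_s))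
    (hH : arcHamiltonian (𝓗.f 0) y p (t_s, w) = arcHamiltonian (𝓗.f 1) z r (t_s, u t_s))
    (ht₁ : t₁ ∈ Ico t₀ t_s) (hL : IsLebesguePoint u t₁) (hv : v ∈ 𝓗.U) :
    arcHamiltonian (𝓗.f 0) y p (t₁, u t₁) ≤ arcHamiltonian (𝓗.f 0) y p (t₁, v) := by
  obtain ⟨htr, hmin⟩ := hopt
  have hlt₀ := htr.lt_switch
  have hlt₁ := htr.switch_lt
  have hf := arc₀.smooth
  have hw : w ∈ 𝓗.U := htr.leftValue.mem arc₀.isCompact arc₀.measurable hlt₀ fun t _ => arc₀.mem t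
  have hφs : ContMDiffAt (𝓡 n) 𝓘(ℝ, ℝ) ∞ φ (y t_s) := hφ.contMDiffAt (hV.mem_nhds hyV)
  have hφd : MDifferentiableAt (𝓡 n) 𝓘(ℝ, ℝ) φ (y t_s) := hφs.mdifferentiableAt (by simp)
  have hφ0 : φ (y t_s) = 0 := (hφS _ hyV).1 htr.mem_S
  -- the needle variation
  have hcv : IsControlVariation (𝓗.f 0) 𝓗.U u t₀ t_s t_s (fun ε => needle u t₁ v ε)
      (fun _ => t₀) fun _ => t_s := by
    simpa using isControlVariation_needle (f := 𝓗.f 0) arc₀.measurable arc₀.mem hlt₀ (t₁ := t₁) hv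
      (le_refl (0 : ℝ))
  obtain ⟨Y₀, hinit, hsol, hclose⟩ := arc₀.exists_family hcv (isFirstOrderClose_const (y t₀))
  obtain ⟨K, c₁, hK, hc₁, hc₁s, hrate⟩ := arc₀.exists_rate hlt₀ hcv hsol hclose
    ((isFirstOrderClose_const (y t₀)).congr hinit) hφs
  obtain ⟨c₂, hc₂, hc₂s, hlin⟩ := arc₀.exists_le_linear hlt₀ hw htr.leftValue hφd hφ0 hφ1
  obtain ⟨c₃, hc₃, hc₃s, hmapV⟩ := exists_mapsTo_Icc_left hlt₀ arc₀.solution.1.1 hV hyV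
  set c := max c₁ (max c₂ c₃) with hc
  have hc₀ : t₀ ≤ c := hc₁.trans (le_max_left _ _)
  have hcs : c < t_s := max_lt hc₁s (max_lt hc₂s hc₃s)
  have hcc₂ : c₂ ≤ c := (le_max_left _ _).trans (le_max_right _ _)
  have hcc₃ : c₃ ≤ c := (le_max_right _ _).trans (le_max_right _ _)
  obtain ⟨p', hp', arc'⟩ := arc₀.exists_adjoint (differential n φ (y t_s))
  set D := arcHamiltonian (𝓗.f 0) y p' (t₁, v) - arcHamiltonian (𝓗.f 0) y p' (t₁, u t₁) with hD
  set C := |D| + 2 * K + 1 with hCdef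
  have hC : 0 < C := by positivity
  have hCD : |D| < C := by linarith
  obtain ⟨hfo, hvar⟩ :=
    arc₀.hasVariation_needle_freeze hlt₀ ht₁ hL hv hw htr.leftValue hinit hsol hclose hC
  have hvar' := (arc'.hasVariation_needle_freeze hlt₀ ht₁ hL hv hw htr.leftValue hinit hsol hclose
    hC).2
  have hκ' : arcHamiltonian (𝓗.f 0) y p' (t_s, w) = 1 := by
    rw [arcHamiltonian, hp']
    exact hφ1
  rw [hp', hκ', mul_one, ← hD] at hvar'
  obtain ⟨Y, s, hY, hYfo, hYvar⟩ :=
    exists_hitting hf arc₀.isCompact hw hfo hV hyV hφ hφ0 hφ1 hCD hvar' t_s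
  -- the restart after the jump
  have hζ : MDifferentiableAt (𝓡 n) (𝓡 n) 𝓗.ζ (y t_s) :=
    (𝓗.smooth_ζ (y t_s)).mdifferentiableAt (by simp)
  have hz₀ : IsFirstOrderClose n (z t_s) fun ε => 𝓗.ζ (Y ε (s ε)) := by
    rw [htr.jump]
    exact hYfo.comp hζ
  have hvarz := (hYvar _ _ hvar).jump hζ hφd hφ0 (hY.mono fun ε hε => hε.2.2.2.2.1) hp
  rw [← htr.jump] at hvarz
  obtain ⟨Z, hZ, hZvar⟩ := arc₁.exists_restart hlt₁ hLs hz₀ hC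
    (hY.mono fun ε hε => ⟨hε.2.1, hε.2.2.1⟩)
  have hfin := hZvar _ hvarz
  rw [hr] at hfin
  refine sub_nonneg.1 (nonneg_of_isLittleO (((hasVariation_cost hh hfin).congr
    (fun ε => ?_) fun _ => rfl)) (F := fun ε => h (Z ε t_f) - h (z t_f)) ?_)
  · have e : p t_s (controlField (𝓗.f 0) w (y t_s)) = arcHamiltonian (𝓗.f 0) y p (t_s, w) := rfl
    rw [e, ← hH]
    ring
  have htrans := eventually_not_isTangentTo hV hyV hφ hφS (W := controlField (𝓗.f 0) w)
    (arc₀.isUniformlyC1.differentiableAt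
      ((chart n (y t_s)).map_source (mem_extChartAt_source _)) (Or.inr ⟨w, hw, rfl⟩)).continuousAt
    (by rw [hφ1]; exact one_ne_zero)
  filter_upwards [hinit, hsol, hY, hZ, hYfo.1.eventually htrans, hYfo.1 (hV.mem_nhds hyV), hrate,
    hclose t₀ c _ le_rfl hcs.le isClosed_closure.isOpen_compl
      (fun t ht => hcl t ⟨ht.1, ht.2.trans_lt hcs⟩),
    hclose c t_s V hc₀ le_rfl hV (fun t ht => hmapV ⟨hcc₃.trans ht.1, ht.2⟩),
    (tendsto_mul_nhdsGT C).eventually_lt_const (sub_pos.2 hcs),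
    (tendsto_mul_nhdsGT C).eventually_lt_const (sub_pos.2 hlt₁), self_mem_nhdsWithin]
    with ε hinit hsol ⟨hY1, hY2, hY3, hY4, hY5, hY6⟩ ⟨hZ1, hZ2⟩ htrans hYV hrate havoid hnear
      hε1 hε2 hε
  have hε : 0 < ε := hε
  have hCε : 0 < C * ε := mul_pos hC hε
  set σ := t_s - C * ε with hσ
  have h0σ : c < σ := by linarith
  set u' : ℝ → EuclideanSpace ℝ (Fin m) := fun t => if t < σ then needle u t₁ v ε t else
    if t < s ε then w else if t < t_s + C * ε then u t_s else u t with hu'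
  set y' : ℝ → M := fun t => if t ≤ σ then Y₀ ε t else Y ε t with hy'
  have hy1 : ∀ t ≤ σ, y' t = Y₀ ε t := fun t ht => if_pos ht
  have hy2 : ∀ t, σ ≤ t → y' t = Y ε t := fun t ht => by
    rcases eq_or_lt_of_le ht with rfl | h'
    · rw [hy1 σ le_rfl, hY1]
    · exact if_neg (not_le.2 h')
  have hys : y' (s ε) = Y ε (s ε) := hy2 _ hY2.le
  refine sub_nonneg.2 (hmin u' (s ε) y' (Z ε) w ?_)
  refine
    { lt_switch := by linarith
      switch_lt := by linarith
      measurable_u := Measurable.ite measurableSet_Iio (measurable_needle arc₀.measurable t₁ v ε)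
        (Measurable.ite measurableSet_Iio measurable_const
          (Measurable.ite measurableSet_Iio measurable_const arc₀.measurable))
      u_mem := fun t _ => ?_
      init := by rw [hy1 t₀ (by linarith), hinit, htr.init]
      dynamics₀ := ?_
      notMem_S := fun t ht => ?_
      mem_S := by
        rw [hys]
        exact (hφS _ hYV).2 hY5
      leftValue := isLeftLebesgueValue_of_eventually hY2 fun τ hτ => ?_
      transversal := by
        rw [hys]
        exact htrans
      jump := by rw [hZ1, hys]
      dynamics₁ := ?_ }
  · simp only [hu']
    split_ifs
    exacts [needle_mem arc₀.mem t₁ hv ε t, hw, arc₀.mem t_s, arc₀.mem t]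
  · refine IsSolution.trans (g := fun t => controlField (𝓗.f 0) (u' t)) (by linarith) hY2.le
      ((hsol.mono le_rfl (by linarith)).congr (fun t ht => hy1 t ht.2) fun t ht => ?_)
      (hY4.congr (fun t ht => hy2 t ht.1) fun t ht => ?_)
    · rw [drive_Ico ht.1.le (by linarith [ht.2])]
      simp only [hu', if_pos ht.2]
    · simp only [hu', if_neg (not_lt.2 ht.1.le), if_pos ht.2]
  · rcases lt_or_ge t σ with htσ | htσ
    · rw [hy1 t htσ.le]
      rcases le_total t c with htc | htc
      · exact fun hS => havoid ⟨ht.1, htc⟩ (subset_closure hS)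
      · intro hS
        have e1 := (hφS _ (hnear ⟨htc, by linarith⟩)).1 hS
        have e2 := hlin t ⟨hcc₂.trans htc, by linarith⟩
        have e3 := (abs_le.1 (hrate t ⟨(le_max_left _ _).trans htc, by linarith⟩)).2
        have e4 : 2 * K * ε < C * ε := by
          have := abs_nonneg D
          have : 2 * K < C := by linarith
          gcongr
        linarith
    · rw [hy2 t htσ]
      obtain ⟨e1, e2⟩ := hY6 t ⟨htσ, ht.2⟩
      exact fun hS => e2 ((hφS _ e1).1 hS)
  · simp only [hu', if_neg (not_lt.2 hτ.1.le), if_pos hτ.2]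
  · refine IsSolution.congr (g' := fun t => controlField (𝓗.f 1) (u' t)) hZ2 (fun _ _ => rfl)
      fun t ht => ?_
    simp only [hu', if_neg (not_lt.2 (hY2.le.trans ht.1.le)), if_neg (not_lt.2 ht.1.le)]

end

section

/-! ### Hamilton's equations -/

variable {n m : ℕ} {M : Type*} [TopologicalSpace M] [ChartedSpace (EuclideanSpace ℝ (Fin n)) M]
  [IsManifold (𝓡 n) ∞ M] {f : (x : M) → EuclideanSpace ℝ (Fin m) → TangentSpace (𝓡 n) x}
  {U : Set (EuclideanSpace ℝ (Fin m))} {u u' : ℝ → EuclideanSpace ℝ (Fin m)} {x : ℝ → M}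
  {p : ℝ → Covec n} {a b : ℝ}

theorem IsAdjointArc.isHamiltonianCurve (h : IsAdjointArc f U u x p a b b)
    (hu : ∀ t ∈ Ioo a b, u' t = u t) : IsHamiltonianCurve f u' x p a b := by
  refine ⟨h.solution.1, fun q c d hac hcd hdb hmap => ?_, fun q => ?_⟩
  · exact h.adjoint.1 q c d hac hcd hdb (by rwa [chart_source])
  · filter_upwards [h.solution.2, h.adjoint.2 q] with t h1 h2 ht hsrc
    have hsrc' : x t ∈ (chart n q).source := by rwa [chart_source]
    have h1 := h1 ht
    have h2 := h2 ht hsrc'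
    rw [drive_Ico ht.1.le ht.2, ← hu t ht] at h1 h2
    have hdiff : DifferentiableAt ℝ (coordField q (controlField f (u' t))) (chart n q (x t)) :=
      h.isUniformlyC1.differentiableAt ((chart n q).map_source hsrc')
        (Or.inr ⟨u' t, by rw [hu t ht]; exact h.mem t, rfl⟩)
    refine ⟨_, _, h1.hasDerivAt_chart hsrc', h2, fun η => ?_, ?_⟩
    · have h3 : HasFDerivAt
          (fun π : Covec n => localHamiltonian f q (chart n q (x t)) π (u' t))
          (ContinuousLinearMap.apply ℝ ℝ
            (coordField q (controlField f (u' t)) (chart n q (x t))))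
          (covectorCoord q (x t) (p t)) :=
        (ContinuousLinearMap.apply ℝ ℝ
          (coordField q (controlField f (u' t)) (chart n q (x t)))).hasFDerivAt
      rw [h3.fderiv, ContinuousLinearMap.apply_apply, coordField_chart hsrc']
    · have h3 : HasFDerivAt
          (fun ξ => localHamiltonian f q ξ (covectorCoord q (x t) (p t)) (u' t))
          ((coordCovec q (x t) (p t)).comp
            (fderiv ℝ (coordField q (controlField f (u' t))) (chart n q (x t))))
          (chart n q (x t)) :=
        (ContinuousLinearMap.hasFDerivAt (coordCovec q (x t) (p t))).comp _ hdiff.hasFDerivAt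
      rw [h3.fderiv]

theorem minimizesHamiltonian_of_isLebesguePoint (hU : IsCompact U) (hu : Measurable u)
    (hmem : ∀ t ∈ Ico a b, u t ∈ U)
    (h : ∀ t ∈ Ico a b, IsLebesguePoint u t → ∀ v ∈ U,
      arcHamiltonian f x p (t, u t) ≤ arcHamiltonian f x p (t, v)) :
    MinimizesHamiltonian f U u x p a b := by
  refine ⟨?_, h⟩
  filter_upwards [ae_isLebesguePoint hU hu hmem] with t ht htI using h t htI (ht htI)

/-! ### Modification of a control outside its domain -/

theorem IsLebesguePoint.congr {t c : ℝ} (h : IsLebesguePoint u t) (hc : t < c)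
    (heq : ∀ τ ∈ Ico t c, u' τ = u τ) : IsLebesguePoint u' t := by
  refine Tendsto.congr' ?_ h
  filter_upwards [self_mem_nhdsWithin,
    mem_nhdsWithin_of_mem_nhds (Iio_mem_nhds (sub_pos.2 hc))] with ε hε hε'
  have hε : 0 < ε := hε
  have hε' : ε < c - t := hε'
  congr 1
  refine intervalIntegral.integral_congr fun τ hτ => ?_
  rw [uIcc_of_le (by linarith)] at hτ
  simp only [heq τ ⟨hτ.1, by linarith [hτ.2]⟩, heq t ⟨le_rfl, hc⟩]

theorem IsHybridTrajectory.congr {𝓗 : ImpulsiveHybridSystem n m M} {t₀ t_f t_s : ℝ} {x₀ : M}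
    {y z : ℝ → M} {w : EuclideanSpace ℝ (Fin m)}
    (h : IsHybridTrajectory 𝓗 t₀ t_f x₀ u t_s y z w) (hu : Measurable u')
    (heq : ∀ t ∈ Ico t₀ t_f, u' t = u t) : IsHybridTrajectory 𝓗 t₀ t_f x₀ u' t_s y z w :=
  { h with
    measurable_u := hu
    u_mem := fun t ht => by
      rw [heq t ht]
      exact h.u_mem t ht
    dynamics₀ := h.dynamics₀.congr fun t ht => heq t ⟨ht.1.le, ht.2.trans h.switch_lt⟩
    leftValue := h.leftValue.congr h.lt_switch fun τ hτ =>
      heq τ ⟨hτ.1.le, hτ.2.trans h.switch_lt⟩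
    dynamics₁ := h.dynamics₁.congr fun t ht => heq t ⟨h.lt_switch.le.trans ht.1.le, ht.2⟩ }

/-- Transport of covectors along an equality of base points is invisible in the representation of
covectors as linear forms on the model space. -/
theorem cotangentMap_transport {ζ : M → M} {x₁ x₂ : M} (e : x₁ = ζ x₂) (α : CotangentSpaceAt n x₁) :
    (show Covec n from cotangentMap ζ x₂ (e ▸ α)) = (show Covec n from α).comp
      (show Eucl n →L[ℝ] Eucl n from mfderiv (𝓡 n) (𝓡 n) ζ x₂) := by
  subst e
  rfl

end

end HybridControl

end

theorem theorem3p1 {n m : ℕ} {M : Type*} [TopologicalSpace M] [T2Space M]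
    [SecondCountableTopology M] [ChartedSpace (EuclideanSpace ℝ (Fin n)) M]
    [IsManifold (𝓡 n) ∞ M]
    (g : Bundle.ContMDiffRiemannianMetric (𝓡 n) ∞ (EuclideanSpace ℝ (Fin n))
      (TangentSpace (𝓡 n) : M → Type _))
    (𝓗 : HybridControl.ImpulsiveHybridSystem n m M)
    (h : M → ℝ) (hh : ContMDiff (𝓡 n) 𝓘(ℝ, ℝ) 1 h)
    (t₀ t_f : ℝ) (x₀ : M)
    -- an optimal control with its hybrid trajectory
    (u : ℝ → EuclideanSpace ℝ (Fin m)) (t_s : ℝ) (y z : ℝ → M) (w : EuclideanSpace ℝ (Fin m))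
    (hopt : HybridControl.IsMayerOptimal 𝓗 h t₀ t_f x₀ u t_s y z w)
    -- the switching time is a Lebesgue point of the optimal control
    (hu : HybridControl.IsLebesguePoint u t_s)
    -- the optimal trajectory stays away from the closure of `S` before the switching time
    (hcl : ∀ t ∈ Ico t₀ t_s, y t ∉ closure 𝓗.S) :
    ∃ (p : (t : ℝ) → HybridControl.CotangentSpaceAt n (y t))
      (r : (t : ℝ) → HybridControl.CotangentSpaceAt n (z t)),
      -- Hamilton's equations in both phases
      HybridControl.IsHamiltonianCurve (𝓗.f 0) u y p t₀ t_s ∧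
      HybridControl.IsHamiltonianCurve (𝓗.f 1) u z r t_s t_f ∧
      -- minimization of the Hamiltonian in both phases
      HybridControl.MinimizesHamiltonian (𝓗.f 0) 𝓗.U u y p t₀ t_s ∧
      HybridControl.MinimizesHamiltonian (𝓗.f 1) 𝓗.U u z r t_s t_f ∧
      -- terminal condition
      r t_f = mfderiv (𝓡 n) 𝓘(ℝ, ℝ) h (z t_f) ∧
      -- nontriviality
      (mfderiv (𝓡 n) 𝓘(ℝ, ℝ) h (z t_f) ≠ 0 → ∀ t ∈ Icc t_s t_f, r t ≠ 0) ∧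
      -- adjoint jump condition, with a normal vector `N` of `S` at the switching state
      (∃ N : TangentSpace (𝓡 n) (y t_s), N ≠ 0 ∧
        (∀ X : TangentSpace (𝓡 n) (y t_s),
          HybridControl.IsTangentTo 𝓗.S (y t_s) X → g.inner (y t_s) N X = 0) ∧
        ∃ μ : ℝ, p t_s =
          HybridControl.cotangentMap 𝓗.ζ (y t_s) (hopt.1.jump ▸ r t_s) + μ • g.inner (y t_s) N) ∧
      -- continuity of the Hamiltonian at the switching time
      HybridControl.hamiltonian (𝓗.f 0) (y t_s) (p t_s) w =
        HybridControl.hamiltonian (𝓗.f 1) (z t_s) (r t_s) (u t_s) := by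
  classical
  obtain ⟨htr, hmin⟩ := hopt
  have hlt₀ := htr.lt_switch
  have hlt₁ := htr.switch_lt
  -- outside of `[t₀, t_f)`, where nothing is known about `u`, an admissible value is prescribed
  set ū : ℝ → EuclideanSpace ℝ (Fin m) := fun t => if t ∈ Ico t₀ t_f then u t else u t₀ with hū
  have heq : ∀ t ∈ Ico t₀ t_f, ū t = u t := fun t ht => if_pos ht
  have hmeas : Measurable ū := Measurable.ite measurableSet_Ico htr.measurable_u measurable_const
  have hmem : ∀ t, ū t ∈ 𝓗.U := fun t => by
    simp only [hū]
    split_ifs with ht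
    exacts [htr.u_mem t ht, htr.u_mem t₀ ⟨le_rfl, hlt₀.trans hlt₁⟩]
  have hopt' : HybridControl.IsMayerOptimal 𝓗 h t₀ t_f x₀ ū t_s y z w :=
    ⟨htr.congr hmeas heq, hmin⟩
  have hLs : HybridControl.IsLebesguePoint ū t_s :=
    hu.congr hlt₁ fun τ hτ => heq τ ⟨hlt₀.le.trans hτ.1, hτ.2⟩
  have heq₀ : ∀ t ∈ Ico t₀ t_s, ū t = u t := fun t ht => heq t ⟨ht.1, ht.2.trans hlt₁⟩
  have heq₁ : ∀ t ∈ Ico t_s t_f, ū t = u t := fun t ht => heq t ⟨hlt₀.le.trans ht.1, ht.2⟩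
  -- the conormal of the switching manifold
  obtain ⟨V, hV, hyV, φ, hφ, hφS, hφ1⟩ :=
    𝓗.hypersurface_S.exists_definingFunction htr.mem_S htr.transversal
  obtain ⟨N, hN⟩ := HybridControl.exists_inner_eq g (y t_s)
    (show TangentSpace (𝓡 n) (y t_s) →L[ℝ] ℝ from HybridControl.differential n φ (y t_s))
  -- the adjoint curves
  have hC₀ := HybridControl.isUniformlyC1_controlFamily (𝓗.smooth_f 0) 𝓗.isCompact_U
  have hC₁ := HybridControl.isUniformlyC1_controlFamily (𝓗.smooth_f 1) 𝓗.isCompact_U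
  have hy := HybridControl.isSolution_drive_Ico.2 hopt'.1.dynamics₀
  have hz := HybridControl.isSolution_drive_Ico.2 hopt'.1.dynamics₁
  have hadm₁ : HybridControl.IsAdmissible (HybridControl.controlFamily (𝓗.f 1) 𝓗.U)
      (HybridControl.drive (𝓗.f 1) (Ico t_s t_f) ū) :=
    HybridControl.isAdmissible_drive (𝓗.smooth_f 1) 𝓗.isCompact_U measurableSet_Ico hmeas
      fun t _ => hmem t
  obtain ⟨r, hr, hradj⟩ := hz.exists_isAdjoint hC₁ hadm₁ hlt₁.le
    (HybridControl.differential n h (z t_f))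
  set ζr : HybridControl.Covec n := (r t_s).comp
    (show HybridControl.Eucl n →L[ℝ] HybridControl.Eucl n from
      mfderiv (𝓡 n) (𝓡 n) 𝓗.ζ (y t_s)) with hζr
  -- this multiplier makes the Hamiltonian continuous at the switching time
  set μ : ℝ := HybridControl.arcHamiltonian (𝓗.f 1) z r (t_s, ū t_s) -
    ζr (HybridControl.controlField (𝓗.f 0) w (y t_s)) with hμ
  obtain ⟨p, hp, hpadj⟩ := hy.exists_isAdjoint hC₀
    (HybridControl.isAdmissible_drive (𝓗.smooth_f 0) 𝓗.isCompact_U measurableSet_Ico hmeas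
      fun t _ => hmem t) hlt₀.le (ζr + μ • HybridControl.differential n φ (y t_s))
  have arc₀ : HybridControl.IsAdjointArc (𝓗.f 0) 𝓗.U ū y p t₀ t_s t_s :=
    ⟨𝓗.smooth_f 0, 𝓗.isCompact_U, hmeas, hmem, hlt₀.le, le_rfl, hy, hpadj⟩
  have arc₁ : HybridControl.IsAdjointArc (𝓗.f 1) 𝓗.U ū z r t_s t_f t_f :=
    ⟨𝓗.smooth_f 1, 𝓗.isCompact_U, hmeas, hmem, hlt₁.le, le_rfl, hz, hradj⟩
  have hφ1' : HybridControl.differential n φ (y t_s)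
      (HybridControl.controlField (𝓗.f 0) w (y t_s)) = 1 := hφ1
  have hH : HybridControl.arcHamiltonian (𝓗.f 0) y p (t_s, w) =
      HybridControl.arcHamiltonian (𝓗.f 1) z r (t_s, ū t_s) := by
    have e : HybridControl.arcHamiltonian (𝓗.f 0) y p (t_s, w) =
      ζr (HybridControl.controlField (𝓗.f 0) w (y t_s)) + μ *
        HybridControl.differential n φ (y t_s)
          (HybridControl.controlField (𝓗.f 0) w (y t_s)) := by
      simp only [HybridControl.arcHamiltonian, hp]
      rfl
    rw [e, hφ1', hμ]
    ring
  refine ⟨p, r, arc₀.isHamiltonianCurve fun t ht => (heq₀ t ⟨ht.1.le, ht.2⟩).symm,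
    arc₁.isHamiltonianCurve fun t ht => (heq₁ t ⟨ht.1.le, ht.2⟩).symm,
    HybridControl.minimizesHamiltonian_of_isLebesguePoint 𝓗.isCompact_U htr.measurable_u
      (fun t ht => htr.u_mem t ⟨ht.1, ht.2.trans hlt₁⟩) fun t ht hL v hv => ?_,
    HybridControl.minimizesHamiltonian_of_isLebesguePoint 𝓗.isCompact_U htr.measurable_u
      (fun t ht => htr.u_mem t ⟨hlt₀.le.trans ht.1, ht.2⟩) fun t ht hL v hv => ?_,
    hr, fun hne t ht => hradj.ne_zero hC₁ hadm₁ hz (by rw [hr]; exact hne) ht,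
    ⟨N, ?_, fun X hX => ?_, μ, ?_⟩, ?_⟩
  · rw [← heq₀ t ht]
    exact hopt'.le_before_switch hh hLs hcl arc₀ arc₁ hr hV hyV hφ hφS hφ1' hp hH ht
      (hL.congr ht.2 fun τ hτ => heq₀ τ ⟨ht.1.trans hτ.1, hτ.2⟩) hv
  · rw [← heq₁ t ht]
    exact hopt'.le_after_switch hh arc₁ hr ht
      (hL.congr ht.2 fun τ hτ => heq₁ τ ⟨ht.1.trans hτ.1, hτ.2⟩) hv
  · rintro rfl
    have h0 : HybridControl.differential n φ (y t_s) = 0 := by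
      rw [map_zero] at hN
      exact hN.symm
    rw [h0] at hφ1'
    exact zero_ne_one hφ1'
  · rw [hN]
    exact HybridControl.differential_eq_zero_of_isTangentTo hV hyV hφ hφS hX
  · rw [hN]
    exact hp.trans (congrArg (· + μ • HybridControl.differential n φ (y t_s))
      (HybridControl.cotangentMap_transport htr.jump (r t_s)).symm)
  · have e := heq₁ t_s ⟨le_rfl, hlt₁⟩
    rw [← e]
    exact hH
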